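/- **Setting.** Let $L\ge 1$, $d_1,\dots,d_L\ge 1$, $p=\prod_k d_k$, $m_k=p/d_k$, $m_{\min}=\min_k m_k$. For $\Psi_k\in\mathbb R^{d_k\times d_k}$ the Kronecker sum is $\Psi_1\oplus\dots\oplus\Psi_L=\sum_{k=1}^L I_{d_1}\otimes\dots\otimes I_{d_{k-1}}\otimes\Psi_k\otimes I_{d_{k+1}}\otimes\dots\otimes I_{d_L}\in\mathbb R^{p\times p}$. Let $\Omega_0=\Psi_1\oplus\dots\oplus\Psi_L$ be symmetric positive definite, $\Sigma_0=\Omega_0^{-1}$, $\kappa(\Sigma_0)=\|\Omega_0\|_2\|\Omega_0^{-1}\|_2$, let $s_k$ be the number of nonzero off-diagonal entries of $\Psi_k$, and $s=\sum_k m_ks_k$. Here $\|\cdot\|_2$ is the operator norm and $\|\cdot\|_F$ the Frobenius norm. Let $X_1,\dots,X_n$ be i.i.d. random tensors in $\mathbb R^{d_1\times\dots\times d_L}$ such that $\mathrm{vec}(X_i)=\Sigma_0^{1/2}Z_i$, where $Z_i\in\mathbb R^p$ has independent coordinates with mean zero, variance one and $\|Z_{ij}\|_{\psi_2}\le K$;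 here $\|Z\|_{\psi_2}=\inf\{t>0:\mathbb E\exp(Z^2/t^2)\le 2\}$. Put $\hat S=\frac1n\sum_i \mathrm{vec}(X_i)\mathrm{vec}(X_i)^T$ (with the ordering of coordinates used in the Kronecker products). For penalty levels $\rho_{n,k}$ the TeraLasso estimator $\hat\Omega$ (BiGLasso for $L=2$) is the minimizer of $$-\log\det\Omega+\langle\hat S,\Omega\rangle+\sum_{k=1}^L m_k\rho_{n,k}\sum_{i\ne j}|B_{k,ij}|$$ over all positive definite $\Omega=B_1\oplus\dots\oplus B_L$ with $B_k\in\mathbb R^{d_k\times d_k}$. **Theorem.** For every $K>0$ there are constants $a,c>0$ depending only on $K$, and for all $b\ge a$ and $\varepsilon_0>0$ there is a constant $C>0$ depending only on $K,b,\varepsilon_0$, such that the following holds for all $L$, $d_1,\dots,d_L$, $n$, $\Psi_1,\dots,\Psi_L$ and $X_1,\dots,X_n$ as above. Assume - (A1) $m_{\min}\ge\log p$, and $\rho_{n,k}=\delta_{n,k}/\varepsilon_k$ with $\varepsilon_0\le\varepsilon_k<1$ and $a\|\Sigma_0\|_2\sqrt{\tfrac{\log p}{n m_k}}\le\delta_{n,k}\le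 b\|\Sigma_0\|_2\sqrt{\tfrac{\log p}{n m_k}}$ for all $k$; - (A2) all eigenvalues of $\Omega_0$ lie in $[\underline k_\Omega,\overline k_\Omega]$ for some $0<\underline k_\Omega\le\overline k_\Omega<\infty$ (on which $a,b,c,C$ do not depend); - (A3) $n\,m_{\min}^2\ge C^2(L+1)\kappa(\Sigma_0)^4(s\log p+Lp)$. Then, with probability at least $1-L\exp(-c\log p)$, the estimator $\hat\Omega$ exists, is unique, and satisfies $$\frac{\|\hat\Omega-\Omega_0\|_F}{\|\Omega_0\|_2}\le C\,\kappa(\Sigma_0)\sqrt{\frac{s\log p+Lp}{n\,m_{\min}}},$$ $$\frac{\|\hat\Omega-\Omega_0\|_2}{\|\Omega_0\|_2}\le C\sqrt{L+1}\,\kappa(\Sigma_0)\sqrt{\frac{s\log p+Lp}{n\,m_{\min}^2}},\qquad \frac{\|\hat\Omega-\Omega_0\|_F}{\|\Omega_0\|_F}\le C\sqrt{L+1}\,\kappa(\Sigma_0)\sqrt{\frac{s\log p+Lp}{n\,m_{\min}^2}}.$$ -/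

import Mathlib

open MeasureTheory ProbabilityTheory

noncomputable section

namespace TeraLasso

/-- Multi-indices of an order-`L` tensor with dimensions `d 0, …, d (L-1)`. A tensor is a function
`Idx d → ℝ`, which is at the same time its vectorization; `p × p` matrices are indexed by `Idx d`. -/
abbrev Idx {L : ℕ} (d : Fin L → ℕ) : Type := ∀ k, Fin (d k)

/-- `p = ∏ₖ dₖ`. -/
def totalDim {L : ℕ} (d : Fin L → ℕ) : ℕ := ∏ k, d k

/-- `mₖ = ∏_{i ≠ k} dᵢ`. -/
def coDim {L : ℕ} (d : Fin L → ℕ) (k : Fin L) : ℕ := ∏ i ∈ Finset.univ.erase k, d i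

/-- `m_min = minₖ mₖ` (used for `L ≥ 1`). -/
def minCoDim {L : ℕ} (d : Fin L → ℕ) : ℕ := ⨅ k, coDim d k

/-- The Kronecker sum `Ψ₁ ⊕ ⋯ ⊕ Ψ_L = ∑ₖ I ⊗ Ψₖ ⊗ I`, entrywise: the `(i, j)` entry of the `k`-th
summand is `Ψₖ (iₖ, jₖ)` if `i` and `j` agree outside position `k`, and `0` otherwise. -/
def kroneckerSum {L : ℕ} {d : Fin L → ℕ} (Ψ : ∀ k, Matrix (Fin (d k)) (Fin (d k)) ℝ) :
    Matrix (Idx d) (Idx d) ℝ :=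
  Matrix.of fun i j => ∑ k, Ψ k (i k) (j k) *
    ∏ l ∈ Finset.univ.erase k, (1 : Matrix (Fin (d l)) (Fin (d l)) ℝ) (i l) (j l)

/-- `|A|_{1,off} = ∑_{i ≠ j} |A i j|`. -/
def offNorm {q : ℕ} (A : Matrix (Fin q) (Fin q) ℝ) : ℝ :=
  ∑ i, ∑ j ∈ Finset.univ.erase i, |A i j|

/-- The number of nonzero off-diagonal entries. -/
def offSupport {q : ℕ} (A : Matrix (Fin q) (Fin q) ℝ) : ℕ :=
  Set.ncard {ij : Fin q × Fin q | ij.1 ≠ ij.2 ∧ A ij.1 ij.2 ≠ 0}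

/-- `s = ∑ₖ mₖ sₖ`. -/
def sparsity {L : ℕ} {d : Fin L → ℕ} (Ψ : ∀ k, Matrix (Fin (d k)) (Fin (d k)) ℝ) : ℕ :=
  ∑ k, coDim d k * offSupport (Ψ k)

/-- The operator norm with respect to the Euclidean norms. -/
def opNorm {ι : Type*} [Fintype ι] [DecidableEq ι] (A : Matrix ι ι ℝ) : ℝ :=
  ‖Matrix.toEuclideanCLM (n := ι) (𝕜 := ℝ) A‖

/-- The Frobenius norm. -/
def frobNorm {ι : Type*} [Fintype ι] (A : Matrix ι ι ℝ) : ℝ :=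
  Real.sqrt (∑ i, ∑ j, A i j ^ 2)

/-- The condition number `‖A‖₂ ‖A⁻¹‖₂` of an invertible matrix. -/
def condNumber {ι : Type*} [Fintype ι] [DecidableEq ι] (A : Matrix ι ι ℝ) : ℝ :=
  opNorm A * opNorm A⁻¹

/-- `A` is symmetric with all eigenvalues in `[lo, hi]`. -/
def SpectrumWithin {ι : Type*} [Fintype ι] [DecidableEq ι] (A : Matrix ι ι ℝ) (lo hi : ℝ) : Prop :=
  A.IsHermitian ∧ ∀ t ∈ spectrum ℝ A, lo ≤ t ∧ t ≤ hi

/-- The norm `‖Z‖_{ψ₂} = inf {t > 0 : E exp(Z² / t²) ≤ 2}`, which is `∞` if there is no such `t`. -/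
def psiTwoNorm {S : Type*} [MeasurableSpace S] (μ : Measure S) (Z : S → ℝ) : ENNReal :=
  ⨅ (t : ℝ) (_ : 0 < t) (_ : ∫⁻ ω, ENNReal.ofReal (Real.exp (Z ω ^ 2 / t ^ 2)) ∂μ ≤ 2),
    ENNReal.ofReal t

/-- `X` is a sub-gaussian random vector (tensor) with covariance `cov`: `X = cov^{1/2} Z`, where
`cov^{1/2}` is the positive semidefinite square root and `Z` has independent coordinates with mean
zero, unit variance, and `ψ₂`-norm at most `K`. -/
def IsSubGaussianTensor {S : Type*} [MeasurableSpace S] (μ : Measure S) {ι : Type*} [Fintype ι]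
    (K : ℝ) (cov : Matrix ι ι ℝ) (X : S → ι → ℝ) : Prop :=
  ∃ (R : Matrix ι ι ℝ) (Z : ι → S → ℝ),
    R.PosSemidef ∧ R * R = cov ∧
    (∀ j, Measurable (Z j)) ∧ iIndepFun Z μ ∧
    (∀ j, ∫ ω, Z j ω ∂μ = 0) ∧ (∀ j, ∫ ω, Z j ω ^ 2 ∂μ = 1) ∧
    (∀ j, psiTwoNorm μ (Z j) ≤ ENNReal.ofReal K) ∧
    ∀ ω, X ω = R.mulVec fun j => Z j ω

/-- The sample covariance `n⁻¹ ∑ᵢ xᵢ xᵢᵀ`. -/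
def sampleCov {ι : Type*} {n : ℕ} (x : Fin n → ι → ℝ) : Matrix ι ι ℝ :=
  (n : ℝ)⁻¹ • ∑ i, Matrix.vecMulVec (x i) (x i)

/-- The objective `-log |Ω| + ⟨S, Ω⟩ + ∑ₖ mₖ ρₖ |Ψₖ|_{1,off}` at `Ω = Ψ₁ ⊕ ⋯ ⊕ Ψ_L`. It depends on
`Ω` only, since the off-diagonal entries of the factors are determined by `Ω`. -/
def objective {L : ℕ} {d : Fin L → ℕ} (S : Matrix (Idx d) (Idx d) ℝ) (ρ : Fin L → ℝ)
    (Ψ : ∀ k, Matrix (Fin (d k)) (Fin (d k)) ℝ) : ℝ :=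
  -Real.log (kroneckerSum Ψ).det + (S.transpose * kroneckerSum Ψ).trace +
    ∑ k, (coDim d k : ℝ) * ρ k * offNorm (Ψ k)

/-- `Ωhat` minimizes the objective over the positive definite Kronecker sums. -/
def IsEstimator {L : ℕ} {d : Fin L → ℕ} (S : Matrix (Idx d) (Idx d) ℝ) (ρ : Fin L → ℝ)
    (Ωhat : Matrix (Idx d) (Idx d) ℝ) : Prop :=
  Ωhat.PosDef ∧ ∃ Ψ : ∀ k, Matrix (Fin (d k)) (Fin (d k)) ℝ, Ωhat = kroneckerSum Ψ ∧
    ∀ Ψ' : ∀ k, Matrix (Fin (d k)) (Fin (d k)) ℝ, (kroneckerSum Ψ').PosDef →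
      objective S ρ Ψ ≤ objective S ρ Ψ'

/-- `(s log p + L p)`. -/
def complexity {L : ℕ} {d : Fin L → ℕ} (Ψ : ∀ k, Matrix (Fin (d k)) (Fin (d k)) ℝ) : ℝ :=
  sparsity Ψ * Real.log (totalDim d) + L * totalDim d

end TeraLasso

end

open TeraLasso

open scoped Matrix

namespace TeraLasso

section Norms

variable {ι : Type*} [Fintype ι]

lemma frobNorm_nonneg (A : Matrix ι ι ℝ) : 0 ≤ frobNorm A := Real.sqrt_nonneg _

lemma frobNorm_sq (A : Matrix ι ι ℝ) : frobNorm A ^ 2 = ∑ i, ∑ j, A i j ^ 2 :=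
  Real.sq_sqrt (Finset.sum_nonneg fun _ _ => Finset.sum_nonneg fun _ _ => sq_nonneg _)

lemma frobNorm_transpose (A : Matrix ι ι ℝ) : frobNorm Aᵀ = frobNorm A := by
  unfold frobNorm
  rw [Finset.sum_comm]
  rfl

lemma trace_transpose_mul_eq_sum (A B : Matrix ι ι ℝ) :
    (Aᵀ * B).trace = ∑ i, ∑ j, A i j * B i j := by
  rw [Finset.sum_comm]
  simp [Matrix.trace, Matrix.mul_apply]

lemma frobNorm_smul (t : ℝ) (A : Matrix ι ι ℝ) : frobNorm (t • A) = |t| * frobNorm A := by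
  unfold frobNorm
  rw [← Real.sqrt_sq_eq_abs, ← Real.sqrt_mul (sq_nonneg t)]
  simp [mul_pow, Finset.mul_sum]

lemma frobNorm_eq_zero {A : Matrix ι ι ℝ} (h : frobNorm A = 0) : A = 0 := by
  have h2 := frobNorm_sq A
  rw [h, zero_pow two_ne_zero] at h2
  ext i j
  have h3 : A i j ^ 2 ≤ ∑ i, ∑ j, A i j ^ 2 :=
    (Finset.single_le_sum (f := fun j => A i j ^ 2) (fun _ _ => sq_nonneg _)
      (Finset.mem_univ j)).trans
    (Finset.single_le_sum (f := fun i => ∑ j, A i j ^ 2)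
      (fun _ _ => Finset.sum_nonneg fun _ _ => sq_nonneg _) (Finset.mem_univ i))
  rw [← h2] at h3
  exact pow_eq_zero_iff two_ne_zero |>.1 (le_antisymm h3 (sq_nonneg _))

variable [DecidableEq ι]

open scoped Matrix.Norms.L2Operator in
lemma opNorm_eq_norm (A : Matrix ι ι ℝ) : opNorm A = ‖A‖ := rfl

lemma opNorm_nonneg (A : Matrix ι ι ℝ) : 0 ≤ opNorm A := norm_nonneg _

open scoped Matrix.Norms.L2Operator in
lemma opNorm_mul_le (A B : Matrix ι ι ℝ) : opNorm (A * B) ≤ opNorm A * opNorm B := by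
  simp only [opNorm_eq_norm]; exact norm_mul_le _ _

open scoped Matrix.Norms.L2Operator in
lemma opNorm_sum_le {κ : Type*} (s : Finset κ) (f : κ → Matrix ι ι ℝ) :
    opNorm (∑ k ∈ s, f k) ≤ ∑ k ∈ s, opNorm (f k) := by
  simp only [opNorm_eq_norm]; exact norm_sum_le _ _

open scoped Matrix.Norms.L2Operator in
lemma opNorm_smul (t : ℝ) (A : Matrix ι ι ℝ) : opNorm (t • A) = |t| * opNorm A := by
  simp only [opNorm_eq_norm, norm_smul, Real.norm_eq_abs]

open scoped Matrix.Norms.L2Operator in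
lemma opNorm_transpose (A : Matrix ι ι ℝ) : opNorm Aᵀ = opNorm A := by
  simp only [opNorm_eq_norm]
  rw [← Matrix.conjTranspose_eq_transpose_of_trivial, Matrix.l2_opNorm_conjTranspose]

open scoped Matrix.Norms.L2Operator in
lemma opNorm_transpose_mul_self (A : Matrix ι ι ℝ) : opNorm (Aᵀ * A) = opNorm A ^ 2 := by
  simp only [opNorm_eq_norm]
  rw [← Matrix.conjTranspose_eq_transpose_of_trivial, Matrix.l2_opNorm_conjTranspose_mul_self, sq]

open scoped Matrix.Norms.L2Operator in
lemma opNorm_one [Nonempty ι] : opNorm (1 : Matrix ι ι ℝ) = 1 := by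
  rw [opNorm_eq_norm]; exact norm_one

open scoped Matrix.Norms.L2Operator in
lemma sum_sq_mulVec_le (A : Matrix ι ι ℝ) (x : ι → ℝ) :
    ∑ i, (A *ᵥ x) i ^ 2 ≤ opNorm A ^ 2 * ∑ i, x i ^ 2 := by
  have h := Matrix.l2_opNorm_mulVec A (WithLp.toLp 2 x)
  have h2 := pow_le_pow_left₀ (norm_nonneg _) h 2
  rw [mul_pow, EuclideanSpace.norm_sq_eq, EuclideanSpace.norm_sq_eq] at h2
  simpa [Real.norm_eq_abs, sq_abs, opNorm_eq_norm] using h2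

lemma opNorm_le_of_sum_sq_mulVec_le {A : Matrix ι ι ℝ} {c : ℝ} (hc : 0 ≤ c)
    (h : ∀ x : ι → ℝ, ∑ i, (A *ᵥ x) i ^ 2 ≤ c ^ 2 * ∑ i, x i ^ 2) : opNorm A ≤ c := by
  refine ContinuousLinearMap.opNorm_le_bound _ hc fun x => ?_
  refine le_of_sq_le_sq ?_ (by positivity)
  rw [mul_pow, EuclideanSpace.norm_sq_eq, EuclideanSpace.norm_sq_eq]
  simpa [Real.norm_eq_abs, sq_abs] using h x.ofLp

lemma frobNorm_mul_le_opNorm_mul (A B : Matrix ι ι ℝ) :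
    frobNorm (A * B) ≤ opNorm A * frobNorm B := by
  refine le_of_sq_le_sq ?_ (mul_nonneg (opNorm_nonneg _) (frobNorm_nonneg _))
  rw [mul_pow, frobNorm_sq, frobNorm_sq, Finset.sum_comm,
    Finset.sum_comm (f := fun i j => B i j ^ 2), Finset.mul_sum]
  refine Finset.sum_le_sum fun j _ => ?_
  simpa [Matrix.mulVec, dotProduct, Matrix.mul_apply] using sum_sq_mulVec_le A fun i => B i j

lemma frobNorm_mul_le_mul_opNorm (A B : Matrix ι ι ℝ) :
    frobNorm (A * B) ≤ frobNorm A * opNorm B := by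
  rw [← frobNorm_transpose, Matrix.transpose_mul, ← opNorm_transpose B, ← frobNorm_transpose A,
    mul_comm (frobNorm _)]
  exact frobNorm_mul_le_opNorm_mul _ _

lemma frobNorm_mul_mul_le (A M B : Matrix ι ι ℝ) :
    frobNorm (A * M * B) ≤ opNorm A * opNorm B * frobNorm M := by
  calc frobNorm (A * M * B) ≤ frobNorm (A * M) * opNorm B := frobNorm_mul_le_mul_opNorm _ _
    _ ≤ opNorm A * frobNorm M * opNorm B := by
      gcongr
      · exact opNorm_nonneg _
      · exact frobNorm_mul_le_opNorm_mul _ _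
    _ = _ := by ring

lemma opNorm_mul_mul_le (A M B : Matrix ι ι ℝ) :
    opNorm (A * M * B) ≤ opNorm A * opNorm B * opNorm M := by
  calc opNorm (A * M * B) ≤ opNorm (A * M) * opNorm B := opNorm_mul_le _ _
    _ ≤ opNorm A * opNorm M * opNorm B := by
      gcongr
      · exact opNorm_nonneg _
      · exact opNorm_mul_le _ _
    _ = _ := by ring

end Norms

section Spectral

variable {ι : Type*} [Fintype ι] [DecidableEq ι]

lemma exists_orthogonal_diagonalization {H : Matrix ι ι ℝ} (hH : H.IsHermitian) :
    ∃ (U : Matrix ι ι ℝ) (h : ι → ℝ), Uᵀ * U = 1 ∧ U * Uᵀ = 1 ∧ H = U * Matrix.diagonal h * Uᵀ := by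
  refine ⟨hH.eigenvectorUnitary, hH.eigenvalues, ?_, ?_, ?_⟩
  · have := Unitary.coe_star_mul_self hH.eigenvectorUnitary
    rwa [Matrix.star_eq_conjTranspose, Matrix.conjTranspose_eq_transpose_of_trivial] at this
  · have := Unitary.coe_mul_star_self hH.eigenvectorUnitary
    rwa [Unitary.coe_star, Matrix.star_eq_conjTranspose,
      Matrix.conjTranspose_eq_transpose_of_trivial] at this
  · conv_lhs => rw [hH.spectral_theorem, Unitary.conjStarAlgAut_apply]
    rw [Matrix.star_eq_conjTranspose, Matrix.conjTranspose_eq_transpose_of_trivial]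
    rfl

lemma opNorm_diagonal_entry_le (h : ι → ℝ) (i : ι) : |h i| ≤ opNorm (Matrix.diagonal h) := by
  have := sum_sq_mulVec_le (Matrix.diagonal h) (Pi.single i 1)
  refine abs_le_of_sq_le_sq ?_ (opNorm_nonneg _)
  simpa [Pi.single_apply, Matrix.mulVec_diagonal, ite_pow] using this

lemma opNorm_orthogonal_le {U : Matrix ι ι ℝ} (hU : Uᵀ * U = 1) : opNorm U ≤ 1 := by
  refine opNorm_le_of_sum_sq_mulVec_le zero_le_one fun x => le_of_eq ?_
  have : (U *ᵥ x) ⬝ᵥ (U *ᵥ x) = x ⬝ᵥ x := by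
    rw [Matrix.dotProduct_mulVec, Matrix.vecMul_mulVec, hU, Matrix.vecMul_one]
  simpa [dotProduct, sq] using this

open scoped MatrixOrder in
/-- A positive definite `A` and a symmetric `D` are simultaneously diagonalizable by congruence. The
numbers `h i` are the eigenvalues of `A^{-1/2} D A^{-1/2}`. -/
lemma exists_relative_eigenvalues {A D : Matrix ι ι ℝ} (hA : A.PosDef) (hD : D.IsHermitian) :
    ∃ h : ι → ℝ, (∀ t : ℝ, (A + t • D).det = A.det * ∏ i, (1 + t * h i)) ∧
      (∀ t : ℝ, (A + t • D).PosDef ↔ ∀ i, 0 < 1 + t * h i) ∧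
      (A⁻¹ * D).trace = ∑ i, h i ∧
      (∀ i, |h i| ≤ opNorm A⁻¹ * opNorm D) ∧
      frobNorm D ^ 2 ≤ opNorm A ^ 2 * ∑ i, h i ^ 2 := by
  obtain ⟨B, hB, hAB⟩ :=
    CStarAlgebra.isStrictlyPositive_iff_eq_star_mul_self.1 hA.isStrictlyPositive
  rw [Matrix.star_eq_conjTranspose, Matrix.conjTranspose_eq_transpose_of_trivial] at hAB
  have hBd : IsUnit B.det := (Matrix.isUnit_iff_isUnit_det B).1 hB
  have hBB : B * B⁻¹ = 1 := Matrix.mul_nonsing_inv _ hBd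
  have hBB' : B⁻¹ * B = 1 := Matrix.nonsing_inv_mul _ hBd
  have hBBt : Bᵀ * B⁻¹ᵀ = 1 := by rw [← Matrix.transpose_mul, hBB', Matrix.transpose_one]
  have hBBt' : B⁻¹ᵀ * Bᵀ = 1 := by rw [← Matrix.transpose_mul, hBB, Matrix.transpose_one]
  have hAinv : A⁻¹ = B⁻¹ * B⁻¹ᵀ := by
    refine Matrix.inv_eq_right_inv ?_
    calc A * (B⁻¹ * B⁻¹ᵀ) = Bᵀ * (B * B⁻¹) * B⁻¹ᵀ := by rw [hAB]; simp only [Matrix.mul_assoc]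
      _ = 1 := by rw [hBB, Matrix.mul_one, hBBt]
  have hH : (B⁻¹ᵀ * D * B⁻¹).IsHermitian := by
    have := Matrix.isHermitian_conjTranspose_mul_mul B⁻¹ hD
    rwa [Matrix.conjTranspose_eq_transpose_of_trivial] at this
  obtain ⟨U, h, hU, hU', hUh⟩ := exists_orthogonal_diagonalization hH
  have hDeq : D = Bᵀ * (U * Matrix.diagonal h * Uᵀ) * B := by
    rw [← hUh]
    calc D = (Bᵀ * B⁻¹ᵀ) * D * (B⁻¹ * B) := by rw [hBBt, hBB']; simp
      _ = _ := by simp only [Matrix.mul_assoc]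
  have hAeq : ∀ t : ℝ, A + t • D =
      (Uᵀ * B)ᵀ * Matrix.diagonal (fun i => 1 + t * h i) * (Uᵀ * B) := by
    intro t
    have hdiag : Matrix.diagonal (fun i => 1 + t * h i) = 1 + t • Matrix.diagonal h := by
      ext i j
      by_cases hij : i = j <;> simp [Matrix.diagonal, hij]
    rw [hdiag, Matrix.mul_add, Matrix.add_mul, Matrix.mul_one, Matrix.transpose_mul,
      Matrix.transpose_transpose]
    congr 1
    · calc A = Bᵀ * (U * Uᵀ) * B := by rw [hU', Matrix.mul_one, hAB]
        _ = _ := by simp only [Matrix.mul_assoc]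
    · conv_lhs => rw [hDeq]
      simp only [Matrix.mul_assoc, Matrix.mul_smul, Matrix.smul_mul]
  have hUBu : IsUnit (Uᵀ * B) := by
    refine IsUnit.mul ?_ hB
    exact IsUnit.of_mul_eq_one _ hU
  refine ⟨h, fun t => ?_, fun t => ?_, ?_, fun i => ?_, ?_⟩
  · have h0 := hAeq 0
    simp only [zero_smul, add_zero, zero_mul, Matrix.diagonal_one, Matrix.mul_one] at h0
    rw [hAeq t, h0, Matrix.det_mul, Matrix.det_mul, Matrix.det_mul _ (Uᵀ * B), Matrix.det_diagonal]
    ring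
  · rw [hAeq t, ← Matrix.conjTranspose_eq_transpose_of_trivial]
    rw [← Matrix.posDef_diagonal_iff (R := ℝ) (d := fun i => 1 + t * h i)]
    constructor
    · intro hp
      have hd : IsUnit (Uᵀ * B).det := (Matrix.isUnit_iff_isUnit_det _).1 hUBu
      have := hp.conjTranspose_mul_mul_same (B := (Uᵀ * B)⁻¹)
        (Matrix.mulVec_injective_of_isUnit ((Matrix.isUnit_nonsing_inv_iff).2 hUBu))
      have e : (Uᵀ * B)⁻¹ᴴ * ((Uᵀ * B)ᴴ * Matrix.diagonal (fun i => 1 + t * h i) * (Uᵀ * B)) *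
          (Uᵀ * B)⁻¹ = ((Uᵀ * B) * (Uᵀ * B)⁻¹)ᴴ * Matrix.diagonal (fun i => 1 + t * h i) *
            ((Uᵀ * B) * (Uᵀ * B)⁻¹) := by
        rw [Matrix.conjTranspose_mul (Uᵀ * B)]
        simp only [Matrix.mul_assoc]
      rw [e, Matrix.mul_nonsing_inv _ hd] at this
      simpa using this
    · intro hp
      exact hp.conjTranspose_mul_mul_same (Matrix.mulVec_injective_of_isUnit hUBu)
  · calc (A⁻¹ * D).trace = (B⁻¹ᵀ * D * B⁻¹).trace := by
          rw [hAinv, Matrix.mul_assoc, Matrix.trace_mul_comm]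
      _ = ∑ i, h i := by
          rw [hUh, Matrix.trace_mul_comm, ← Matrix.mul_assoc, hU, Matrix.one_mul,
            Matrix.trace_diagonal]
  · have hd : Matrix.diagonal h = Uᵀ * (B⁻¹ᵀ * D * B⁻¹) * U := by
      rw [hUh]
      calc Matrix.diagonal h = (Uᵀ * U) * Matrix.diagonal h * (Uᵀ * U) := by rw [hU]; simp
        _ = _ := by simp only [Matrix.mul_assoc]
    have hU1 := opNorm_orthogonal_le hU
    have hAn : opNorm A⁻¹ = opNorm B⁻¹ ^ 2 := by
      rw [hAinv, ← opNorm_transpose B⁻¹, ← opNorm_transpose_mul_self, Matrix.transpose_transpose]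
    calc |h i| ≤ opNorm (Matrix.diagonal h) := opNorm_diagonal_entry_le h i
      _ ≤ opNorm Uᵀ * opNorm U * opNorm (B⁻¹ᵀ * D * B⁻¹) := by rw [hd]; exact opNorm_mul_mul_le _ _ _
      _ ≤ 1 * 1 * (opNorm B⁻¹ᵀ * opNorm B⁻¹ * opNorm D) := by
        rw [opNorm_transpose]
        have := opNorm_mul_mul_le B⁻¹ᵀ D B⁻¹
        gcongr
        · exact opNorm_nonneg _
        · exact opNorm_nonneg _
      _ = _ := by rw [opNorm_transpose, hAn]; ring
  · have hAn : opNorm A = opNorm B ^ 2 := by rw [hAB, opNorm_transpose_mul_self]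
    have h1 : frobNorm D ≤ opNorm A * frobNorm (U * Matrix.diagonal h * Uᵀ) := by
      conv_lhs => rw [hDeq]
      refine (frobNorm_mul_mul_le _ _ _).trans (le_of_eq ?_)
      rw [opNorm_transpose, hAn, sq]
    have h2 : frobNorm (U * Matrix.diagonal h * Uᵀ) ≤ frobNorm (Matrix.diagonal h) := by
      refine (frobNorm_mul_mul_le _ _ _).trans ?_
      have hU1 := opNorm_orthogonal_le hU
      rw [opNorm_transpose]
      have := opNorm_nonneg U
      calc _ ≤ 1 * 1 * frobNorm (Matrix.diagonal h) := by
            gcongr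
            exact frobNorm_nonneg _
        _ = _ := by ring
    have h3 : frobNorm (Matrix.diagonal h) ^ 2 = ∑ i, h i ^ 2 := by
      rw [frobNorm_sq]
      refine Finset.sum_congr rfl fun i _ => ?_
      rw [Finset.sum_eq_single i] <;> simp +contextual [eq_comm]
    rw [← h3, ← mul_pow]
    have := opNorm_nonneg A
    exact pow_le_pow_left₀ (frobNorm_nonneg _) (h1.trans (by gcongr)) 2

lemma log_one_add_le_sub_sq {h : ℝ} (hh : |h| ≤ 1 / 5) : Real.log (1 + h) ≤ h - h ^ 2 / 4 := by
  have h1 := Real.abs_log_sub_add_sum_range_le (x := -h) (by rw [abs_neg]; linarith) 2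
  have h2 := (abs_le.1 h1).2
  simp only [Finset.sum_range_succ, Finset.sum_range_zero, abs_neg, sub_neg_eq_add] at h2
  have h3 : |h| ^ (2 + 1) / (1 - |h|) ≤ h ^ 2 / 4 := by
    rw [div_le_iff₀ (by linarith), ← sq_abs h]
    nlinarith [sq_nonneg |h|, abs_nonneg h]
  norm_num at h2 h3
  linarith

/-- Quadratic growth of `-log det` around a positive definite matrix. -/
lemma neg_log_det_ge {A D : Matrix ι ι ℝ} (hA : A.PosDef) (hD : D.IsHermitian)
    (hsmall : opNorm A⁻¹ * opNorm D ≤ 1 / 5) :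
    (A + D).PosDef ∧ frobNorm D ^ 2 ≤
      4 * opNorm A ^ 2 * (-Real.log (A + D).det + Real.log A.det + (A⁻¹ * D).trace) := by
  obtain ⟨h, hdet, hpos, htr, hle, hF⟩ := exists_relative_eigenvalues hA hD
  have h1 : ∀ i, |h i| ≤ 1 / 5 := fun i => (hle i).trans hsmall
  have h2 : ∀ i, 0 < 1 + h i := fun i => by linarith [(abs_le.1 (h1 i)).1]
  have hd := hdet 1
  have hp := hpos 1
  simp only [one_smul, one_mul] at hd hp
  refine ⟨hp.2 h2, ?_⟩
  have hl : Real.log (A + D).det = Real.log A.det + ∑ i, Real.log (1 + h i) := by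
    rw [hd, Real.log_mul hA.det_pos.ne' (Finset.prod_ne_zero_iff.2 fun i _ => (h2 i).ne'),
      Real.log_prod (fun i _ => (h2 i).ne')]
  have hs : ∑ i, Real.log (1 + h i) ≤ ∑ i, h i - (∑ i, h i ^ 2) / 4 := by
    rw [Finset.sum_div, ← Finset.sum_sub_distrib]
    exact Finset.sum_le_sum fun i _ => log_one_add_le_sub_sq (h1 i)
  have : 0 ≤ opNorm A ^ 2 := sq_nonneg _
  rw [hl, htr]
  nlinarith

/-- `log det` is strictly concave on positive definite matrices. -/
lemma log_det_strictConcave {A B : Matrix ι ι ℝ} (hA : A.PosDef) (hB : B.PosDef) {t : ℝ}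
    (ht0 : 0 < t) (ht1 : t < 1) :
    ((1 - t) • A + t • B).PosDef ∧
    (1 - t) * Real.log A.det + t * Real.log B.det ≤ Real.log ((1 - t) • A + t • B).det ∧
    (A ≠ B →
      (1 - t) * Real.log A.det + t * Real.log B.det < Real.log ((1 - t) • A + t • B).det) := by
  obtain ⟨h, hdet, hpos, htr, hle, hF⟩ :=
    exists_relative_eigenvalues hA (hB.isHermitian.sub hA.isHermitian)
  have e1 : A + (1 : ℝ) • (B - A) = B := by simp
  have et : A + t • (B - A) = (1 - t) • A + t • B := by
    rw [smul_sub, sub_smul, one_smul]; abel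
  have h1 : ∀ i, 0 < 1 + h i := by
    have := hpos 1
    rw [e1] at this
    simpa using this.1 hB
  have h2 : ∀ i, 0 < 1 + t * h i := fun i => by nlinarith [h1 i]
  have hlog : ∀ s : ℝ, (∀ i, 0 < 1 + s * h i) →
      Real.log (A + s • (B - A)).det = Real.log A.det + ∑ i, Real.log (1 + s * h i) := by
    intro s hs
    rw [hdet, Real.log_mul hA.det_pos.ne' (Finset.prod_ne_zero_iff.2 fun i _ => (hs i).ne'),
      Real.log_prod (fun i _ => (hs i).ne')]
  have hl1 := hlog 1 (by simpa using h1)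
  have hl2 := hlog t h2
  rw [e1] at hl1
  rw [et] at hl2
  simp only [one_mul] at hl1
  have hle : ∀ i, t * Real.log (1 + h i) ≤ Real.log (1 + t * h i) := by
    intro i
    have := strictConcaveOn_log_Ioi.concaveOn.2 (Set.mem_Ioi.2 one_pos)
      (Set.mem_Ioi.2 (h1 i)) (sub_nonneg.2 ht1.le) ht0.le (sub_add_cancel 1 t)
    simp only [smul_eq_mul, Real.log_one, mul_zero, zero_add] at this
    rwa [show (1 - t) * 1 + t * (1 + h i) = 1 + t * h i by ring] at this
  have hlt : ∀ i, h i ≠ 0 → t * Real.log (1 + h i) < Real.log (1 + t * h i) := by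
    intro i hi
    have := strictConcaveOn_log_Ioi.2 (Set.mem_Ioi.2 one_pos) (Set.mem_Ioi.2 (h1 i))
      (by simpa using hi) (sub_pos.2 ht1) ht0 (sub_add_cancel 1 t)
    simp only [smul_eq_mul, Real.log_one, mul_zero, zero_add] at this
    rwa [show (1 - t) * 1 + t * (1 + h i) = 1 + t * h i by ring] at this
  refine ⟨?_, ?_, fun hne => ?_⟩
  · rw [← et]; exact (hpos t).2 h2
  · rw [hl1, hl2, mul_add, Finset.mul_sum]
    have := Finset.sum_le_sum fun i (_ : i ∈ Finset.univ) => hle i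
    linarith
  · have hex : ∃ i, h i ≠ 0 := by
      by_contra hcon
      push Not at hcon
      simp only [hcon] at hF
      have : frobNorm (B - A) = 0 := by
        have h0 := sq_nonneg (frobNorm (B - A))
        refine pow_eq_zero_iff two_ne_zero |>.1 (le_antisymm (by simpa using hF) h0)
      exact hne (sub_eq_zero.1 (frobNorm_eq_zero this)).symm
    obtain ⟨i, hi⟩ := hex
    rw [hl1, hl2, mul_add, Finset.mul_sum]
    have := Finset.sum_lt_sum (fun i (_ : i ∈ Finset.univ) => hle i) ⟨i, Finset.mem_univ _, hlt i hi⟩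
    linarith

end Spectral

section Dimensions

variable {L : ℕ} {d : Fin L → ℕ}

lemma totalDim_eq_mul_coDim (k : Fin L) : totalDim d = d k * coDim d k :=
  (Finset.mul_prod_erase _ _ (Finset.mem_univ k)).symm

lemma card_idx : Fintype.card (Idx d) = totalDim d := by
  simp [Idx, totalDim]

lemma totalDim_pos (hd : ∀ k, 0 < d k) : 0 < totalDim d := Finset.prod_pos fun k _ => hd k

lemma coDim_pos (hd : ∀ k, 0 < d k) (k : Fin L) : 0 < coDim d k := Finset.prod_pos fun k _ => hd k

lemma minCoDim_le (k : Fin L) : minCoDim d ≤ coDim d k := ciInf_le (OrderBot.bddBelow _) k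

lemma exists_coDim_eq_minCoDim (hL : 1 ≤ L) : ∃ k, coDim d k = minCoDim d := by
  have : Nonempty (Fin L) := ⟨⟨0, hL⟩⟩
  exact ciInf_mem (coDim d)

lemma minCoDim_pos (hL : 1 ≤ L) (hd : ∀ k, 0 < d k) : 0 < minCoDim d := by
  obtain ⟨k, hk⟩ := exists_coDim_eq_minCoDim (d := d) hL
  rw [← hk]; exact coDim_pos hd k

lemma dim_mul_minCoDim_le (k : Fin L) : d k * minCoDim d ≤ totalDim d := by
  rw [totalDim_eq_mul_coDim k]
  exact Nat.mul_le_mul_left _ (minCoDim_le k)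

lemma sum_dim_mul_minCoDim_le : (∑ k, d k) * minCoDim d ≤ L * totalDim d := by
  rw [Finset.sum_mul]
  refine (Finset.sum_le_sum fun k _ => dim_mul_minCoDim_le k).trans (le_of_eq (by simp))

end Dimensions

section Modes

variable {L : ℕ} {d : Fin L → ℕ}

/-- `I ⊗ ⋯ ⊗ B ⊗ ⋯ ⊗ I` with `B` in position `k`. -/
def modeEmbed (k : Fin L) (B : Matrix (Fin (d k)) (Fin (d k)) ℝ) : Matrix (Idx d) (Idx d) ℝ :=
  Matrix.of fun i j => B (i k) (j k) *
    ∏ l ∈ Finset.univ.erase k, (1 : Matrix (Fin (d l)) (Fin (d l)) ℝ) (i l) (j l)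

lemma kroneckerSum_eq_sum_modeEmbed (Ψ : ∀ k, Matrix (Fin (d k)) (Fin (d k)) ℝ) :
    kroneckerSum Ψ = ∑ k, modeEmbed k (Ψ k) := by
  ext i j
  simp [kroneckerSum, modeEmbed, Matrix.sum_apply]

lemma modeEmbed_apply_update (k : Fin L) (B : Matrix (Fin (d k)) (Fin (d k)) ℝ) (i : Idx d)
    (b : Fin (d k)) : modeEmbed k B i (Function.update i k b) = B (i k) b := by
  simp only [modeEmbed, Matrix.of_apply, Function.update_self]
  rw [Finset.prod_eq_one, mul_one]
  intro l hl
  rw [Function.update_of_ne (Finset.ne_of_mem_erase hl), Matrix.one_apply_eq]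

lemma modeEmbed_apply_eq_zero (k : Fin L) (B : Matrix (Fin (d k)) (Fin (d k)) ℝ) {i j : Idx d}
    (h : ∃ l, l ≠ k ∧ i l ≠ j l) : modeEmbed k B i j = 0 := by
  obtain ⟨l, hl, hij⟩ := h
  simp only [modeEmbed, Matrix.of_apply]
  refine mul_eq_zero_of_right _ ?_
  exact Finset.prod_eq_zero (Finset.mem_erase.2 ⟨hl, Finset.mem_univ _⟩) (Matrix.one_apply_ne hij)

lemma modeEmbed_apply_self (k : Fin L) (B : Matrix (Fin (d k)) (Fin (d k)) ℝ) (i : Idx d) :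
    modeEmbed k B i i = B (i k) (i k) := by
  have := modeEmbed_apply_update k B i (i k)
  rwa [Function.update_eq_self] at this

/-- Sums over a row of `modeEmbed k B` reduce to sums over a row of `B`. -/
lemma sum_modeEmbed_row (k : Fin L) (B : Matrix (Fin (d k)) (Fin (d k)) ℝ) (i : Idx d)
    (G : Idx d → ℝ → ℝ) (hG : ∀ j, G j 0 = 0) :
    ∑ j, G j (modeEmbed k B i j) = ∑ b, G (Function.update i k b) (B (i k) b) := by
  have hinj : Function.Injective fun b => Function.update i k b := Function.update_injective i k
  rw [← Finset.sum_subset (Finset.subset_univ (Finset.univ.image fun b => Function.update i k b)),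
    Finset.sum_image hinj.injOn]
  · simp only [modeEmbed_apply_update]
  · intro j _ hj
    rw [modeEmbed_apply_eq_zero, hG]
    by_contra hcon
    push Not at hcon
    refine hj (Finset.mem_image.2 ⟨j k, Finset.mem_univ _, ?_⟩)
    funext l
    by_cases hl : l = k
    · subst hl; simp
    · rw [Function.update_of_ne hl, hcon l hl]

/-- Exchanging the `k`-th coordinate with an independent one. -/
lemma sum_sum_update_swap (k : Fin L) (F : Idx d → Fin (d k) → ℝ) :
    ∑ i, ∑ a, F i a = ∑ i : Idx d, ∑ a, F (Function.update i k a) (i k) := by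
  rw [← Fintype.sum_prod_type', ← Fintype.sum_prod_type' (f := fun i a =>
    F (Function.update i k a) (i k))]
  refine Finset.sum_nbij' (fun x => (Function.update x.1 k x.2, x.1 k))
    (fun x => (Function.update x.1 k x.2, x.1 k)) ?_ ?_ ?_ ?_ ?_ <;> simp

lemma sum_coord (hd : ∀ k, 0 < d k) (k : Fin L) (c : Fin (d k) → ℝ) :
    ∑ i : Idx d, c (i k) = coDim d k * ∑ a, c a := by
  have h := sum_sum_update_swap k fun (i : Idx d) _ => c (i k)
  simp only [Function.update_self, Finset.sum_const, Finset.card_univ, Fintype.card_fin,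
    nsmul_eq_mul, card_idx] at h
  rw [← Finset.mul_sum, totalDim_eq_mul_coDim k] at h
  have hk : (0 : ℝ) < d k := by exact_mod_cast hd k
  push_cast at h
  rw [mul_assoc] at h
  exact mul_left_cancel₀ hk.ne' h

lemma sum_update_eq_zero (hd : ∀ k, 0 < d k) (k : Fin L) (F : Idx d → ℝ)
    (h : ∀ i, ∑ a, F (Function.update i k a) = 0) : ∑ i, F i = 0 := by
  have h1 := sum_sum_update_swap k fun (i : Idx d) _ => F i
  simp only [h, Finset.sum_const_zero, Finset.sum_const, Finset.card_univ, Fintype.card_fin,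
    nsmul_eq_mul] at h1
  rw [← Finset.mul_sum] at h1
  have hk : (d k : ℝ) ≠ 0 := by exact_mod_cast (hd k).ne'
  exact (mul_eq_zero.1 h1).resolve_left hk

lemma frobNorm_modeEmbed_sq (hd : ∀ k, 0 < d k) (k : Fin L)
    (B : Matrix (Fin (d k)) (Fin (d k)) ℝ) :
    frobNorm (modeEmbed k B) ^ 2 = coDim d k * frobNorm B ^ 2 := by
  rw [frobNorm_sq, frobNorm_sq, ← sum_coord hd k fun a => ∑ b, B a b ^ 2]
  refine Finset.sum_congr rfl fun i _ => ?_
  exact sum_modeEmbed_row k B i (fun _ x => x ^ 2) (by simp)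

lemma opNorm_modeEmbed_le (k : Fin L) (B : Matrix (Fin (d k)) (Fin (d k)) ℝ) :
    opNorm (modeEmbed k B) ≤ frobNorm B := by
  refine opNorm_le_of_sum_sq_mulVec_le (frobNorm_nonneg _) fun x => ?_
  have h1 : ∀ i, (modeEmbed k B *ᵥ x) i ^ 2 ≤
      ∑ a, (∑ b, B (i k) b ^ 2) * x (Function.update i k a) ^ 2 := by
    intro i
    have : (modeEmbed k B *ᵥ x) i = ∑ b, B (i k) b * x (Function.update i k b) :=
      sum_modeEmbed_row k B i (fun j y => y * x j) (by simp)
    rw [this, ← Finset.mul_sum]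
    exact Finset.sum_mul_sq_le_sq_mul_sq _ _ _
  refine (Finset.sum_le_sum fun i _ => h1 i).trans (le_of_eq ?_)
  rw [sum_sum_update_swap k fun i a => (∑ b, B (i k) b ^ 2) * x (Function.update i k a) ^ 2,
    frobNorm_sq, Finset.mul_sum]
  refine Finset.sum_congr rfl fun i _ => ?_
  simp [Finset.sum_mul]

lemma sum_modeEmbed_mul_modeEmbed {k l : Fin L} (hkl : k ≠ l)
    (B : Matrix (Fin (d k)) (Fin (d k)) ℝ) (C : Matrix (Fin (d l)) (Fin (d l)) ℝ) :
    ∑ i, ∑ j, modeEmbed k B i j * modeEmbed l C i j =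
      ∑ i : Idx d, B (i k) (i k) * C (i l) (i l) := by
  refine Finset.sum_congr rfl fun i _ => ?_
  rw [sum_modeEmbed_row k B i (fun j x => x * modeEmbed l C i j) (by simp),
    Finset.sum_eq_single (i k)]
  · rw [Function.update_eq_self, modeEmbed_apply_self]
  · intro b _ hb
    rw [modeEmbed_apply_eq_zero, mul_zero]
    exact ⟨k, hkl, by simpa using hb.symm⟩
  · simp

lemma sum_modeEmbed_mul_modeEmbed_eq_zero (hd : ∀ k, 0 < d k) {k l : Fin L} (hkl : k ≠ l)
    {B : Matrix (Fin (d k)) (Fin (d k)) ℝ} (C : Matrix (Fin (d l)) (Fin (d l)) ℝ)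
    (hB : ∑ a, B a a = 0) :
    ∑ i, ∑ j, modeEmbed k B i j * modeEmbed l C i j = 0 := by
  rw [sum_modeEmbed_mul_modeEmbed hkl]
  refine sum_update_eq_zero hd k _ fun i => ?_
  simp only [Function.update_self, Function.update_of_ne hkl.symm]
  rw [← Finset.sum_mul, hB, zero_mul]

lemma modeEmbed_one (k : Fin L) : modeEmbed (d := d) k 1 = 1 := by
  ext i j
  simp only [modeEmbed, Matrix.of_apply]
  rw [Finset.mul_prod_erase _ (fun l => (1 : Matrix (Fin (d l)) (Fin (d l)) ℝ) (i l) (j l))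
    (Finset.mem_univ k)]
  by_cases h : i = j
  · subst h; simp
  · obtain ⟨l, hl⟩ := Function.ne_iff.1 h
    rw [Matrix.one_apply_ne h]
    exact Finset.prod_eq_zero (Finset.mem_univ l) (Matrix.one_apply_ne hl)

lemma modeEmbed_add (k : Fin L) (B C : Matrix (Fin (d k)) (Fin (d k)) ℝ) :
    modeEmbed k (B + C) = modeEmbed k B + modeEmbed k C := by
  ext i j; simp [modeEmbed, add_mul]

lemma modeEmbed_smul (k : Fin L) (t : ℝ) (B : Matrix (Fin (d k)) (Fin (d k)) ℝ) :
    modeEmbed k (t • B) = t • modeEmbed k B := by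
  ext i j; simp [modeEmbed, mul_assoc]

/-- The Kronecker sum as a linear map of its factors. -/
noncomputable def kroneckerSumLinear (d : Fin L → ℕ) :
    (∀ k, Matrix (Fin (d k)) (Fin (d k)) ℝ) →ₗ[ℝ] Matrix (Idx d) (Idx d) ℝ where
  toFun := kroneckerSum
  map_add' Ψ Φ := by
    simp only [kroneckerSum_eq_sum_modeEmbed, Pi.add_apply, modeEmbed_add, Finset.sum_add_distrib]
  map_smul' t Ψ := by
    simp only [kroneckerSum_eq_sum_modeEmbed, Pi.smul_apply, modeEmbed_smul, Finset.smul_sum,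
      RingHom.id_apply]

lemma kroneckerSum_add (Ψ Φ : ∀ k, Matrix (Fin (d k)) (Fin (d k)) ℝ) :
    kroneckerSum (Ψ + Φ) = kroneckerSum Ψ + kroneckerSum Φ := (kroneckerSumLinear d).map_add Ψ Φ

lemma kroneckerSum_smul (t : ℝ) (Ψ : ∀ k, Matrix (Fin (d k)) (Fin (d k)) ℝ) :
    kroneckerSum (t • Ψ) = t • kroneckerSum Ψ := (kroneckerSumLinear d).map_smul t Ψ

lemma kroneckerSum_sub (Ψ Φ : ∀ k, Matrix (Fin (d k)) (Fin (d k)) ℝ) :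
    kroneckerSum (Ψ - Φ) = kroneckerSum Ψ - kroneckerSum Φ := (kroneckerSumLinear d).map_sub Ψ Φ

lemma frobNorm_sum_sq_of_orthogonal {ι κ : Type*} [Fintype ι] [Fintype κ]
    (T : κ → Matrix ι ι ℝ) (hT : ∀ k l, k ≠ l → ∑ i, ∑ j, T k i j * T l i j = 0) :
    frobNorm (∑ k, T k) ^ 2 = ∑ k, frobNorm (T k) ^ 2 := by
  classical
  have h1 : frobNorm (∑ k, T k) ^ 2 = ∑ k, ∑ l, ∑ i, ∑ j, T k i j * T l i j := by
    rw [frobNorm_sq]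
    simp only [Matrix.sum_apply, sq, Finset.sum_mul_sum]
    calc ∑ i, ∑ j, ∑ k, ∑ l, T k i j * T l i j
        = ∑ i, ∑ k, ∑ j, ∑ l, T k i j * T l i j :=
          Finset.sum_congr rfl fun i _ => Finset.sum_comm
      _ = ∑ k, ∑ i, ∑ j, ∑ l, T k i j * T l i j := Finset.sum_comm
      _ = ∑ k, ∑ i, ∑ l, ∑ j, T k i j * T l i j :=
          Finset.sum_congr rfl fun k _ => Finset.sum_congr rfl fun i _ => Finset.sum_comm
      _ = _ := Finset.sum_congr rfl fun k _ => Finset.sum_comm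
  rw [h1]
  refine Finset.sum_congr rfl fun k _ => ?_
  rw [Finset.sum_eq_single k (fun l _ hl => hT k l hl.symm) (by simp), frobNorm_sq]
  simp only [sq]

/-- The operator norm of a Kronecker sum is small compared with its Frobenius norm. -/
lemma opNorm_kroneckerSum_le (hL : 1 ≤ L) (hd : ∀ k, 0 < d k)
    (A : ∀ k, Matrix (Fin (d k)) (Fin (d k)) ℝ) :
    opNorm (kroneckerSum A) ≤ √((L + 1) / minCoDim d) * frobNorm (kroneckerSum A) := by
  have hm : (0 : ℝ) < minCoDim d := by exact_mod_cast minCoDim_pos hL hd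
  let τ : Fin L → ℝ := fun k => (∑ a, A k a a) / d k
  let B : ∀ k, Matrix (Fin (d k)) (Fin (d k)) ℝ := fun k => A k - τ k • 1
  let T : Option (Fin L) → Matrix (Idx d) (Idx d) ℝ := fun o =>
    o.elim ((∑ k, τ k) • 1) fun k => modeEmbed k (B k)
  have hB : ∀ k, ∑ a, B k a a = 0 := by
    intro k
    have hk : (d k : ℝ) ≠ 0 := by exact_mod_cast (hd k).ne'
    simp only [B, τ, Matrix.sub_apply, Matrix.smul_apply, Matrix.one_apply_eq, smul_eq_mul, mul_one,
      Finset.sum_sub_distrib, Finset.sum_const, Finset.card_univ, Fintype.card_fin, nsmul_eq_mul]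
    field_simp
    ring
  have hsum : kroneckerSum A = ∑ o, T o := by
    rw [Fintype.sum_option, kroneckerSum_eq_sum_modeEmbed]
    simp only [T, Option.elim_none, Option.elim_some]
    rw [Finset.sum_smul, ← Finset.sum_add_distrib]
    refine Finset.sum_congr rfl fun k _ => ?_
    rw [← modeEmbed_one k, ← modeEmbed_smul, ← modeEmbed_add]
    simp [B]
  have hone : ∀ k (t : ℝ), ∑ i, ∑ j, modeEmbed k (B k) i j * (t • (1 : Matrix (Idx d) _ ℝ)) i j
      = 0 := by
    intro k t
    have : ∀ i : Idx d, ∑ j, modeEmbed k (B k) i j * (t • (1 : Matrix (Idx d) _ ℝ)) i j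
        = B k (i k) (i k) * t := by
      intro i
      rw [Finset.sum_eq_single i]
      · simp [modeEmbed_apply_self]
      · intro j _ hj
        simp [Matrix.one_apply_ne hj.symm]
      · simp
    simp only [this]
    rw [← Finset.sum_mul, sum_coord hd k fun a => B k a a, hB, mul_zero, zero_mul]
  have horth : ∀ o o', o ≠ o' → ∑ i, ∑ j, T o i j * T o' i j = 0 := by
    intro o o' hne
    match o, o' with
    | none, none => exact absurd rfl hne
    | none, some k =>
      have := hone k (∑ k, τ k)
      simp only [T, Option.elim_none, Option.elim_some]
      simpa only [mul_comm] using this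
    | some k, none => exact hone k (∑ k, τ k)
    | some k, some l =>
      exact sum_modeEmbed_mul_modeEmbed_eq_zero hd (fun h => hne (by rw [h])) _ (hB k)
  have hfrob := frobNorm_sum_sq_of_orthogonal T horth
  have hop : ∀ o, opNorm (T o) ^ 2 ≤ frobNorm (T o) ^ 2 / minCoDim d := by
    intro o
    rw [le_div_iff₀ hm]
    match o with
    | none =>
      simp only [T, Option.elim_none]
      have : Nonempty (Idx d) := ⟨fun k => ⟨0, hd k⟩⟩
      have h1 : frobNorm (1 : Matrix (Idx d) (Idx d) ℝ) ^ 2 = totalDim d := by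
        rw [frobNorm_sq]
        simp [Matrix.one_apply, ite_pow, totalDim]
      rw [opNorm_smul, frobNorm_smul, mul_pow, mul_pow, h1, opNorm_one, one_pow, mul_one]
      have h2 : (minCoDim d : ℝ) ≤ totalDim d := by
        obtain ⟨k, hk⟩ := exists_coDim_eq_minCoDim (d := d) hL
        rw [← hk, totalDim_eq_mul_coDim k]
        exact_mod_cast Nat.le_mul_of_pos_left _ (hd k)
      gcongr
    | some k =>
      simp only [T, Option.elim_some]
      rw [frobNorm_modeEmbed_sq hd, mul_comm]
      have h1 : (minCoDim d : ℝ) ≤ coDim d k := by exact_mod_cast minCoDim_le k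
      have h2 := opNorm_modeEmbed_le k (B k)
      have h3 := opNorm_nonneg (modeEmbed k (B k))
      gcongr
  refine le_of_sq_le_sq ?_ (mul_nonneg (Real.sqrt_nonneg _) (frobNorm_nonneg _))
  rw [mul_pow, Real.sq_sqrt (by positivity), hsum, hfrob]
  calc opNorm (∑ o, T o) ^ 2 ≤ (∑ o, opNorm (T o)) ^ 2 :=
        pow_le_pow_left₀ (opNorm_nonneg _) (opNorm_sum_le _ _) 2
    _ ≤ Fintype.card (Option (Fin L)) * ∑ o, opNorm (T o) ^ 2 := sq_sum_le_card_mul_sum_sq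
    _ ≤ Fintype.card (Option (Fin L)) * ∑ o, frobNorm (T o) ^ 2 / minCoDim d := by
        gcongr with o; exact hop o
    _ = _ := by
        rw [← Finset.sum_div]
        simp only [Fintype.card_option, Fintype.card_fin, Nat.cast_add, Nat.cast_one]
        ring

/-- The off-diagonal part of a matrix. -/
def offPart {q : ℕ} (A : Matrix (Fin q) (Fin q) ℝ) : Matrix (Fin q) (Fin q) ℝ :=
  A - Matrix.diagonal fun a => A a a

lemma offPart_apply_self {q : ℕ} (A : Matrix (Fin q) (Fin q) ℝ) (a : Fin q) :
    offPart A a a = 0 := by simp [offPart]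

lemma offPart_apply_ne {q : ℕ} (A : Matrix (Fin q) (Fin q) ℝ) {a b : Fin q} (h : a ≠ b) :
    offPart A a b = A a b := by simp [offPart, h]

lemma kroneckerSum_apply_update (A : ∀ k, Matrix (Fin (d k)) (Fin (d k)) ℝ) (k : Fin L)
    {i : Idx d} {b : Fin (d k)} (hb : b ≠ i k) :
    kroneckerSum A i (Function.update i k b) = A k (i k) b := by
  rw [kroneckerSum_eq_sum_modeEmbed, Matrix.sum_apply, Finset.sum_eq_single k,
    modeEmbed_apply_update]
  · intro l _ hl
    exact modeEmbed_apply_eq_zero _ _ ⟨k, hl.symm, by simpa using hb.symm⟩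
  · simp

lemma modeEmbed_diagonal (k : Fin L) (f : Fin (d k) → ℝ) :
    modeEmbed k (Matrix.diagonal f) = Matrix.diagonal fun i => f (i k) := by
  ext i j
  by_cases h : i = j
  · subst h; simp [modeEmbed_apply_self]
  · rw [Matrix.diagonal_apply_ne _ h]
    by_cases hk : i k = j k
    · refine modeEmbed_apply_eq_zero _ _ ?_
      obtain ⟨l, hl⟩ := Function.ne_iff.1 h
      exact ⟨l, fun e => hl (by subst e; exact hk), hl⟩
    · simp [modeEmbed, Matrix.diagonal_apply_ne _ hk]

lemma kroneckerSum_diagonal (f : ∀ k, Fin (d k) → ℝ) :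
    kroneckerSum (fun k => Matrix.diagonal (f k)) = Matrix.diagonal fun i => ∑ k, f k (i k) := by
  simp only [kroneckerSum_eq_sum_modeEmbed, modeEmbed_diagonal]
  ext i j
  by_cases h : i = j
  · subst h; simp [Matrix.sum_apply]
  · simp [Matrix.sum_apply, h]

lemma kroneckerSum_eq_diagonal_add (A : ∀ k, Matrix (Fin (d k)) (Fin (d k)) ℝ) :
    kroneckerSum A = Matrix.diagonal (fun i => ∑ k, A k (i k) (i k)) +
      ∑ k, modeEmbed k (offPart (A k)) := by
  rw [← kroneckerSum_diagonal fun k a => A k a a, kroneckerSum_eq_sum_modeEmbed,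
    kroneckerSum_eq_sum_modeEmbed, ← Finset.sum_add_distrib]
  refine Finset.sum_congr rfl fun k _ => ?_
  rw [← modeEmbed_add, offPart, add_sub_cancel]

lemma frobNorm_kroneckerSum_sq (hd : ∀ k, 0 < d k)
    (A : ∀ k, Matrix (Fin (d k)) (Fin (d k)) ℝ) :
    frobNorm (kroneckerSum A) ^ 2 = ∑ i : Idx d, (∑ k, A k (i k) (i k)) ^ 2 +
      ∑ k, coDim d k * frobNorm (offPart (A k)) ^ 2 := by
  let v : Idx d → ℝ := fun i => ∑ k, A k (i k) (i k)
  let T : Option (Fin L) → Matrix (Idx d) (Idx d) ℝ := fun o =>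
    o.elim (Matrix.diagonal v) fun k => modeEmbed k (offPart (A k))
  have hsum : kroneckerSum A = ∑ o, T o := by
    rw [Fintype.sum_option, kroneckerSum_eq_diagonal_add]
    rfl
  have hone : ∀ k, ∑ i, ∑ j, modeEmbed k (offPart (A k)) i j * Matrix.diagonal v i j = 0 := by
    intro k
    refine Finset.sum_eq_zero fun i _ => Finset.sum_eq_zero fun j _ => ?_
    by_cases h : i = j
    · subst h; rw [modeEmbed_apply_self, offPart_apply_self, zero_mul]
    · rw [Matrix.diagonal_apply_ne _ h, mul_zero]
  have horth : ∀ o o', o ≠ o' → ∑ i, ∑ j, T o i j * T o' i j = 0 := by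
    intro o o' hne
    match o, o' with
    | none, none => exact absurd rfl hne
    | none, some k =>
      simp only [T, Option.elim_none, Option.elim_some]
      simpa only [mul_comm] using hone k
    | some k, none => exact hone k
    | some k, some l =>
      exact sum_modeEmbed_mul_modeEmbed_eq_zero hd (fun h => hne (by rw [h])) _
        (by simp [offPart_apply_self])
  rw [hsum, frobNorm_sum_sq_of_orthogonal T horth, Fintype.sum_option]
  simp only [T, Option.elim_none, Option.elim_some, frobNorm_modeEmbed_sq hd]
  congr 1
  rw [frobNorm_sq]
  refine Finset.sum_congr rfl fun i _ => ?_
  rw [Finset.sum_eq_single i] <;> simp +contextual [v, eq_comm]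

/-- The objective as a function of the matrix alone. -/
noncomputable def matrixObjective (S : Matrix (Idx d) (Idx d) ℝ) (ρ : Fin L → ℝ)
    (Ω : Matrix (Idx d) (Idx d) ℝ) : ℝ :=
  -Real.log Ω.det + (S.transpose * Ω).trace +
    ∑ k, ρ k * ∑ i, ∑ b ∈ Finset.univ.erase (i k), |Ω i (Function.update i k b)|

lemma objective_eq_matrixObjective (hd : ∀ k, 0 < d k) (S : Matrix (Idx d) (Idx d) ℝ)
    (ρ : Fin L → ℝ) (Ψ : ∀ k, Matrix (Fin (d k)) (Fin (d k)) ℝ) :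
    objective S ρ Ψ = matrixObjective S ρ (kroneckerSum Ψ) := by
  unfold objective matrixObjective
  congr 1
  refine Finset.sum_congr rfl fun k _ => ?_
  have : ∀ i : Idx d, ∑ b ∈ Finset.univ.erase (i k), |kroneckerSum Ψ i (Function.update i k b)| =
      ∑ b ∈ Finset.univ.erase (i k), |Ψ k (i k) b| := fun i =>
    Finset.sum_congr rfl fun b hb => by rw [kroneckerSum_apply_update _ _ (Finset.ne_of_mem_erase hb)]
  simp only [this]
  rw [sum_coord hd k fun a => ∑ b ∈ Finset.univ.erase a, |Ψ k a b|, offNorm]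
  ring

end Modes

section ScalarMgf

/-- `exp` with values in `[0, ∞]`. -/
noncomputable def lexp (x : ℝ) : ENNReal := ENNReal.ofReal (Real.exp x)

lemma lexp_add (x y : ℝ) : lexp (x + y) = lexp x * lexp y := by
  rw [lexp, Real.exp_add, ENNReal.ofReal_mul (Real.exp_pos _).le]; rfl

lemma lexp_zero : lexp 0 = 1 := by simp [lexp]

lemma lexp_sum {ι : Type*} (s : Finset ι) (f : ι → ℝ) :
    lexp (∑ i ∈ s, f i) = ∏ i ∈ s, lexp (f i) := by
  rw [lexp, Real.exp_sum, ENNReal.ofReal_prod_of_nonneg fun _ _ => (Real.exp_pos _).le]; rfl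

lemma lexp_mono : Monotone lexp := fun _ _ h => ENNReal.ofReal_le_ofReal (Real.exp_le_exp.2 h)

lemma measurable_lexp : Measurable lexp := ENNReal.measurable_ofReal.comp Real.measurable_exp

@[fun_prop]
lemma measurable_lexp_comp {α : Type*} [MeasurableSpace α] {f : α → ℝ} (hf : Measurable f) :
    Measurable fun x => lexp (f x) := measurable_lexp.comp hf

lemma exp_le_self_add_exp_sq (x : ℝ) : Real.exp x ≤ x + Real.exp (x ^ 2) := by
  have h0 := Real.add_one_le_exp (x ^ 2)
  rcases le_or_gt |x| 1 with h | h
  · have := (abs_le.1 (Real.abs_exp_sub_one_sub_id_le h)).2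
    linarith
  · rcases lt_abs.1 h with h | h
    · have : Real.exp x ≤ Real.exp (x ^ 2) := Real.exp_le_exp.2 (by nlinarith)
      linarith
    · have : Real.exp x ≤ 1 := Real.exp_le_one_iff.2 (by linarith)
      nlinarith

lemma exp_le_one_add_add_sq_mul (x : ℝ) : Real.exp x ≤ 1 + x + x ^ 2 * Real.exp |x| := by
  have h1 : 1 ≤ Real.exp |x| := Real.one_le_exp (abs_nonneg _)
  rcases le_or_gt |x| 1 with h | h
  · have := (abs_le.1 (Real.abs_exp_sub_one_sub_id_le h)).2
    nlinarith [sq_nonneg x]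
  · rcases lt_abs.1 h with h | h
    · rw [abs_of_pos (by linarith)] at h1 ⊢
      have h2 : 1 ≤ x ^ 2 := by nlinarith
      nlinarith
    · have : Real.exp x ≤ 1 := Real.exp_le_one_iff.2 (by linarith)
      nlinarith [sq_nonneg x]

lemma exp_mul_le_of_mem_unitInterval {α : ℝ} (h0 : 0 ≤ α) (h1 : α ≤ 1) (y : ℝ) :
    Real.exp (α * y) ≤ 1 - α + α * Real.exp y := by
  have := convexOn_exp.2 (Set.mem_univ 0) (Set.mem_univ y) (sub_nonneg.2 h1) h0
    (sub_add_cancel 1 α)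
  simpa using this

variable {S : Type*} [MeasurableSpace S] {μ : Measure S}

lemma lintegral_lexp_le_of_psiTwoNorm_le {Z : S → ℝ} {K : ℝ} (hK : 0 < K)
    (h : psiTwoNorm μ Z ≤ ENNReal.ofReal K) :
    ∫⁻ ω, lexp (Z ω ^ 2 / (2 * K) ^ 2) ∂μ ≤ 2 := by
  have h2 : psiTwoNorm μ Z < ENNReal.ofReal (2 * K) :=
    h.trans_lt ((ENNReal.ofReal_lt_ofReal_iff (by linarith)).2 (by linarith))
  simp only [psiTwoNorm, iInf_lt_iff] at h2
  obtain ⟨t, ht, hle, htK⟩ := h2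
  have htK' : t < 2 * K := (ENNReal.ofReal_lt_ofReal_iff (by linarith)).1 htK
  refine le_trans (lintegral_mono fun ω => lexp_mono ?_) hle
  gcongr

/-- The consequences of a `ψ₂`-bound at scale `k`, in terms of Bochner integrals. -/
lemma integrable_exp_sq_of_lintegral_le {Z : S → ℝ} (hZ : Measurable Z) {k : ℝ}
    (h : ∫⁻ ω, lexp (Z ω ^ 2 / k ^ 2) ∂μ ≤ 2) :
    Integrable (fun ω => Real.exp (Z ω ^ 2 / k ^ 2)) μ ∧ ∫ ω, Real.exp (Z ω ^ 2 / k ^ 2) ∂μ ≤ 2 := by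
  have hm : AEStronglyMeasurable (fun ω => Real.exp (Z ω ^ 2 / k ^ 2)) μ := by fun_prop
  constructor
  · refine ⟨hm, ?_⟩
    rw [hasFiniteIntegral_iff_ofReal (Filter.Eventually.of_forall fun _ => (Real.exp_pos _).le)]
    exact h.trans_lt (by simp)
  · rw [integral_eq_lintegral_of_nonneg_ae
      (Filter.Eventually.of_forall fun _ => (Real.exp_pos _).le) hm]
    exact ENNReal.toReal_le_of_le_ofReal (by norm_num)
      (by rw [ENNReal.ofReal_ofNat]; exact h)

lemma lintegral_lexp_le_of_integral_exp_le {f : S → ℝ} (hf : Measurable f) {g : S → ℝ}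
    (hg : Integrable g μ) (hfg : ∀ ω, Real.exp (f ω) ≤ g ω) {c : ℝ}
    (hc : ∫ ω, g ω ∂μ ≤ Real.exp c) : ∫⁻ ω, lexp (f ω) ∂μ ≤ lexp c := by
  have hexp : Integrable (fun ω => Real.exp (f ω)) μ := by
    refine hg.mono' (by fun_prop) (Filter.Eventually.of_forall fun ω => ?_)
    rw [Real.norm_of_nonneg (Real.exp_pos _).le]
    exact hfg ω
  unfold lexp
  rw [← ofReal_integral_eq_lintegral_ofReal hexp
    (Filter.Eventually.of_forall fun _ => (Real.exp_pos _).le)]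
  exact ENNReal.ofReal_le_ofReal ((integral_mono hexp hg hfg).trans hc)

variable [IsProbabilityMeasure μ]

lemma integrable_sq_of_integrable_exp_sq {Z : S → ℝ} (hZ : Measurable Z) {k : ℝ} (hk : 0 < k)
    (h : Integrable (fun ω => Real.exp (Z ω ^ 2 / k ^ 2)) μ) :
    Integrable (fun ω => Z ω ^ 2) μ ∧ Integrable Z μ := by
  have h2 : Integrable (fun ω => Z ω ^ 2) μ := by
    refine (h.const_mul (k ^ 2)).mono' (by fun_prop) (Filter.Eventually.of_forall fun ω => ?_)
    have := Real.add_one_le_exp (Z ω ^ 2 / k ^ 2)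
    rw [Real.norm_of_nonneg (sq_nonneg _)]
    have h3 : Z ω ^ 2 = k ^ 2 * (Z ω ^ 2 / k ^ 2) := by field_simp
    rw [h3]
    gcongr
    rw [← h3]
    linarith
  refine ⟨h2, ?_⟩
  refine (h2.add (integrable_const (1 : ℝ))).mono' (by fun_prop)
    (Filter.Eventually.of_forall fun ω => ?_)
  rw [Real.norm_eq_abs, Pi.add_apply, ← sq_abs]
  nlinarith [sq_nonneg (|Z ω| - 1), abs_nonneg (Z ω)]

/-- A centred variable with `E exp(Z² / k²) ≤ 2` has a sub-gaussian moment generating function. -/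
lemma lintegral_lexp_mul_le {Z : S → ℝ} (hZ : Measurable Z) {k : ℝ} (hk : 0 < k)
    (h : ∫⁻ ω, lexp (Z ω ^ 2 / k ^ 2) ∂μ ≤ 2) (h0 : ∫ ω, Z ω ∂μ = 0) (t : ℝ) :
    ∫⁻ ω, lexp (t * Z ω) ∂μ ≤ lexp (k ^ 2 * t ^ 2) := by
  obtain ⟨hi, hle⟩ := integrable_exp_sq_of_lintegral_le hZ h
  obtain ⟨-, hZi⟩ := integrable_sq_of_integrable_exp_sq hZ hk hi
  rcases le_or_gt (k ^ 2 * t ^ 2) 1 with hα | hα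
  · have hα0 : 0 ≤ k ^ 2 * t ^ 2 := by positivity
    have hi' : Integrable (fun ω => (1 - k ^ 2 * t ^ 2) +
        k ^ 2 * t ^ 2 * Real.exp (Z ω ^ 2 / k ^ 2)) μ :=
      (integrable_const _).add (hi.const_mul _)
    refine lintegral_lexp_le_of_integral_exp_le (by fun_prop)
      (g := fun ω => t * Z ω + ((1 - k ^ 2 * t ^ 2) +
        k ^ 2 * t ^ 2 * Real.exp (Z ω ^ 2 / k ^ 2))) ?_ ?_ ?_
    · exact (hZi.const_mul t).add hi'
    · intro ω
      refine (exp_le_self_add_exp_sq _).trans ?_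
      have := exp_mul_le_of_mem_unitInterval hα0 hα (Z ω ^ 2 / k ^ 2)
      rw [show (t * Z ω) ^ 2 = k ^ 2 * t ^ 2 * (Z ω ^ 2 / k ^ 2) by field_simp]
      linarith
    · rw [integral_add (hZi.const_mul t) hi',
        integral_add (integrable_const _) (hi.const_mul _), integral_const_mul, integral_const_mul,
        h0]
      simp only [integral_const, probReal_univ, smul_eq_mul, mul_zero, one_mul]
      have := Real.add_one_le_exp (k ^ 2 * t ^ 2)
      nlinarith
  · refine lintegral_lexp_le_of_integral_exp_le (by fun_prop)
      (g := fun ω => Real.exp (k ^ 2 * t ^ 2 / 2) *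
        (1 / 2 + 1 / 2 * Real.exp (Z ω ^ 2 / k ^ 2))) ?_ ?_ ?_
    · exact ((integrable_const _).add (hi.const_mul _)).const_mul _
    · intro ω
      have h1 := exp_mul_le_of_mem_unitInterval (α := 1 / 2) (by norm_num) (by norm_num)
        (Z ω ^ 2 / k ^ 2)
      have h2 : t * Z ω ≤ k ^ 2 * t ^ 2 / 2 + 1 / 2 * (Z ω ^ 2 / k ^ 2) := by
        have h3 := sq_nonneg (k * t - Z ω / k)
        have h4 : (k * t - Z ω / k) ^ 2 = k ^ 2 * t ^ 2 - 2 * (t * Z ω) + Z ω ^ 2 / k ^ 2 := by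
          field_simp
          ring
        linarith
      calc Real.exp (t * Z ω) ≤ Real.exp (k ^ 2 * t ^ 2 / 2 + 1 / 2 * (Z ω ^ 2 / k ^ 2)) :=
            Real.exp_le_exp.2 h2
        _ ≤ _ := by
          rw [Real.exp_add]
          gcongr
          linarith
    · rw [integral_const_mul, integral_add (integrable_const _) (hi.const_mul _),
        integral_const_mul]
      simp only [integral_const, probReal_univ, smul_eq_mul, one_mul]
      have h1 : Real.exp (k ^ 2 * t ^ 2) =
          Real.exp (k ^ 2 * t ^ 2 / 2) * Real.exp (k ^ 2 * t ^ 2 / 2) := by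
        rw [← Real.exp_add]; ring_nf
      rw [h1]
      gcongr
      have h2 := Real.add_one_le_exp (k ^ 2 * t ^ 2 / 2)
      linarith

/-- The square of a variable with `E exp(Z² / k²) ≤ 2`, centred, is sub-exponential. -/
lemma lintegral_lexp_mul_sq_sub_one_le {Z : S → ℝ} (hZ : Measurable Z) {k : ℝ} (hk : 0 < k)
    (h : ∫⁻ ω, lexp (Z ω ^ 2 / k ^ 2) ∂μ ≤ 2) (h1 : ∫ ω, Z ω ^ 2 ∂μ = 1) {θ : ℝ}
    (hθ : 2 * k ^ 2 * |θ| ≤ 1) :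
    ∫⁻ ω, lexp (θ * (Z ω ^ 2 - 1)) ∂μ ≤ lexp (16 * k ^ 4 * Real.exp (1 / k ^ 2) * θ ^ 2) := by
  obtain ⟨hi, hle⟩ := integrable_exp_sq_of_lintegral_le hZ h
  obtain ⟨hZ2, -⟩ := integrable_sq_of_integrable_exp_sq hZ hk hi
  set c := 8 * k ^ 4 * Real.exp (1 / k ^ 2) * θ ^ 2 with hc
  have hc0 : 0 ≤ c := by positivity
  have hZ1 : Integrable (fun ω => θ * (Z ω ^ 2 - 1)) μ :=
    (hZ2.sub (integrable_const _)).const_mul _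
  have hi' : Integrable (fun ω => θ * (Z ω ^ 2 - 1) + c * Real.exp (Z ω ^ 2 / k ^ 2)) μ :=
    hZ1.add (hi.const_mul _)
  refine lintegral_lexp_le_of_integral_exp_le (by fun_prop)
    (g := fun ω => 1 + (θ * (Z ω ^ 2 - 1) + c * Real.exp (Z ω ^ 2 / k ^ 2))) ?_ ?_ ?_
  · exact (integrable_const _).add hi'
  · intro ω
    set y := Z ω ^ 2 - 1 with hy
    refine (exp_le_one_add_add_sq_mul _).trans ?_
    rw [← add_assoc]
    refine add_le_add_right ?_ _
    have hy1 : |y| ≤ Z ω ^ 2 + 1 := by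
      rw [abs_le]; constructor <;> nlinarith [sq_nonneg (Z ω)]
    have h2 : |θ * y| ≤ |y| / (2 * k ^ 2) := by
      rw [abs_mul, le_div_iff₀ (by positivity)]
      nlinarith [abs_nonneg y]
    have h3 : y ^ 2 ≤ 8 * k ^ 4 * Real.exp (|y| / (2 * k ^ 2)) := by
      have := Real.quadratic_le_exp_of_nonneg (x := |y| / (2 * k ^ 2)) (by positivity)
      have h4 : (|y| / (2 * k ^ 2)) ^ 2 / 2 ≤ Real.exp (|y| / (2 * k ^ 2)) := by
        have : 0 ≤ |y| / (2 * k ^ 2) := by positivity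
        linarith
      have h5 : y ^ 2 = 8 * k ^ 4 * ((|y| / (2 * k ^ 2)) ^ 2 / 2) := by
        rw [← sq_abs y]; field_simp; norm_num
      rw [h5]
      gcongr
    calc (θ * y) ^ 2 * Real.exp |θ * y|
        ≤ θ ^ 2 * (8 * k ^ 4 * Real.exp (|y| / (2 * k ^ 2))) * Real.exp (|y| / (2 * k ^ 2)) := by
          rw [mul_pow]; gcongr
      _ = 8 * k ^ 4 * θ ^ 2 * Real.exp (|y| / k ^ 2) := by
          rw [show |y| / k ^ 2 = |y| / (2 * k ^ 2) + |y| / (2 * k ^ 2) by field_simp; norm_num,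
            Real.exp_add]
          ring
      _ ≤ 8 * k ^ 4 * θ ^ 2 * Real.exp (Z ω ^ 2 / k ^ 2 + 1 / k ^ 2) := by
          rw [← add_div]
          gcongr
      _ = c * Real.exp (Z ω ^ 2 / k ^ 2) := by rw [Real.exp_add, hc]; ring
  · rw [integral_add (integrable_const _) hi', integral_add hZ1 (hi.const_mul _), integral_const_mul, integral_const_mul,
      integral_sub hZ2 (integrable_const _), h1]
    simp only [integral_const, probReal_univ, smul_eq_mul, one_mul, sub_self, mul_zero, zero_add]
    have h2 := Real.add_one_le_exp (16 * k ^ 4 * Real.exp (1 / k ^ 2) * θ ^ 2)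
    have h3 : 16 * k ^ 4 * Real.exp (1 / k ^ 2) * θ ^ 2 = 2 * c := by rw [hc]; ring
    rw [h3] at h2 ⊢
    nlinarith

lemma lintegral_lexp_mul_gaussian (t : ℝ) :
    ∫⁻ x, lexp (t * x) ∂(gaussianReal 0 1) = lexp (t ^ 2 / 2) := by
  have h := congrFun (mgf_fun_id_gaussianReal (μ := 0) (v := 1)) t
  simp only [mgf, NNReal.coe_one] at h
  unfold lexp
  rw [← ofReal_integral_eq_lintegral_ofReal (integrable_exp_mul_gaussianReal t)
    (Filter.Eventually.of_forall fun _ => (Real.exp_pos _).le), h]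
  simp

lemma lintegral_lexp_mul_sq_gaussian_le {θ : ℝ} (h0 : 0 ≤ θ) (h1 : θ ≤ 1 / 4) :
    ∫⁻ x, lexp (θ * x ^ 2) ∂(gaussianReal 0 1) ≤ lexp (2 * θ) := by
  rw [gaussianReal_of_var_ne_zero _ one_ne_zero,
    lintegral_withDensity_eq_lintegral_mul _ (measurable_gaussianPDF _ _) (by fun_prop)]
  have e : ∀ x : ℝ, (gaussianPDF 0 1 * fun x => lexp (θ * x ^ 2)) x =
      ENNReal.ofReal ((√(2 * Real.pi))⁻¹ * Real.exp (-(1 / 2 - θ) * x ^ 2)) := by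
    intro x
    simp only [Pi.mul_apply, gaussianPDF, gaussianPDFReal, lexp, NNReal.coe_one, mul_one, sub_zero]
    rw [← ENNReal.ofReal_mul (by positivity), mul_assoc, ← Real.exp_add]
    congr 3
    ring
  simp only [e]
  have hexp : Integrable fun x : ℝ => Real.exp (-(1 / 2 - θ) * x ^ 2) :=
    integrable_exp_neg_mul_sq (by linarith)
  rw [← ofReal_integral_eq_lintegral_ofReal (hexp.const_mul _)
    (Filter.Eventually.of_forall fun _ => by positivity), integral_const_mul, integral_gaussian]
  refine ENNReal.ofReal_le_ofReal ?_
  have hp : 0 < 1 / 2 - θ := by linarith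
  rw [inv_mul_le_iff₀ (by positivity), ← Real.sqrt_sq (Real.exp_pos (2 * θ)).le,
    ← Real.sqrt_mul (by positivity)]
  refine Real.sqrt_le_sqrt ?_
  rw [div_le_iff₀ hp, ← Real.exp_nat_mul]
  have h2 := Real.quadratic_le_exp_of_nonneg (x := 4 * θ) (by linarith)
  have h3 : 1 ≤ 2 * Real.exp (4 * θ) * (1 / 2 - θ) := by
    have : 1 ≤ 2 * (1 + 4 * θ) * (1 / 2 - θ) := by nlinarith
    nlinarith
  push_cast
  rw [show (2 : ℝ) * (2 * θ) = 4 * θ by ring]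
  nlinarith [Real.pi_pos]

end ScalarMgf

section HansonWright

variable {S : Type*} [MeasurableSpace S] {μ : Measure S}

lemma lintegral_lexp_sum_le {κ : Type*} {β : κ → Type*} [∀ i, MeasurableSpace (β i)] (s : Finset κ)
    {Z : ∀ i, S → β i} (hind : iIndepFun Z μ) (hZ : ∀ i, Measurable (Z i)) {f : ∀ i, β i → ℝ}
    (hf : ∀ i, Measurable (f i)) {c : κ → ℝ}
    (h : ∀ i, ∫⁻ ω, lexp (f i (Z i ω)) ∂μ ≤ lexp (c i)) :
    ∫⁻ ω, lexp (∑ i ∈ s, f i (Z i ω)) ∂μ ≤ lexp (∑ i ∈ s, c i) := by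
  simp only [lexp_sum]
  rw [lintegral_prod_eq_prod_lintegral_of_indepFun s (fun i ω => lexp (f i (Z i ω)))
    (hind.comp (fun i x => lexp (f i x)) fun i => measurable_lexp_comp (hf i)) fun i => measurable_lexp_comp ((hf i).comp (hZ i))]
  exact Finset.prod_le_prod' fun i _ => h i

variable {ι : Type*} [Fintype ι]

lemma lintegral_lexp_linear_le {Z : ι → S → ℝ} (hind : iIndepFun Z μ)
    (hZ : ∀ j, Measurable (Z j)) {v : ℝ}
    (hv : ∀ j t, ∫⁻ ω, lexp (t * Z j ω) ∂μ ≤ lexp (v * t ^ 2)) (w : ι → ℝ) :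
    ∫⁻ ω, lexp (∑ j, w j * Z j ω) ∂μ ≤ lexp (v * ∑ j, w j ^ 2) := by
  rw [Finset.mul_sum]
  exact lintegral_lexp_sum_le Finset.univ hind hZ (f := fun j x => w j * x)
    (fun j => measurable_const.mul measurable_id) fun j => hv j (w j)

lemma lintegral_lexp_sum_pi_gaussian (f : ι → ℝ → ℝ) (hf : ∀ i, Measurable (f i)) :
    ∫⁻ g, lexp (∑ i, f i (g i)) ∂(Measure.pi fun _ : ι => gaussianReal 0 1) =
      ∏ i, ∫⁻ x, lexp (f i x) ∂(gaussianReal 0 1) := by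
  simp only [lexp_sum]
  rw [lintegral_prod_eq_prod_lintegral_of_indepFun Finset.univ
    (fun i (g : ι → ℝ) => lexp (f i (g i)))
    (iIndepFun_pi (X := fun i x => lexp (f i x))
      fun i => (measurable_lexp_comp (hf i)).aemeasurable)
    fun i => measurable_lexp_comp ((hf i).comp (measurable_pi_apply i))]
  refine Finset.prod_congr rfl fun i _ => ?_
  exact (measurePreserving_eval (fun _ : ι => gaussianReal 0 1) i).lintegral_comp
    (measurable_lexp_comp (hf i))

variable [DecidableEq ι]

/-- The exponential moment of `‖B Z‖²`, by linearizing the square with an independent gaussian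
vector in the eigenbasis of `Bᵀ B`. -/
lemma lintegral_lexp_norm_sq_le [IsProbabilityMeasure μ] {Z : ι → S → ℝ} (hind : iIndepFun Z μ)
    (hZ : ∀ j, Measurable (Z j)) {v : ℝ} (hv0 : 0 ≤ v)
    (hv : ∀ j t, ∫⁻ ω, lexp (t * Z j ω) ∂μ ≤ lexp (v * t ^ 2)) (B : Matrix ι ι ℝ) {η : ℝ}
    (hη : 0 ≤ η) (hsmall : 8 * v * η * opNorm B ^ 2 ≤ 1) :
    ∫⁻ ω, lexp (η * ∑ i, (B *ᵥ fun j => Z j ω) i ^ 2) ∂μ ≤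
      lexp (4 * v * η * frobNorm B ^ 2) := by
  have hherm : (Bᵀ * B).IsHermitian := by
    have := Matrix.isHermitian_conjTranspose_mul_self B
    rwa [Matrix.conjTranspose_eq_transpose_of_trivial] at this
  obtain ⟨U, σ, hU, hU', hσ⟩ := exists_orthogonal_diagonalization hherm
  have hdiag : Matrix.diagonal σ = (B * U)ᵀ * (B * U) := by
    calc Matrix.diagonal σ = (Uᵀ * U) * Matrix.diagonal σ * (Uᵀ * U) := by rw [hU]; simp
      _ = Uᵀ * (U * Matrix.diagonal σ * Uᵀ) * U := by simp only [Matrix.mul_assoc]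
      _ = _ := by rw [← hσ, Matrix.transpose_mul]; simp only [Matrix.mul_assoc]
  have hσ0 : ∀ i, 0 ≤ σ i := by
    intro i
    have := congrFun (congrFun hdiag i) i
    rw [Matrix.diagonal_apply_eq, Matrix.mul_apply] at this
    rw [this]
    exact Finset.sum_nonneg fun j _ => mul_self_nonneg _
  have hσ1 : ∀ i, σ i ≤ opNorm B ^ 2 := by
    intro i
    have h1 := opNorm_orthogonal_le hU
    have h2 := opNorm_nonneg B
    have h3 := opNorm_nonneg U
    calc σ i ≤ |σ i| := le_abs_self _
      _ ≤ opNorm (Matrix.diagonal σ) := opNorm_diagonal_entry_le σ i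
      _ = opNorm (B * U) ^ 2 := by rw [hdiag, opNorm_transpose_mul_self]
      _ ≤ (opNorm B * 1) ^ 2 := by
        refine pow_le_pow_left₀ (opNorm_nonneg _) ((opNorm_mul_le _ _).trans ?_) 2
        gcongr
      _ = _ := by rw [mul_one]
  have hσsum : ∑ i, σ i = frobNorm B ^ 2 := by
    have h1 : (Bᵀ * B).trace = ∑ i, σ i := by
      rw [hσ, Matrix.trace_mul_comm, ← Matrix.mul_assoc, hU, Matrix.one_mul, Matrix.trace_diagonal]
    rw [← h1, trace_transpose_mul_eq_sum, frobNorm_sq]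
    simp only [sq]
  have hquad : ∀ z : ι → ℝ, ∑ i, (B *ᵥ z) i ^ 2 = ∑ i, σ i * (Uᵀ *ᵥ z) i ^ 2 := by
    intro z
    have h1 : ∑ i, (B *ᵥ z) i ^ 2 = z ⬝ᵥ ((Bᵀ * B) *ᵥ z) := by
      rw [← Matrix.mulVec_mulVec, Matrix.dotProduct_mulVec, Matrix.vecMul_transpose]
      simp [dotProduct, sq]
    rw [h1, hσ, ← Matrix.mulVec_mulVec, ← Matrix.mulVec_mulVec, Matrix.dotProduct_mulVec,
      ← Matrix.mulVec_transpose]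
    simp only [dotProduct, Matrix.mulVec_diagonal]
    exact Finset.sum_congr rfl fun i _ => by ring
  set γ : Measure (ι → ℝ) := Measure.pi fun _ : ι => gaussianReal 0 1 with hγ
  set a : ι → ℝ := fun i => √(2 * η * σ i) with ha
  have ha2 : ∀ i, a i ^ 2 = 2 * η * σ i := fun i =>
    Real.sq_sqrt (mul_nonneg (by linarith) (hσ0 i))
  have hlin : ∀ z : ι → ℝ, lexp (η * ∑ i, (B *ᵥ z) i ^ 2) =
      ∫⁻ g, lexp (∑ i, a i * (Uᵀ *ᵥ z) i * g i) ∂γ := by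
    intro z
    rw [lintegral_lexp_sum_pi_gaussian (fun i x => a i * (Uᵀ *ᵥ z) i * x)
      fun i => measurable_const.mul measurable_id]
    simp only [lintegral_lexp_mul_gaussian]
    rw [← lexp_sum, hquad, Finset.mul_sum]
    congr 1
    refine Finset.sum_congr rfl fun i _ => ?_
    rw [mul_pow, ha2]; ring
  have hswap : ∀ (z g : ι → ℝ), ∑ i, a i * (Uᵀ *ᵥ z) i * g i =
      ∑ j, (U *ᵥ fun i => a i * g i) j * z j := by
    intro z g
    simp only [Matrix.mulVec, dotProduct, Finset.mul_sum, Finset.sum_mul, Matrix.transpose_apply]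
    rw [Finset.sum_comm]
    exact Finset.sum_congr rfl fun i _ => Finset.sum_congr rfl fun j _ => by ring
  have hnorm : ∀ g : ι → ℝ, ∑ j, (U *ᵥ fun i => a i * g i) j ^ 2 = ∑ i, 2 * η * σ i * g i ^ 2 := by
    intro g
    have h1 : ∀ x : ι → ℝ, ∑ j, (U *ᵥ x) j ^ 2 = ∑ i, x i ^ 2 := by
      intro x
      have : (U *ᵥ x) ⬝ᵥ (U *ᵥ x) = x ⬝ᵥ x := by
        rw [Matrix.dotProduct_mulVec, Matrix.vecMul_mulVec, hU, Matrix.vecMul_one]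
      simpa [dotProduct, sq] using this
    rw [h1]
    exact Finset.sum_congr rfl fun i _ => by rw [mul_pow, ha2]
  have hmeas : Measurable (Function.uncurry fun (ω : S) (g : ι → ℝ) =>
      lexp (∑ j, (U *ᵥ fun i => a i * g i) j * Z j ω)) := by
    simp only [Function.uncurry_def, Matrix.mulVec, dotProduct]
    have : ∀ j, Measurable fun p : S × (ι → ℝ) => Z j p.1 := fun j => (hZ j).comp measurable_fst
    fun_prop
  calc ∫⁻ ω, lexp (η * ∑ i, (B *ᵥ fun j => Z j ω) i ^ 2) ∂μ
      = ∫⁻ ω, ∫⁻ g, lexp (∑ j, (U *ᵥ fun i => a i * g i) j * Z j ω) ∂γ ∂μ := by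
        simp only [hlin, hswap]
    _ = ∫⁻ g, ∫⁻ ω, lexp (∑ j, (U *ᵥ fun i => a i * g i) j * Z j ω) ∂μ ∂γ :=
        lintegral_lintegral_swap hmeas.aemeasurable
    _ ≤ ∫⁻ g, lexp (∑ i, 2 * v * η * σ i * g i ^ 2) ∂γ := by
        refine lintegral_mono fun g => ?_
        refine (lintegral_lexp_linear_le hind hZ hv _).trans (le_of_eq ?_)
        rw [hnorm, Finset.mul_sum]
        congr 1
        exact Finset.sum_congr rfl fun i _ => by ring
    _ = ∏ i, ∫⁻ x, lexp (2 * v * η * σ i * x ^ 2) ∂(gaussianReal 0 1) :=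
        lintegral_lexp_sum_pi_gaussian (fun i x => 2 * v * η * σ i * x ^ 2)
          fun i => by fun_prop
    _ ≤ ∏ i, lexp (2 * (2 * v * η * σ i)) := by
        refine Finset.prod_le_prod' fun i _ => lintegral_lexp_mul_sq_gaussian_le ?_ ?_
        · have := hσ0 i
          positivity
        · have h1 : 8 * v * η * σ i ≤ 8 * v * η * opNorm B ^ 2 :=
            mul_le_mul_of_nonneg_left (hσ1 i) (by positivity)
          linarith
    _ = _ := by
        rw [← lexp_sum, ← hσsum, Finset.mul_sum]
        congr 1
        exact Finset.sum_congr rfl fun i _ => by ring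

lemma lintegral_comp_of_indepFun [IsProbabilityMeasure μ] {α β : Type*} [MeasurableSpace α]
    [MeasurableSpace β] {f : S → α} {g : S → β} (hf : Measurable f) (hg : Measurable g)
    (hfg : IndepFun f g μ) {F : α → β → ENNReal} (hF : Measurable (Function.uncurry F)) :
    ∫⁻ ω, F (f ω) (g ω) ∂μ = ∫⁻ ω', ∫⁻ ω, F (f ω) (g ω') ∂μ ∂μ := by
  have h1 : ∫⁻ ω, F (f ω) (g ω) ∂μ =
      ∫⁻ z, Function.uncurry F z ∂(μ.map fun ω => (f ω, g ω)) :=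
    (lintegral_map hF (hf.prodMk hg)).symm
  rw [h1, hfg.map_prod_eq_prod_map_map hf.aemeasurable hg.aemeasurable,
    lintegral_prod_symm _ hF.aemeasurable, lintegral_map (Measurable.lintegral_prod_left' hF) hg]
  refine lintegral_congr fun ω' => ?_
  exact lintegral_map (hF.comp (measurable_id.prodMk measurable_const)) hf

/-- The exponential moment of a bilinear form in two complementary sets of coordinates. -/
lemma lintegral_lexp_bilinear_le [IsProbabilityMeasure μ] {Z : ι → S → ℝ} (hind : iIndepFun Z μ)
    (hZ : ∀ j, Measurable (Z j)) {v : ℝ} (hv0 : 0 ≤ v)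
    (hv : ∀ j t, ∫⁻ ω, lexp (t * Z j ω) ∂μ ≤ lexp (v * t ^ 2)) (A : Matrix ι ι ℝ) {l : ℝ}
    (hsmall : 8 * v ^ 2 * l ^ 2 * opNorm A ^ 2 ≤ 1) (I : Finset ι) :
    ∫⁻ ω, lexp (l * ∑ i, ∑ j, if i ∈ I ∧ j ∉ I then A i j * Z i ω * Z j ω else 0) ∂μ ≤
      lexp (4 * v ^ 2 * l ^ 2 * frobNorm A ^ 2) := by
  let f : S → ι → ℝ := fun ω i => if i ∈ I then Z i ω else 0
  let g : S → ι → ℝ := fun ω i => if i ∉ I then Z i ω else 0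
  have hf : Measurable f := measurable_pi_lambda _ fun i => by
    by_cases hi : i ∈ I <;> simp [f, hi, hZ i]
  have hg : Measurable g := measurable_pi_lambda _ fun i => by
    by_cases hi : i ∈ I <;> simp [g, hi, hZ i]
  have hfg : IndepFun f g μ := by
    have h0 := hind.indepFun_finset I Iᶜ disjoint_compl_right hZ
    let φ : (I → ℝ) → ι → ℝ := fun x i => if h : i ∈ I then x ⟨i, h⟩ else 0
    let ψ : ((Iᶜ : Finset ι) → ℝ) → ι → ℝ := fun x i =>
      if h : i ∈ Iᶜ then x ⟨i, h⟩ else 0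
    have hφ : Measurable φ := measurable_pi_lambda _ fun i => by
      by_cases hi : i ∈ I
      · simpa [φ, hi] using measurable_pi_apply _
      · simp [φ, hi]
    have hψ : Measurable ψ := measurable_pi_lambda _ fun i => by
      by_cases hi : i ∈ I
      · simp [ψ, hi]
      · simpa [ψ, hi] using measurable_pi_apply _
    have h1 := h0.comp hφ hψ
    have e1 : (φ ∘ fun a (i : I) => Z i a) = f := by
      funext ω i; by_cases hi : i ∈ I <;> simp [φ, f, hi]
    have e2 : (ψ ∘ fun a (i : (Iᶜ : Finset ι)) => Z i a) = g := by
      funext ω i; by_cases hi : i ∈ I <;> simp [ψ, g, hi]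
    rwa [e1, e2] at h1
  let P : Matrix ι ι ℝ := Matrix.diagonal fun j => if j ∉ I then 1 else 0
  have hgP : ∀ ω, g ω = P *ᵥ fun j => Z j ω := by
    intro ω
    funext j
    simp [g, P, Matrix.mulVec_diagonal]
  have hP1 : opNorm P ≤ 1 := by
    refine opNorm_le_of_sum_sq_mulVec_le zero_le_one fun x => ?_
    rw [one_pow, one_mul]
    refine Finset.sum_le_sum fun j _ => ?_
    by_cases hj : j ∈ I <;> simp [P, Matrix.mulVec_diagonal, hj, sq_nonneg]
  have hAP : opNorm (A * P) ≤ opNorm A :=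
    (opNorm_mul_le _ _).trans (mul_le_of_le_one_right (opNorm_nonneg _) hP1)
  have hAPF : frobNorm (A * P) ≤ frobNorm A :=
    (frobNorm_mul_le_mul_opNorm _ _).trans (mul_le_of_le_one_right (frobNorm_nonneg _) hP1)
  have hF : Measurable (Function.uncurry fun (x y : ι → ℝ) =>
      lexp (l * ∑ i, ∑ j, A i j * x i * y j)) := by
    simp only [Function.uncurry_def]
    fun_prop
  calc ∫⁻ ω, lexp (l * ∑ i, ∑ j, if i ∈ I ∧ j ∉ I then A i j * Z i ω * Z j ω else 0) ∂μ
      = ∫⁻ ω, lexp (l * ∑ i, ∑ j, A i j * f ω i * g ω j) ∂μ := by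
        refine lintegral_congr fun ω => ?_
        congr 2
        refine Finset.sum_congr rfl fun i _ => Finset.sum_congr rfl fun j _ => ?_
        by_cases hi : i ∈ I <;> by_cases hj : j ∈ I <;> simp [f, g, hi, hj]
    _ = ∫⁻ ω', ∫⁻ ω, lexp (l * ∑ i, ∑ j, A i j * f ω i * g ω' j) ∂μ ∂μ :=
        lintegral_comp_of_indepFun hf hg hfg hF
    _ ≤ ∫⁻ ω', lexp (v * l ^ 2 * ∑ i, ((A * P) *ᵥ fun j => Z j ω') i ^ 2) ∂μ := by
        refine lintegral_mono fun ω' => ?_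
        let w : ι → ℝ := fun i => if i ∈ I then l * (A *ᵥ g ω') i else 0
        have e : ∀ ω, l * ∑ i, ∑ j, A i j * f ω i * g ω' j = ∑ i, w i * Z i ω := by
          intro ω
          rw [Finset.mul_sum]
          refine Finset.sum_congr rfl fun i _ => ?_
          by_cases hi : i ∈ I
          · simp only [f, w, hi, if_true, Matrix.mulVec, dotProduct]
            rw [mul_assoc, Finset.sum_mul]
            congr 1
            exact Finset.sum_congr rfl fun j _ => by ring
          · simp [f, w, hi]
        simp only [e]
        refine (lintegral_lexp_linear_le hind hZ hv w).trans (lexp_mono ?_)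
        rw [mul_assoc]
        refine mul_le_mul_of_nonneg_left ?_ hv0
        rw [Finset.mul_sum]
        refine Finset.sum_le_sum fun i _ => ?_
        rw [← Matrix.mulVec_mulVec, ← hgP]
        by_cases hi : i ∈ I
        · simp only [w, hi, if_true]
          rw [mul_pow]
        · simp only [w, hi, if_false]
          rw [zero_pow two_ne_zero]
          positivity
    _ ≤ lexp (4 * v * (v * l ^ 2) * frobNorm (A * P) ^ 2) := by
        refine lintegral_lexp_norm_sq_le hind hZ hv0 hv (A * P) (by positivity) ?_
        refine le_trans ?_ hsmall
        rw [show 8 * v * (v * l ^ 2) = 8 * v ^ 2 * l ^ 2 by ring]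
        have := opNorm_nonneg (A * P)
        gcongr
    _ ≤ _ := by
        refine lexp_mono ?_
        rw [show 4 * v * (v * l ^ 2) = 4 * v ^ 2 * l ^ 2 by ring]
        have := frobNorm_nonneg (A * P)
        gcongr

lemma four_mul_card_filter_mem_notMem {i j : ι} (hij : i ≠ j) :
    4 * ((Finset.univ : Finset (Finset ι)).filter fun I => i ∈ I ∧ j ∉ I).card =
      2 ^ Fintype.card ι := by
  have h1 : ((Finset.univ : Finset (Finset ι)).filter fun I => i ∈ I ∧ j ∉ I) =
      ((Finset.univ.erase i).erase j).powerset.image (insert i) := by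
    ext I
    simp only [Finset.mem_filter, Finset.mem_univ, true_and, Finset.mem_image, Finset.mem_powerset]
    constructor
    · rintro ⟨hi, hj⟩
      refine ⟨I.erase i, fun x hx => ?_, Finset.insert_erase hi⟩
      rw [Finset.mem_erase] at hx
      simp only [Finset.mem_erase, Finset.mem_univ, and_true]
      exact ⟨fun h => hj (h ▸ hx.2), hx.1⟩
    · rintro ⟨J, hJ, rfl⟩
      refine ⟨Finset.mem_insert_self _ _, fun h => ?_⟩
      rcases Finset.mem_insert.1 h with h | h
      · exact hij h.symm
      · have := hJ h
        simp at this
  have hinj : Set.InjOn (insert i) (((Finset.univ.erase i).erase j).powerset : Set (Finset ι)) := by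
    intro J hJ J' hJ' h
    have hn : ∀ J ∈ ((Finset.univ.erase i).erase j).powerset, i ∉ J := by
      intro J hJ hi
      have := (Finset.mem_powerset.1 hJ) hi
      simp at this
    rw [← Finset.erase_insert (hn J hJ), ← Finset.erase_insert (hn J' hJ'), h]
  have hcard : 2 ≤ Fintype.card ι := by
    have := Finset.card_le_univ ({i, j} : Finset ι)
    rwa [Finset.card_pair hij] at this
  rw [h1, Finset.card_image_of_injOn hinj, Finset.card_powerset,
    Finset.card_erase_of_mem (Finset.mem_erase.2 ⟨hij.symm, Finset.mem_univ _⟩),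
    Finset.card_erase_of_mem (Finset.mem_univ _), Finset.card_univ]
  obtain ⟨m, hm⟩ := Nat.exists_eq_add_of_le hcard
  rw [hm, show 2 + m - 1 - 1 = m by omega, pow_add]
  norm_num

/-- Decoupling: an off-diagonal quadratic form is an average of bilinear forms in complementary
sets of coordinates. -/
lemma lexp_offDiag_le (A : Matrix ι ι ℝ) (z : ι → ℝ) (l : ℝ) :
    lexp (l * ∑ i, ∑ j, if i = j then 0 else A i j * z i * z j) ≤
      ∑ I : Finset ι, ENNReal.ofReal ((2 ^ Fintype.card ι : ℝ)⁻¹) *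
        lexp (4 * l * ∑ i, ∑ j, if i ∈ I ∧ j ∉ I then A i j * z i * z j else 0) := by
  set N : ℝ := 2 ^ Fintype.card ι with hN
  have hN0 : 0 < N := by positivity
  have key : l * (∑ i, ∑ j, if i = j then 0 else A i j * z i * z j) = ∑ I : Finset ι,
      N⁻¹ • (4 * l * ∑ i, ∑ j, if i ∈ I ∧ j ∉ I then A i j * z i * z j else 0) := by
    have e : ∀ i j, (∑ I : Finset ι, if i ∈ I ∧ j ∉ I then A i j * z i * z j else 0) =
        if i = j then 0 else N / 4 * (A i j * z i * z j) := by
      intro i j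
      by_cases hij : i = j
      · subst hij
        simp
      · rw [← Finset.sum_filter, Finset.sum_const, nsmul_eq_mul, if_neg hij]
        congr 1
        have h4 := four_mul_card_filter_mem_notMem hij
        have : (4 : ℝ) * (((Finset.univ : Finset (Finset ι)).filter
            fun I => i ∈ I ∧ j ∉ I).card : ℝ) = N := by
          rw [hN]; exact_mod_cast h4
        linarith
    have e2 : (∑ I : Finset ι, ∑ i, ∑ j, if i ∈ I ∧ j ∉ I then A i j * z i * z j else 0) =
        N / 4 * ∑ i, ∑ j, if i = j then 0 else A i j * z i * z j := by
      rw [Finset.sum_comm, Finset.mul_sum]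
      refine Finset.sum_congr rfl fun i _ => ?_
      rw [Finset.sum_comm, Finset.mul_sum]
      refine Finset.sum_congr rfl fun j _ => ?_
      rw [e]
      by_cases hij : i = j <;> simp [hij]
    simp only [smul_eq_mul, ← Finset.mul_sum]
    rw [e2]
    field_simp
  rw [key]
  unfold lexp
  have hconv := convexOn_exp.map_sum_le (t := (Finset.univ : Finset (Finset ι)))
    (w := fun _ => N⁻¹)
    (p := fun I => 4 * l * ∑ i, ∑ j, if i ∈ I ∧ j ∉ I then A i j * z i * z j else 0)
    (fun _ _ => by positivity) (by simp [hN]) (fun _ _ => Set.mem_univ _)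
  refine (ENNReal.ofReal_le_ofReal hconv).trans (le_of_eq ?_)
  rw [ENNReal.ofReal_sum_of_nonneg fun _ _ => by positivity]
  refine Finset.sum_congr rfl fun I _ => ?_
  rw [smul_eq_mul, ENNReal.ofReal_mul (by positivity)]

lemma lintegral_lexp_offDiag_le [IsProbabilityMeasure μ] {Z : ι → S → ℝ} (hind : iIndepFun Z μ)
    (hZ : ∀ j, Measurable (Z j)) {v : ℝ} (hv0 : 0 ≤ v)
    (hv : ∀ j t, ∫⁻ ω, lexp (t * Z j ω) ∂μ ≤ lexp (v * t ^ 2)) (A : Matrix ι ι ℝ) {l : ℝ}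
    (hsmall : 128 * v ^ 2 * l ^ 2 * opNorm A ^ 2 ≤ 1) :
    ∫⁻ ω, lexp (l * ∑ i, ∑ j, if i = j then 0 else A i j * Z i ω * Z j ω) ∂μ ≤
      lexp (64 * v ^ 2 * l ^ 2 * frobNorm A ^ 2) := by
  calc _ ≤ ∫⁻ ω, ∑ I : Finset ι, ENNReal.ofReal ((2 ^ Fintype.card ι : ℝ)⁻¹) *
        lexp (4 * l * ∑ i, ∑ j, if i ∈ I ∧ j ∉ I then A i j * Z i ω * Z j ω else 0) ∂μ :=
        lintegral_mono fun ω => lexp_offDiag_le A (fun j => Z j ω) l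
    _ = ∑ I : Finset ι, ENNReal.ofReal ((2 ^ Fintype.card ι : ℝ)⁻¹) * ∫⁻ ω,
        lexp (4 * l * ∑ i, ∑ j, if i ∈ I ∧ j ∉ I then A i j * Z i ω * Z j ω else 0) ∂μ := by
        have hm : ∀ I : Finset ι, Measurable fun ω =>
            lexp (4 * l * ∑ i, ∑ j, if i ∈ I ∧ j ∉ I then A i j * Z i ω * Z j ω else 0) := by
          intro I
          refine measurable_lexp_comp (measurable_const.mul (Finset.measurable_sum _ fun i _ =>
            Finset.measurable_sum _ fun j _ => ?_))
          by_cases h : i ∈ I ∧ j ∉ I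
          · simp only [h]
            exact (measurable_const.mul (hZ i)).mul (hZ j)
          · simp only [h, if_false]
            exact measurable_const
        rw [lintegral_finsetSum _ fun I _ => (hm I).const_mul _]
        exact Finset.sum_congr rfl fun I _ => lintegral_const_mul _ (hm I)
    _ ≤ ∑ I : Finset ι, ENNReal.ofReal ((2 ^ Fintype.card ι : ℝ)⁻¹) *
        lexp (64 * v ^ 2 * l ^ 2 * frobNorm A ^ 2) := by
        refine Finset.sum_le_sum fun I _ => ?_
        gcongr
        refine (lintegral_lexp_bilinear_le hind hZ hv0 hv A (l := 4 * l) ?_ I).trans (le_of_eq ?_)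
        · rw [mul_pow]; linarith
        · congr 1; ring
    _ = _ := by
        rw [Finset.sum_const, Finset.card_univ, Fintype.card_finset, nsmul_eq_mul, ← mul_assoc]
        have : ((2 ^ Fintype.card ι : ℕ) : ENNReal) *
            ENNReal.ofReal ((2 ^ Fintype.card ι : ℝ)⁻¹) = 1 := by
          rw [← ENNReal.ofReal_natCast, ← ENNReal.ofReal_mul (by positivity)]
          push_cast
          rw [mul_inv_cancel₀ (by positivity), ENNReal.ofReal_one]
        rw [this, one_mul]

lemma abs_entry_le_opNorm (A : Matrix ι ι ℝ) (i j : ι) : |A i j| ≤ opNorm A := by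
  refine abs_le_of_sq_le_sq ?_ (opNorm_nonneg _)
  have h := sum_sq_mulVec_le A (Pi.single j 1)
  have h2 : A i j ^ 2 ≤ ∑ i, (A *ᵥ Pi.single j 1) i ^ 2 := by
    simp only [Matrix.mulVec_single_one]
    exact Finset.single_le_sum (f := fun i => A i j ^ 2) (fun _ _ => sq_nonneg _)
      (Finset.mem_univ i)
  refine h2.trans (h.trans (le_of_eq ?_))
  simp [Pi.single_apply, ite_pow]

/-- The Hanson–Wright inequality, in terms of moment generating functions. -/
lemma exists_hansonWright (K : ℝ) (hK : 0 < K) : ∃ C c : ℝ, 0 < C ∧ 0 < c ∧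
    ∀ {S : Type*} [MeasurableSpace S] (μ : Measure S) [IsProbabilityMeasure μ] {ι : Type*}
      [Fintype ι] [DecidableEq ι] (Z : ι → S → ℝ), (∀ j, Measurable (Z j)) → iIndepFun Z μ →
      (∀ j, ∫ ω, Z j ω ∂μ = 0) → (∀ j, ∫ ω, Z j ω ^ 2 ∂μ = 1) →
      (∀ j, psiTwoNorm μ (Z j) ≤ ENNReal.ofReal K) → ∀ (A : Matrix ι ι ℝ) (l : ℝ),
      |l| * opNorm A ≤ c →
      ∫⁻ ω, lexp (l * ((fun j => Z j ω) ⬝ᵥ A *ᵥ (fun j => Z j ω) - A.trace)) ∂μ ≤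
        lexp (C * l ^ 2 * frobNorm A ^ 2) := by
  set k := 2 * K with hk
  have hk0 : 0 < k := by positivity
  set v := k ^ 2 with hv
  have hv0 : 0 < v := by positivity
  set C₁ := 16 * k ^ 4 * Real.exp (1 / k ^ 2) with hC₁
  have hC₁0 : 0 < C₁ := by positivity
  refine ⟨4 * C₁ + 256 * v ^ 2, 1 / (32 * v), by positivity, by positivity, ?_⟩
  intro S _ μ _ ι _ _ Z hZ hind h0 h1 hpsi A l hl
  have hψ : ∀ j, ∫⁻ ω, lexp (Z j ω ^ 2 / k ^ 2) ∂μ ≤ 2 := fun j =>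
    lintegral_lexp_le_of_psiTwoNorm_le hK (hpsi j)
  have hmgf : ∀ j t, ∫⁻ ω, lexp (t * Z j ω) ∂μ ≤ lexp (v * t ^ 2) := fun j t =>
    lintegral_lexp_mul_le (hZ j) hk0 (hψ j) (h0 j) t
  have hl' : |l| * opNorm A * (32 * v) ≤ 1 := by
    rwa [le_div_iff₀ (by positivity)] at hl
  have hlA0 : 0 ≤ |l| * opNorm A := mul_nonneg (abs_nonneg _) (opNorm_nonneg _)
  have hF0 := sq_nonneg (frobNorm A)
  have hoff : ∫⁻ ω, lexp (2 * l * ∑ i, ∑ j, if i = j then 0 else A i j * Z i ω * Z j ω) ∂μ ≤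
      lexp ((4 * C₁ + 256 * v ^ 2) * l ^ 2 * frobNorm A ^ 2) := by
    refine (lintegral_lexp_offDiag_le hind hZ hv0.le hmgf A ?_).trans (lexp_mono ?_)
    · have : 128 * v ^ 2 * (2 * l) ^ 2 * opNorm A ^ 2 = (|l| * opNorm A * (32 * v)) ^ 2 / 2 := by
        rw [mul_pow (|l| * opNorm A), mul_pow |l|, sq_abs]; ring
      rw [this]
      have : 0 ≤ |l| * opNorm A * (32 * v) := by positivity
      nlinarith
    · have : 0 ≤ C₁ * l ^ 2 * frobNorm A ^ 2 := by positivity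
      nlinarith
  have hdiag : ∫⁻ ω, lexp (∑ j, 2 * l * A j j * (Z j ω ^ 2 - 1)) ∂μ ≤
      lexp ((4 * C₁ + 256 * v ^ 2) * l ^ 2 * frobNorm A ^ 2) := by
    have hj : ∀ j, ∫⁻ ω, lexp (2 * l * A j j * (Z j ω ^ 2 - 1)) ∂μ ≤
        lexp (C₁ * (2 * l * A j j) ^ 2) := by
      intro j
      refine lintegral_lexp_mul_sq_sub_one_le (hZ j) hk0 (hψ j) (h1 j) ?_
      rw [abs_mul, abs_mul, abs_two]
      have h2 : |l| * |A j j| ≤ |l| * opNorm A :=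
        mul_le_mul_of_nonneg_left (abs_entry_le_opNorm A j j) (abs_nonneg _)
      have h3 : |l| * |A j j| * v ≤ |l| * opNorm A * v := mul_le_mul_of_nonneg_right h2 hv0.le
      have h4 : 0 ≤ |l| * opNorm A * v := by positivity
      rw [← hv]
      nlinarith
    refine (lintegral_lexp_sum_le Finset.univ hind hZ
      (f := fun j x => 2 * l * A j j * (x ^ 2 - 1)) (fun j => by fun_prop) hj).trans (lexp_mono ?_)
    have h2 : ∑ j, A j j ^ 2 ≤ frobNorm A ^ 2 := by
      rw [frobNorm_sq]
      exact Finset.sum_le_sum fun j _ => Finset.single_le_sum (f := fun i => A j i ^ 2)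
        (fun _ _ => sq_nonneg _) (Finset.mem_univ j)
    have h3 : ∑ j, C₁ * (2 * l * A j j) ^ 2 = 4 * C₁ * l ^ 2 * ∑ j, A j j ^ 2 := by
      rw [Finset.mul_sum]
      exact Finset.sum_congr rfl fun j _ => by ring
    rw [h3]
    have h4 : 4 * C₁ * l ^ 2 * ∑ j, A j j ^ 2 ≤ 4 * C₁ * l ^ 2 * frobNorm A ^ 2 := by gcongr
    have : 0 ≤ v ^ 2 * l ^ 2 * frobNorm A ^ 2 := by positivity
    nlinarith
  have hsplit : ∀ ω, l * ((fun j => Z j ω) ⬝ᵥ A *ᵥ (fun j => Z j ω) - A.trace) =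
      1 / 2 * (∑ j, 2 * l * A j j * (Z j ω ^ 2 - 1)) +
      1 / 2 * (2 * l * ∑ i, ∑ j, if i = j then 0 else A i j * Z i ω * Z j ω) := by
    intro ω
    have e1 : (fun j => Z j ω) ⬝ᵥ A *ᵥ (fun j => Z j ω) =
        ∑ j, A j j * Z j ω ^ 2 + ∑ i, ∑ j, if i = j then 0 else A i j * Z i ω * Z j ω := by
      simp only [dotProduct, Matrix.mulVec, ← Finset.sum_add_distrib, Finset.mul_sum]
      refine Finset.sum_congr rfl fun i _ => ?_
      rw [← Finset.add_sum_erase _ _ (Finset.mem_univ i),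
        ← Finset.add_sum_erase (a := i) _ _ (Finset.mem_univ i), if_pos rfl, zero_add]
      congr 1
      · ring
      · refine Finset.sum_congr rfl fun j hj => ?_
        rw [if_neg (Finset.ne_of_mem_erase hj).symm]
        ring
    have e2 : ∑ j, 2 * l * A j j * (Z j ω ^ 2 - 1) =
        2 * l * (∑ j, A j j * Z j ω ^ 2 - A.trace) := by
      simp only [Matrix.trace, Matrix.diag, ← Finset.sum_sub_distrib, Finset.mul_sum]
      exact Finset.sum_congr rfl fun j _ => by ring
    rw [e1, e2]
    ring
  have havg : ∀ x y : ℝ, lexp (1 / 2 * x + 1 / 2 * y) ≤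
      ENNReal.ofReal (1 / 2) * lexp x + ENNReal.ofReal (1 / 2) * lexp y := by
    intro x y
    unfold lexp
    rw [← ENNReal.ofReal_mul (by norm_num), ← ENNReal.ofReal_mul (by norm_num),
      ← ENNReal.ofReal_add (by positivity) (by positivity)]
    refine ENNReal.ofReal_le_ofReal ?_
    exact convexOn_exp.2 (Set.mem_univ x) (Set.mem_univ y) (by norm_num) (by norm_num)
      (by norm_num)
  have hm : Measurable fun ω => lexp (∑ j, 2 * l * A j j * (Z j ω ^ 2 - 1)) := by fun_prop
  calc _ ≤ ∫⁻ ω, (ENNReal.ofReal (1 / 2) * lexp (∑ j, 2 * l * A j j * (Z j ω ^ 2 - 1)) +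
        ENNReal.ofReal (1 / 2) *
          lexp (2 * l * ∑ i, ∑ j, if i = j then 0 else A i j * Z i ω * Z j ω)) ∂μ := by
        refine lintegral_mono fun ω => ?_
        rw [hsplit]
        exact havg _ _
    _ ≤ ENNReal.ofReal (1 / 2) * lexp ((4 * C₁ + 256 * v ^ 2) * l ^ 2 * frobNorm A ^ 2) +
        ENNReal.ofReal (1 / 2) * lexp ((4 * C₁ + 256 * v ^ 2) * l ^ 2 * frobNorm A ^ 2) := by
        rw [lintegral_add_left (hm.const_mul _), lintegral_const_mul _ hm,
          lintegral_const_mul' _ _ ENNReal.ofReal_ne_top]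
        gcongr
    _ = _ := by
        rw [← add_mul, ← ENNReal.ofReal_add (by norm_num) (by norm_num)]
        norm_num

end HansonWright

section Deviation

variable {ι : Type*} [Fintype ι]

/-- The deviation `⟨Ŝ - Σ, M⟩` of the sample covariance tested against `M`. -/
noncomputable def deviation {n : ℕ} (x : Fin n → ι → ℝ) (Sig M : Matrix ι ι ℝ) : ℝ :=
  ((sampleCov x - Sig)ᵀ * M).trace

lemma trace_transpose_vecMulVec_mul (x : ι → ℝ) (M : Matrix ι ι ℝ) :
    ((Matrix.vecMulVec x x)ᵀ * M).trace = x ⬝ᵥ M *ᵥ x := by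
  rw [trace_transpose_mul_eq_sum]
  simp only [dotProduct, Matrix.mulVec, Matrix.vecMulVec_apply, Finset.mul_sum]
  exact Finset.sum_congr rfl fun i _ => Finset.sum_congr rfl fun j _ => by ring

lemma deviation_eq {n : ℕ} (x : Fin n → ι → ℝ) (Sig M : Matrix ι ι ℝ) :
    deviation x Sig M = (n : ℝ)⁻¹ * ∑ i, x i ⬝ᵥ M *ᵥ x i - (Sigᵀ * M).trace := by
  rw [deviation, sampleCov, Matrix.transpose_sub, Matrix.sub_mul, Matrix.trace_sub,
    Matrix.transpose_smul, Matrix.smul_mul, Matrix.trace_smul, Matrix.transpose_sum,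
    Matrix.sum_mul, Matrix.trace_sum, smul_eq_mul]
  simp only [trace_transpose_vecMulVec_mul]

lemma nat_mul_deviation_eq {n : ℕ} (hn : 0 < n) (x : Fin n → ι → ℝ) (Sig M : Matrix ι ι ℝ) :
    n * deviation x Sig M = ∑ i, (x i ⬝ᵥ M *ᵥ x i - (Sigᵀ * M).trace) := by
  have hn' : (n : ℝ) ≠ 0 := by exact_mod_cast hn.ne'
  rw [deviation_eq, mul_sub, mul_inv_cancel_left₀ hn', Finset.sum_sub_distrib]
  simp

lemma deviation_add {n : ℕ} (x : Fin n → ι → ℝ) (Sig M N : Matrix ι ι ℝ) :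
    deviation x Sig (M + N) = deviation x Sig M + deviation x Sig N := by
  simp only [deviation, Matrix.mul_add, Matrix.trace_add]

lemma deviation_smul {n : ℕ} (x : Fin n → ι → ℝ) (Sig M : Matrix ι ι ℝ) (t : ℝ) :
    deviation x Sig (t • M) = t * deviation x Sig M := by
  simp only [deviation, Matrix.mul_smul, Matrix.trace_smul, smul_eq_mul]

variable {S : Type*} [MeasurableSpace S] {μ : Measure S}

lemma IsSubGaussianTensor.measurable {K : ℝ} {cov : Matrix ι ι ℝ} {X : S → ι → ℝ}
    (h : IsSubGaussianTensor μ K cov X) : Measurable X := by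
  obtain ⟨R, Z, -, -, hZ, -, -, -, -, hX⟩ := h
  rw [show X = fun ω => R *ᵥ fun j => Z j ω from funext hX]
  refine measurable_pi_lambda _ fun i => ?_
  simp only [Matrix.mulVec, dotProduct]
  fun_prop

lemma measurable_quadForm (M : Matrix ι ι ℝ) : Measurable fun x : ι → ℝ => x ⬝ᵥ M *ᵥ x := by
  simp only [Matrix.mulVec, dotProduct]
  fun_prop

lemma measurable_deviation {n : ℕ} {X : Fin n → S → ι → ℝ} (hX : ∀ i, Measurable (X i))
    (Sig M : Matrix ι ι ℝ) : Measurable fun ω => deviation (fun i => X i ω) Sig M := by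
  simp only [deviation_eq]
  exact (measurable_const.mul (Finset.measurable_sum _ fun i _ =>
    (measurable_quadForm M).comp (hX i))).sub measurable_const

end Deviation

section Tail

/-- A sub-gaussian tail bound for the deviation of the sample covariance, with a free Chernoff
parameter `l`. -/
lemma exists_deviation_tail (K : ℝ) (hK : 0 < K) : ∃ C c : ℝ, 0 < C ∧ 0 < c ∧
    ∀ {S : Type*} [MeasurableSpace S] (μ : Measure S) [IsProbabilityMeasure μ] {ι : Type*}
      [Fintype ι] [DecidableEq ι] {n : ℕ}, 0 < n → ∀ (Sig : Matrix ι ι ℝ) (X : Fin n → S → ι → ℝ),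
      (∀ i, IsSubGaussianTensor μ K Sig (X i)) → iIndepFun X μ → ∀ (M : Matrix ι ι ℝ) (l t : ℝ),
      0 ≤ l → l * (opNorm Sig * opNorm M) ≤ c →
      μ {ω | t < |deviation (fun i => X i ω) Sig M|} ≤
        2 * lexp (-(l * n * t) + C * n * l ^ 2 * (opNorm Sig * frobNorm M) ^ 2) := by
  obtain ⟨C, c, hC, hc, hHW⟩ := exists_hansonWright K hK
  refine ⟨C, c, hC, hc, ?_⟩
  intro S _ μ _ ι _ _ n hn Sig X hX hind M l t hl0 hl
  have hmeasX : ∀ i, Measurable (X i) := fun i => (hX i).measurable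
  have hone : ∀ (l' : ℝ), |l'| = l → ∀ i,
      ∫⁻ ω, lexp (l' * (X i ω ⬝ᵥ M *ᵥ X i ω - (Sigᵀ * M).trace)) ∂μ ≤
        lexp (C * l ^ 2 * (opNorm Sig * frobNorm M) ^ 2) := by
    intro l' hl' i
    obtain ⟨R, Z, hR, hRR, hZ, hZind, h0, h1, hpsi, hXi⟩ := hX i
    have hRt : Rᵀ = R := by
      have := hR.isHermitian
      rwa [Matrix.IsHermitian, Matrix.conjTranspose_eq_transpose_of_trivial] at this
    have hRn : opNorm R * opNorm R = opNorm Sig := by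
      rw [← hRR, ← sq, ← opNorm_transpose_mul_self, hRt]
    have hSt : Sigᵀ = Sig := by rw [← hRR, Matrix.transpose_mul, hRt]
    have htr : (R * M * R).trace = (Sigᵀ * M).trace := by
      rw [Matrix.mul_assoc, Matrix.trace_mul_comm, Matrix.mul_assoc, hRR, hSt,
        Matrix.trace_mul_comm]
    have hquad : ∀ ω, X i ω ⬝ᵥ M *ᵥ X i ω =
        (fun j => Z j ω) ⬝ᵥ (R * M * R) *ᵥ fun j => Z j ω := by
      intro ω
      rw [hXi ω, Matrix.mul_assoc, ← Matrix.mulVec_mulVec, ← Matrix.mulVec_mulVec,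
        Matrix.dotProduct_mulVec (fun j => Z j ω) R, ← Matrix.mulVec_transpose, hRt]
    simp only [hquad, ← htr]
    have hop : opNorm (R * M * R) ≤ opNorm Sig * opNorm M := by
      rw [← hRn]; exact opNorm_mul_mul_le R M R
    have hfr : frobNorm (R * M * R) ≤ opNorm Sig * frobNorm M := by
      rw [← hRn]; exact frobNorm_mul_mul_le R M R
    refine (hHW μ Z hZ hZind h0 h1 hpsi (R * M * R) l' ?_).trans (lexp_mono ?_)
    · rw [hl']
      exact (mul_le_mul_of_nonneg_left hop hl0).trans hl
    · rw [← sq_abs l', hl']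
      have := frobNorm_nonneg (R * M * R)
      gcongr
  have hsum : ∀ (l' : ℝ), |l'| = l →
      ∫⁻ ω, lexp (l' * (n * deviation (fun i => X i ω) Sig M)) ∂μ ≤
        lexp (C * n * l ^ 2 * (opNorm Sig * frobNorm M) ^ 2) := by
    intro l' hl'
    have h1 := lintegral_lexp_sum_le Finset.univ hind hmeasX
      (f := fun _ x => l' * (x ⬝ᵥ M *ᵥ x - (Sigᵀ * M).trace))
      (fun _ => measurable_const.mul ((measurable_quadForm M).sub measurable_const))
      (hone l' hl')
    simp only [nat_mul_deviation_eq hn, Finset.mul_sum]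
    refine h1.trans (le_of_eq ?_)
    congr 1
    rw [Finset.sum_const, Finset.card_univ, Fintype.card_fin, nsmul_eq_mul]
    ring
  have hmark : ∀ (l' : ℝ), |l'| = l →
      μ {ω | l * n * t ≤ l' * (n * deviation (fun i => X i ω) Sig M)} ≤
        lexp (-(l * n * t) + C * n * l ^ 2 * (opNorm Sig * frobNorm M) ^ 2) := by
    intro l' hl'
    have hm : Measurable fun ω => lexp (l' * (n * deviation (fun i => X i ω) Sig M)) :=
      measurable_lexp_comp (measurable_const.mul
        (measurable_const.mul (measurable_deviation hmeasX Sig M)))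
    have h1 := (mul_meas_ge_le_lintegral (μ := μ) hm (lexp (l * n * t))).trans (hsum l' hl')
    have h2 : μ {ω | l * n * t ≤ l' * (n * deviation (fun i => X i ω) Sig M)} ≤
        μ {ω | lexp (l * n * t) ≤ lexp (l' * (n * deviation (fun i => X i ω) Sig M))} :=
      measure_mono fun ω hω => lexp_mono hω
    rw [lexp_add]
    calc _ = lexp (-(l * n * t)) * (lexp (l * n * t) *
          μ {ω | l * n * t ≤ l' * (n * deviation (fun i => X i ω) Sig M)}) := by
          rw [← mul_assoc, ← lexp_add, neg_add_cancel, lexp_zero, one_mul]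
      _ ≤ _ := by
          gcongr
          exact le_trans (by gcongr) h1
  have hsub : {ω | t < |deviation (fun i => X i ω) Sig M|} ⊆
      {ω | l * n * t ≤ l * (n * deviation (fun i => X i ω) Sig M)} ∪
      {ω | l * n * t ≤ -l * (n * deviation (fun i => X i ω) Sig M)} := by
    intro ω hω
    have hln : 0 ≤ l * n := by positivity
    have hω' : t < |deviation (fun i => X i ω) Sig M| := hω
    rcases lt_abs.1 hω' with h | h
    · left
      have := mul_le_mul_of_nonneg_left h.le hln
      change l * n * t ≤ l * (n * deviation (fun i => X i ω) Sig M)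
      linarith
    · right
      have := mul_le_mul_of_nonneg_left h.le hln
      change l * n * t ≤ -l * (n * deviation (fun i => X i ω) Sig M)
      linarith
  refine (measure_mono hsub).trans ((measure_union_le _ _).trans ?_)
  rw [two_mul]
  exact add_le_add (hmark l (abs_of_nonneg hl0)) (hmark (-l) (by rw [abs_neg, abs_of_nonneg hl0]))

end Tail

section Net

/-- The unit ball of a finite-dimensional space has a `1/2`-net of at most `5 ^ dim` points. -/
lemma exists_half_net (E : Type*) [NormedAddCommGroup E] [NormedSpace ℝ E] [FiniteDimensional ℝ E] :
    ∃ N : Finset E, N.card ≤ 5 ^ Module.finrank ℝ E ∧ (∀ u ∈ N, ‖u‖ ≤ 1) ∧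
      ∀ v : E, ‖v‖ ≤ 1 → ∃ u ∈ N, ‖v - u‖ ≤ 1 / 2 := by
  classical
  let Sep : Finset E → Prop := fun s =>
    (∀ c ∈ s, ‖c‖ ≤ 2) ∧ ∀ c ∈ s, ∀ e ∈ s, c ≠ e → 1 ≤ ‖c - e‖
  let P : ℕ → Prop := fun m => ∃ s, Sep s ∧ s.card = m
  have hb : ∀ s, Sep s → s.card ≤ 5 ^ Module.finrank ℝ E := fun s hs =>
    Besicovitch.card_le_of_separated s hs.1 hs.2
  have hP0 : P 0 := ⟨∅, ⟨by simp, by simp⟩, rfl⟩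
  obtain ⟨s, hs, hcard⟩ := Nat.findGreatest_spec (P := P)
    (Nat.zero_le (5 ^ Module.finrank ℝ E)) hP0
  refine ⟨s.image fun c => (1 / 2 : ℝ) • c, Finset.card_image_le.trans (hb s hs), ?_, ?_⟩
  · intro u hu
    obtain ⟨c, hc, rfl⟩ := Finset.mem_image.1 hu
    rw [norm_smul]
    have := hs.1 c hc
    norm_num
    linarith
  · intro v hv
    have key : ∃ c ∈ s, ‖(2 : ℝ) • v - c‖ ≤ 1 := by
      by_contra hcon
      push Not at hcon
      have h2v : (2 : ℝ) • v ∉ s := by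
        intro hmem
        have := hcon _ hmem
        simp at this
        linarith
      have hins : Sep (insert ((2 : ℝ) • v) s) := by
        constructor
        · intro c hc
          rcases Finset.mem_insert.1 hc with rfl | hc
          · rw [norm_smul]; norm_num; linarith
          · exact hs.1 c hc
        · intro c hc e he hne
          rcases Finset.mem_insert.1 hc with rfl | hc <;> rcases Finset.mem_insert.1 he with rfl | he
          · exact absurd rfl hne
          · exact (hcon e he).le
          · rw [norm_sub_rev]; exact (hcon c hc).le
          · exact hs.2 c hc e he hne
      have h1 : (insert ((2 : ℝ) • v) s).card = s.card + 1 := Finset.card_insert_of_notMem h2v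
      have h2 := Nat.le_findGreatest (P := P) (h1 ▸ hb _ hins) ⟨_, hins, h1⟩
      omega
    obtain ⟨c, hc, hle⟩ := key
    refine ⟨(1 / 2 : ℝ) • c, Finset.mem_image_of_mem _ hc, ?_⟩
    have : v - (1 / 2 : ℝ) • c = (1 / 2 : ℝ) • ((2 : ℝ) • v - c) := by
      rw [smul_sub, smul_smul]; norm_num
    rw [this, norm_smul]
    norm_num
    linarith

lemma abs_le_of_abs_le_on_net {E : Type*} [NormedAddCommGroup E] [NormedSpace ℝ E]
    [FiniteDimensional ℝ E] {N : Finset E}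
    (hN : ∀ v : E, ‖v‖ ≤ 1 → ∃ u ∈ N, ‖v - u‖ ≤ 1 / 2) (ℓ : E →ₗ[ℝ] ℝ) {t : ℝ}
    (ht0 : 0 ≤ t) (ht : ∀ u ∈ N, |ℓ u| ≤ t) (v : E) : |ℓ v| ≤ 2 * t * ‖v‖ := by
  let f : E →L[ℝ] ℝ := LinearMap.toContinuousLinearMap ℓ
  have hf : ∀ v, f v = ℓ v := fun v => rfl
  have h1 : ‖f‖ ≤ t + ‖f‖ / 2 := by
    refine ContinuousLinearMap.opNorm_le_of_unit_norm (by positivity) fun x hx => ?_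
    obtain ⟨u, hu, hxu⟩ := hN x hx.le
    have h2 : f x = f u + f (x - u) := by rw [← map_add]; congr 1; abel
    rw [h2]
    refine (norm_add_le _ _).trans (add_le_add (ht u hu) ?_)
    refine (f.le_opNorm _).trans ?_
    have := norm_nonneg f
    nlinarith
  have h2 := f.le_opNorm v
  rw [hf, Real.norm_eq_abs] at h2
  have := norm_nonneg v
  nlinarith

end Net

section DiagonalKroneckerSums

variable {L : ℕ}

/-- The diagonal of the Kronecker sum of diagonal matrices, as a linear map. -/
noncomputable def diagSumLinear (d : Fin L → ℕ) :
    (∀ k, Fin (d k) → ℝ) →ₗ[ℝ] EuclideanSpace ℝ (Idx d) where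
  toFun f := WithLp.toLp 2 fun i => ∑ k, f k (i k)
  map_add' f g := by
    ext i
    simp [Finset.sum_add_distrib]
  map_smul' t f := by
    ext i
    simp [Finset.mul_sum]

variable {d : Fin L → ℕ}

lemma diagSumLinear_apply (f : ∀ k, Fin (d k) → ℝ) (i : Idx d) :
    diagSumLinear d f i = ∑ k, f k (i k) := rfl

lemma finrank_range_diagSumLinear_le :
    Module.finrank ℝ (LinearMap.range (diagSumLinear d)) ≤ ∑ k, d k := by
  refine (LinearMap.finrank_range_le _).trans (le_of_eq ?_)
  rw [Module.finrank_pi_fintype]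
  simp

lemma frobNorm_diagonal {ι : Type*} [Fintype ι] [DecidableEq ι] (v : ι → ℝ) :
    frobNorm (Matrix.diagonal v) = √(∑ i, v i ^ 2) := by
  unfold frobNorm
  congr 1
  refine Finset.sum_congr rfl fun i _ => ?_
  rw [Finset.sum_eq_single i] <;> simp +contextual [eq_comm]

lemma log_totalDim_le_sum (hd : ∀ k, 0 < d k) : Real.log (totalDim d) ≤ ∑ k, (d k : ℝ) := by
  rw [totalDim]
  push_cast
  rw [Real.log_prod fun k _ => by exact_mod_cast (hd k).ne']
  exact Finset.sum_le_sum fun k _ => Real.log_le_self (Nat.cast_nonneg _)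

lemma sum_dim_le_div (hL : 1 ≤ L) (hd : ∀ k, 0 < d k) :
    ∑ k, (d k : ℝ) ≤ L * totalDim d / minCoDim d := by
  rw [le_div_iff₀ (by exact_mod_cast minCoDim_pos hL hd)]
  exact_mod_cast sum_dim_mul_minCoDim_le (d := d)

end DiagonalKroneckerSums

section GoodEvent

lemma five_pow_le_lexp (m : ℕ) {r : ℝ} (hr : m ≤ r) : ((5 ^ m : ℕ) : ENNReal) ≤ lexp (2 * r) := by
  have h5 : (5 : ℝ) ≤ Real.exp 2 := by
    have h1 := Real.exp_one_gt_d9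
    rw [show (2 : ℝ) = 1 + 1 by norm_num, Real.exp_add]
    nlinarith
  rw [← ENNReal.ofReal_natCast]
  refine ENNReal.ofReal_le_ofReal ?_
  push_cast
  calc (5 : ℝ) ^ m ≤ Real.exp 2 ^ m := by gcongr
    _ = Real.exp (m * 2) := (Real.exp_nat_mul 2 m).symm
    _ ≤ _ := Real.exp_le_exp.2 (by linarith)

lemma opNorm_modeEmbed_single_le {L : ℕ} {d : Fin L → ℕ} (k : Fin L) (a b : Fin (d k)) :
    frobNorm (Matrix.single a b (1 : ℝ)) = 1 ∧
      opNorm (modeEmbed k (Matrix.single a b (1 : ℝ))) ≤ 1 := by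
  have h : frobNorm (Matrix.single a b (1 : ℝ)) = 1 := by
    unfold frobNorm
    rw [Real.sqrt_eq_one, Finset.sum_eq_single a, Finset.sum_eq_single b]
    · simp
    · intro j _ hj; simp [hj.symm]
    · simp
    · intro i _ hi; simp [hi.symm]
    · simp
  exact ⟨h, (opNorm_modeEmbed_le k _).trans h.le⟩

lemma sum_sq_dim_mul_exp_le {L : ℕ} (hL : 1 ≤ L) {d : Fin L → ℕ} (hd : ∀ k, 0 < d k)
    (hp : 2 ≤ totalDim d) :
    (∑ k, (d k : ℝ) * d k + 1) * (2 * Real.exp (-(5 * Real.log (totalDim d)))) ≤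
      L * Real.exp (-1 * Real.log (totalDim d)) := by
  have hp2 : (2 : ℝ) ≤ totalDim d := by exact_mod_cast hp
  set x := Real.exp (-1 * Real.log (totalDim d)) with hx
  have hx0 : 0 < x := Real.exp_pos _
  have hxp : x * totalDim d = 1 := by
    rw [hx, neg_one_mul, Real.exp_neg, Real.exp_log (by linarith), inv_mul_cancel₀ (by linarith)]
  have hx5 : Real.exp (-(5 * Real.log (totalDim d))) = x ^ 5 := by
    rw [hx, ← Real.exp_nat_mul]; congr 1; push_cast; ring
  have hx2 : x ≤ 1 / 2 := by nlinarith
  have hdk : ∀ k, (d k : ℝ) * x ≤ 1 := by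
    intro k
    have h3 : (d k : ℝ) ≤ totalDim d := by
      rw [totalDim_eq_mul_coDim k]
      exact_mod_cast Nat.le_mul_of_pos_right _ (coDim_pos hd k)
    calc (d k : ℝ) * x ≤ totalDim d * x := by gcongr
      _ = 1 := by rw [mul_comm, hxp]
  have h4 : (∑ k, (d k : ℝ) * d k) * x ^ 2 ≤ L := by
    rw [Finset.sum_mul]
    calc ∑ k, (d k : ℝ) * d k * x ^ 2 ≤ ∑ _k : Fin L, (1 : ℝ) := by
          refine Finset.sum_le_sum fun k _ => ?_
          have h5 : 0 ≤ (d k : ℝ) * x := by positivity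
          calc (d k : ℝ) * d k * x ^ 2 = ((d k : ℝ) * x) ^ 2 := by ring
            _ ≤ 1 := pow_le_one₀ h5 (hdk k)
      _ = L := by simp
  have hL1 : (1 : ℝ) ≤ L := by exact_mod_cast hL
  have hx3 : x ^ 2 ≤ 1 / 4 := by nlinarith
  have h6 : (∑ k, (d k : ℝ) * d k + 1) * x ^ 2 ≤ 2 * L := by
    rw [add_mul, one_mul]; linarith
  calc (∑ k, (d k : ℝ) * d k + 1) * (2 * Real.exp (-(5 * Real.log (totalDim d))))
      = (∑ k, (d k : ℝ) * d k + 1) * x ^ 2 * (2 * x ^ 2 * x) := by rw [hx5]; ring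
    _ ≤ 2 * L * (2 * (1 / 4) * x) := by gcongr
    _ = L * x := by ring

/-- With high probability the sample covariance is close to its mean, both along the off-diagonal
entries of the factors and uniformly along the diagonal Kronecker sums. -/
lemma exists_good_event (K : ℝ) (hK : 0 < K) : ∃ a T c : ℝ, 0 < a ∧ 0 < T ∧ 0 < c ∧
    ∀ {S : Type*} [MeasurableSpace S] (μ : Measure S) [IsProbabilityMeasure μ] {L : ℕ} (_ : 1 ≤ L)
      {d : Fin L → ℕ} (_ : ∀ k, 0 < d k) {n : ℕ} (_ : 0 < n) (Sig : Matrix (Idx d) (Idx d) ℝ)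
      (_ : 0 < opNorm Sig) (X : Fin n → S → Idx d → ℝ)
      (_ : ∀ i, IsSubGaussianTensor μ K Sig (X i)) (_ : iIndepFun X μ) (δ : Fin L → ℝ)
      (_ : 2 ≤ totalDim d) (_ : ∀ k, Real.log (totalDim d) ≤ coDim d k)
      (_ : ∀ k, a * (opNorm Sig * √(Real.log (totalDim d) / (n * coDim d k))) ≤ δ k)
      (_ : (L : ℝ) * (L + 1) * totalDim d ≤ c ^ 2 * (n * (minCoDim d : ℝ) ^ 2)),
      ∃ E : Set S, MeasurableSet E ∧
        1 - L * Real.exp (-1 * Real.log (totalDim d)) ≤ μ.real E ∧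
        ∀ ω ∈ E,
          (∀ k a b, |deviation (fun i => X i ω) Sig (modeEmbed k (Matrix.single a b 1))| ≤
            coDim d k * δ k) ∧
          ∀ f : ∀ k, Fin (d k) → ℝ,
            |deviation (fun i => X i ω) Sig (Matrix.diagonal fun i => ∑ k, f k (i k))| ≤
              T * opNorm Sig * √(L * totalDim d / (n * minCoDim d)) *
                frobNorm (Matrix.diagonal fun i : Idx d => ∑ k, f k (i k)) := by
  obtain ⟨C, c', hC, hc', htail⟩ := exists_deviation_tail K hK
  set c := min c' 1 with hcdef
  have hc : 0 < c := lt_min hc' one_pos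
  refine ⟨(5 + C * c ^ 2) / c, 2 * (C + 7), c, by positivity, by positivity, hc, ?_⟩
  intro S _ μ _ L hL d hd n hn Sig hSig X hX hind δ hp hlogm hδ hbig
  set p : ℝ := (totalDim d : ℝ) with hpdef
  set σ := opNorm Sig with hσ
  have hp2 : (2 : ℝ) ≤ p := by rw [hpdef]; exact_mod_cast hp
  have hlog0 : 0 ≤ Real.log p := Real.log_nonneg (by linarith)
  have hn0 : (0 : ℝ) < n := by exact_mod_cast hn
  have hn1 : (1 : ℝ) ≤ n := by exact_mod_cast hn
  have hm0 : (0 : ℝ) < minCoDim d := by exact_mod_cast minCoDim_pos hL hd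
  have hL0 : (0 : ℝ) < L := by exact_mod_cast hL
  have hmeasX : ∀ i, Measurable (X i) := fun i => (hX i).measurable
  -- off-diagonal entries of the factors
  have hoff : ∀ x : Σ k, Fin (d k) × Fin (d k),
      μ {ω | coDim d x.1 * δ x.1 <
        |deviation (fun i => X i ω) Sig (modeEmbed x.1 (Matrix.single x.2.1 x.2.2 1))|} ≤
      2 * lexp (-(5 * Real.log p)) := by
    rintro ⟨k, a, b⟩
    obtain ⟨hF1, hop⟩ := opNorm_modeEmbed_single_le (d := d) k a b
    set M : Matrix (Idx d) (Idx d) ℝ := modeEmbed k (Matrix.single a b 1) with hM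
    have hmk : (0 : ℝ) < coDim d k := by exact_mod_cast coDim_pos hd k
    have hF : frobNorm M ^ 2 = coDim d k := by
      rw [hM, frobNorm_modeEmbed_sq hd, hF1]; ring
    set q := √(Real.log p / (n * coDim d k)) with hq
    have hq0 : 0 ≤ q := Real.sqrt_nonneg _
    have hq2 : n * coDim d k * q ^ 2 = Real.log p := by
      rw [hq, Real.sq_sqrt (by positivity)]; field_simp
    have hq1 : q ≤ 1 := by
      rw [hq, Real.sqrt_le_left zero_le_one, one_pow, div_le_one (by positivity)]
      have := hlogm k
      nlinarith
    refine (htail μ hn Sig X hX hind M (c * q / σ) (coDim d k * δ k) (by positivity) ?_).trans ?_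
    · have e : c * q / σ * (σ * opNorm M) = c * (q * opNorm M) := by field_simp
      rw [← hσ, e]
      have h1 : q * opNorm M ≤ 1 := mul_le_one₀ hq1 (opNorm_nonneg _) hop
      calc c * (q * opNorm M) ≤ c * 1 := by gcongr
        _ ≤ c' := by rw [mul_one]; exact min_le_left _ _
    · gcongr
      refine lexp_mono ?_
      have h1 : (5 + C * c ^ 2) * Real.log p ≤ c * q / σ * n * (coDim d k * δ k) := by
        calc (5 + C * c ^ 2) * Real.log p
            = c * q / σ * n * (coDim d k * ((5 + C * c ^ 2) / c * (σ * q))) := by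
              rw [← hq2]; field_simp
          _ ≤ _ := by
              have := hδ k
              gcongr
      have h2 : C * n * (c * q / σ) ^ 2 * (σ * frobNorm M) ^ 2 = C * c ^ 2 * Real.log p := by
        rw [mul_pow σ, hF, ← hq2]; field_simp
      rw [← hσ, h2]
      linarith
  -- diagonal Kronecker sums
  let V := LinearMap.range (diagSumLinear d)
  obtain ⟨N, hNcard, hN1, hNnet⟩ := exists_half_net V
  set r : ℝ := L * p / minCoDim d with hr
  have hr0 : 0 ≤ r := by positivity
  have hdr : ∑ k, (d k : ℝ) ≤ r := sum_dim_le_div hL hd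
  have hlogr : Real.log p ≤ r := (log_totalDim_le_sum hd).trans hdr
  set q := √(L * p / (n * minCoDim d)) with hq
  have hq0 : 0 ≤ q := Real.sqrt_nonneg _
  have hq2 : n * q ^ 2 = r := by
    rw [hq, Real.sq_sqrt (by positivity), hr]; field_simp
  have hdiag : ∀ u ∈ N, μ {ω | (C + 7) * σ * q <
      |deviation (fun i => X i ω) Sig (Matrix.diagonal (u : EuclideanSpace ℝ (Idx d)))|} ≤
      2 * lexp (-(7 * r)) := by
    rintro ⟨u, f, rfl⟩ hu
    set M : Matrix (Idx d) (Idx d) ℝ := Matrix.diagonal (diagSumLinear d f).ofLp with hM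
    have hMk : M = kroneckerSum fun k => Matrix.diagonal (f k) := (kroneckerSum_diagonal f).symm
    have hFM : frobNorm M ≤ 1 := by
      have h1 := hN1 _ hu
      rw [Submodule.coe_norm, EuclideanSpace.norm_eq] at h1
      rw [hM, frobNorm_diagonal]
      simpa using h1
    have hop : opNorm M ≤ √((L + 1) / minCoDim d) := by
      rw [hMk]
      refine (opNorm_kroneckerSum_le hL hd _).trans ?_
      rw [← hMk]
      exact mul_le_of_le_one_right (Real.sqrt_nonneg _) hFM
    refine (htail μ hn Sig X hX hind M (q / σ) ((C + 7) * σ * q) (by positivity) ?_).trans ?_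
    · have e : q / σ * (σ * opNorm M) = q * opNorm M := by field_simp
      rw [← hσ, e]
      calc q * opNorm M ≤ q * √((L + 1) / minCoDim d) := by gcongr
        _ = √(L * p / (n * minCoDim d) * ((L + 1) / minCoDim d)) :=
          (Real.sqrt_mul (by positivity) _).symm
        _ ≤ c := by
          rw [Real.sqrt_le_left hc.le, div_mul_div_comm, div_le_iff₀ (by positivity)]
          linarith
        _ ≤ c' := min_le_left _ _
    · gcongr
      refine lexp_mono ?_
      have h1 : q / σ * n * ((C + 7) * σ * q) = (C + 7) * r := by
        rw [← hq2]; field_simp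
      have h2 : C * n * (q / σ) ^ 2 * (σ * frobNorm M) ^ 2 ≤ C * r := by
        have e : C * n * (q / σ) ^ 2 * (σ * frobNorm M) ^ 2 = C * r * frobNorm M ^ 2 := by
          rw [← hq2]; field_simp
        rw [e]
        have := frobNorm_nonneg M
        exact mul_le_of_le_one_right (by positivity) (pow_le_one₀ this hFM)
      rw [← hσ, h1]
      linarith
  let B₁ : Set S := ⋃ x : Σ k, Fin (d k) × Fin (d k), {ω | coDim d x.1 * δ x.1 <
    |deviation (fun i => X i ω) Sig (modeEmbed x.1 (Matrix.single x.2.1 x.2.2 1))|}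
  let B₂ : Set S := ⋃ u ∈ N, {ω | (C + 7) * σ * q <
    |deviation (fun i => X i ω) Sig (Matrix.diagonal (u : EuclideanSpace ℝ (Idx d)))|}
  have hB₁m : MeasurableSet B₁ := MeasurableSet.iUnion fun x =>
    measurableSet_lt measurable_const (measurable_deviation hmeasX _ _).abs
  have hB₂m : MeasurableSet B₂ := Finset.measurableSet_biUnion N fun u _ =>
    measurableSet_lt measurable_const (measurable_deviation hmeasX _ _).abs
  have hB₁ : μ B₁ ≤ ((∑ k, d k * d k : ℕ) : ENNReal) * (2 * lexp (-(5 * Real.log p))) := by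
    refine (measure_iUnion_fintype_le μ _).trans ((Finset.sum_le_sum fun x _ => hoff x).trans ?_)
    rw [Finset.sum_const, Finset.card_univ, nsmul_eq_mul, Fintype.card_sigma]
    simp
  have hB₂ : μ B₂ ≤ 2 * lexp (-(5 * Real.log p)) := by
    refine (measure_biUnion_finset_le N _).trans ((Finset.sum_le_sum hdiag).trans ?_)
    rw [Finset.sum_const, nsmul_eq_mul]
    have h1 : (N.card : ENNReal) ≤ lexp (2 * r) := by
      refine le_trans ?_ (five_pow_le_lexp (∑ k, d k) (by push_cast; exact hdr))
      have h5 : 5 ^ Module.finrank ℝ V ≤ 5 ^ ∑ k, d k :=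
        Nat.pow_le_pow_right (by norm_num) finrank_range_diagSumLinear_le
      exact_mod_cast hNcard.trans h5
    calc (N.card : ENNReal) * (2 * lexp (-(7 * r))) ≤ lexp (2 * r) * (2 * lexp (-(7 * r))) := by
          gcongr
      _ = 2 * lexp (-(5 * r)) := by
          rw [mul_left_comm, ← lexp_add]; congr 2; ring
      _ ≤ _ := by
          gcongr
          exact lexp_mono (by linarith)
  refine ⟨(B₁ ∪ B₂)ᶜ, (hB₁m.union hB₂m).compl, ?_, ?_⟩
  · rw [probReal_compl_eq_one_sub (hB₁m.union hB₂m)]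
    refine sub_le_sub_left ?_ 1
    have h1 : μ (B₁ ∪ B₂) ≤ ENNReal.ofReal ((∑ k, (d k : ℝ) * d k + 1) *
        (2 * Real.exp (-(5 * Real.log p)))) := by
      refine (measure_union_le _ _).trans ((add_le_add hB₁ hB₂).trans (le_of_eq ?_))
      rw [lexp, add_mul, one_mul, ENNReal.ofReal_add (by positivity) (by positivity),
        ENNReal.ofReal_mul (by positivity), ENNReal.ofReal_mul (by norm_num), ENNReal.ofReal_ofNat,
        ← ENNReal.ofReal_natCast]
      push_cast
      rfl
    exact (ENNReal.toReal_le_of_le_ofReal (by positivity) h1).trans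
      (sum_sq_dim_mul_exp_le hL hd hp)
  · intro ω hω
    rw [Set.mem_compl_iff, Set.mem_union, not_or] at hω
    obtain ⟨hω₁, hω₂⟩ := hω
    refine ⟨fun k a b => ?_, fun f => ?_⟩
    · by_contra hcon
      exact hω₁ (Set.mem_iUnion.2 ⟨⟨k, a, b⟩, not_le.1 hcon⟩)
    · let ℓ : V →ₗ[ℝ] ℝ :=
        { toFun := fun u => deviation (fun i => X i ω) Sig
            (Matrix.diagonal (u : EuclideanSpace ℝ (Idx d)))
          map_add' := fun u w => by
            rw [← deviation_add, Matrix.diagonal_add]; rfl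
          map_smul' := fun t u => by
            rw [RingHom.id_apply, smul_eq_mul, ← deviation_smul, ← Matrix.diagonal_smul]; rfl }
      have h1 := abs_le_of_abs_le_on_net hNnet ℓ (t := (C + 7) * σ * q) (by positivity)
        (fun u hu => by
          by_contra hcon
          exact hω₂ (Set.mem_biUnion hu (not_le.1 hcon)))
        ⟨diagSumLinear d f, f, rfl⟩
      have h2 : ‖(⟨diagSumLinear d f, f, rfl⟩ : V)‖ =
          frobNorm (Matrix.diagonal fun i : Idx d => ∑ k, f k (i k)) := by
        rw [Submodule.coe_norm, EuclideanSpace.norm_eq, frobNorm_diagonal]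
        simp [diagSumLinear_apply]
      rw [h2] at h1
      refine h1.trans (le_of_eq ?_)
      ring

end GoodEvent

section Penalty

variable {L : ℕ} {d : Fin L → ℕ}

lemma modeEmbed_eq_sum_single (k : Fin L) (B : Matrix (Fin (d k)) (Fin (d k)) ℝ) :
    modeEmbed k B = ∑ x : Fin (d k) × Fin (d k), B x.1 x.2 • modeEmbed k (Matrix.single x.1 x.2 1) := by
  let φ : Matrix (Fin (d k)) (Fin (d k)) ℝ →ₗ[ℝ] Matrix (Idx d) (Idx d) ℝ :=
    { toFun := modeEmbed k, map_add' := modeEmbed_add k, map_smul' := modeEmbed_smul k }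
  have hB : B = ∑ x : Fin (d k) × Fin (d k), B x.1 x.2 • Matrix.single x.1 x.2 (1 : ℝ) := by
    rw [Fintype.sum_prod_type]
    conv_lhs => rw [Matrix.matrix_eq_sum_single B]
    simp
  calc modeEmbed k B = φ B := rfl
    _ = _ := by
      conv_lhs => rw [hB]
      rw [map_sum]
      simp only [map_smul]
      rfl

lemma offNorm_eq_sum {q : ℕ} (A : Matrix (Fin q) (Fin q) ℝ) :
    offNorm A = ∑ x : Fin q × Fin q, |offPart A x.1 x.2| := by
  rw [offNorm, Fintype.sum_prod_type]
  refine Finset.sum_congr rfl fun a _ => ?_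
  rw [← Finset.add_sum_erase _ _ (Finset.mem_univ a), offPart_apply_self, abs_zero, zero_add]
  exact Finset.sum_congr rfl fun b hb => by rw [offPart_apply_ne A (Finset.ne_of_mem_erase hb).symm]

lemma offSupport_eq_card {q : ℕ} (A : Matrix (Fin q) (Fin q) ℝ) :
    offSupport A = (Finset.univ.filter fun x : Fin q × Fin q => offPart A x.1 x.2 ≠ 0).card := by
  classical
  rw [offSupport, ← Set.ncard_coe_finset]
  congr 1
  ext ⟨a, b⟩
  by_cases h : a = b
  · subst h; simp [offPart_apply_self]
  · simp [offPart_apply_ne A h, h]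

lemma offPart_add {q : ℕ} (A B : Matrix (Fin q) (Fin q) ℝ) :
    offPart (A + B) = offPart A + offPart B := by
  ext a b
  by_cases h : a = b
  · subst h; simp [offPart_apply_self]
  · simp [offPart_apply_ne _ h]

/-- The `ℓ₁`-norm of an off-diagonal part on the support of `Ψ`. -/
noncomputable def supportNorm {q : ℕ} (Ψ A : Matrix (Fin q) (Fin q) ℝ) : ℝ :=
  ∑ x ∈ Finset.univ.filter fun x : Fin q × Fin q => offPart Ψ x.1 x.2 ≠ 0, |offPart A x.1 x.2|

lemma supportNorm_nonneg {q : ℕ} (Ψ A : Matrix (Fin q) (Fin q) ℝ) : 0 ≤ supportNorm Ψ A :=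
  Finset.sum_nonneg fun _ _ => abs_nonneg _

lemma supportNorm_le {q : ℕ} (Ψ A : Matrix (Fin q) (Fin q) ℝ) :
    supportNorm Ψ A ≤ √(offSupport Ψ) * frobNorm (offPart A) := by
  refine le_of_sq_le_sq ?_ (mul_nonneg (Real.sqrt_nonneg _) (frobNorm_nonneg _))
  rw [mul_pow, Real.sq_sqrt (Nat.cast_nonneg _), frobNorm_sq, offSupport_eq_card]
  refine sq_sum_le_card_mul_sum_sq.trans ?_
  gcongr
  rw [← Fintype.sum_prod_type' (f := fun a b => offPart A a b ^ 2)]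
  simp only [sq_abs]
  exact Finset.sum_le_sum_of_subset_of_nonneg (Finset.filter_subset _ _) fun _ _ _ => sq_nonneg _

lemma penalty_increment_ge {q : ℕ} (Ψ A : Matrix (Fin q) (Fin q) ℝ) {δ ρ : ℝ}
    (hδρ : δ ≤ ρ) (hρ : 0 ≤ ρ) :
    -(2 * ρ * supportNorm Ψ A) ≤ ρ * (offNorm (Ψ + A) - offNorm Ψ) - δ * offNorm A := by
  rw [offNorm_eq_sum, offNorm_eq_sum, offNorm_eq_sum, supportNorm, Finset.sum_filter,
    ← Finset.sum_sub_distrib, Finset.mul_sum, Finset.mul_sum, Finset.mul_sum,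
    ← Finset.sum_sub_distrib, ← Finset.sum_neg_distrib]
  refine Finset.sum_le_sum fun x _ => ?_
  rw [offPart_add, Matrix.add_apply]
  generalize offPart Ψ x.1 x.2 = y
  generalize offPart A x.1 x.2 = z
  have hz := abs_nonneg z
  by_cases hy : y = 0
  · subst hy
    simp only [zero_add, abs_zero, sub_zero, ne_eq, not_true_eq_false, if_false, mul_zero, neg_zero]
    nlinarith
  · simp only [ne_eq, hy, not_false_eq_true, if_true]
    have h1 : -|z| ≤ |y + z| - |y| := by
      have := abs_add_le (y + z) (-z)
      rw [add_neg_cancel_right, abs_neg] at this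
      linarith
    have h2 := mul_le_mul_of_nonneg_left h1 hρ
    nlinarith

/-- Weighted Cauchy–Schwarz over the modes. -/
lemma sum_coDim_mul_supportNorm_le (hd : ∀ k, 0 < d k)
    (Ψ A : ∀ k, Matrix (Fin (d k)) (Fin (d k)) ℝ) :
    ∑ k, coDim d k * supportNorm (Ψ k) (A k) ≤ √(sparsity Ψ) * frobNorm (kroneckerSum A) := by
  refine (Finset.sum_le_sum fun k _ => mul_le_mul_of_nonneg_left (supportNorm_le (Ψ k) (A k))
    (Nat.cast_nonneg _)).trans ?_
  refine le_of_sq_le_sq ?_ (mul_nonneg (Real.sqrt_nonneg _) (frobNorm_nonneg _))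
  rw [mul_pow, Real.sq_sqrt (Nat.cast_nonneg _)]
  have e : ∀ k, (coDim d k : ℝ) * (√(offSupport (Ψ k)) * frobNorm (offPart (A k))) =
      √(coDim d k * offSupport (Ψ k)) * (√(coDim d k) * frobNorm (offPart (A k))) := by
    intro k
    rw [Real.sqrt_mul (Nat.cast_nonneg _)]
    have := Real.mul_self_sqrt (Nat.cast_nonneg (α := ℝ) (coDim d k))
    nth_rewrite 1 [← this]
    ring
  simp only [e]
  refine (Finset.sum_mul_sq_le_sq_mul_sq _ _ _).trans ?_
  have h1 : ∑ k, √((coDim d k : ℝ) * offSupport (Ψ k)) ^ 2 = sparsity Ψ := by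
    rw [sparsity]
    push_cast
    exact Finset.sum_congr rfl fun k _ => Real.sq_sqrt (by positivity)
  have h2 : ∑ k, (√(coDim d k : ℝ) * frobNorm (offPart (A k))) ^ 2 ≤
      frobNorm (kroneckerSum A) ^ 2 := by
    rw [frobNorm_kroneckerSum_sq hd]
    refine le_add_of_nonneg_of_le (Finset.sum_nonneg fun _ _ => sq_nonneg _) (le_of_eq ?_)
    exact Finset.sum_congr rfl fun k _ => by rw [mul_pow, Real.sq_sqrt (Nat.cast_nonneg _)]
  rw [h1]
  gcongr

/-- The linear part of the objective and the penalty decrease at most at a linear rate. -/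
lemma linear_part_ge (hd : ∀ k, 0 < d k) (W : Matrix (Idx d) (Idx d) ℝ) {δ ρ : Fin L → ℝ}
    {ρ' τ : ℝ} (hδρ : ∀ k, δ k ≤ ρ k) (hρ : ∀ k, 0 ≤ ρ k) (hρ' : ∀ k, ρ k ≤ ρ')
    (hρ'0 : 0 ≤ ρ') (hτ : 0 ≤ τ)
    (hoff : ∀ k a b, |(Wᵀ * modeEmbed k (Matrix.single a b 1)).trace| ≤ coDim d k * δ k)
    (hdiag : ∀ f : ∀ k, Fin (d k) → ℝ,
      |(Wᵀ * Matrix.diagonal fun i : Idx d => ∑ k, f k (i k)).trace| ≤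
        τ * frobNorm (Matrix.diagonal fun i : Idx d => ∑ k, f k (i k)))
    (Ψ A : ∀ k, Matrix (Fin (d k)) (Fin (d k)) ℝ) :
    -((2 * ρ' * √(sparsity Ψ) + τ) * frobNorm (kroneckerSum A)) ≤
      (Wᵀ * kroneckerSum A).trace +
        ∑ k, (coDim d k : ℝ) * ρ k * (offNorm (Ψ k + A k) - offNorm (Ψ k)) := by
  have h1 : -(τ * frobNorm (kroneckerSum A)) ≤
      (Wᵀ * Matrix.diagonal fun i : Idx d => ∑ k, A k (i k) (i k)).trace := by
    refine le_trans ?_ (abs_le.1 (hdiag fun k a => A k a a)).1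
    refine neg_le_neg (mul_le_mul_of_nonneg_left ?_ hτ)
    refine le_of_sq_le_sq ?_ (frobNorm_nonneg _)
    rw [frobNorm_kroneckerSum_sq hd, frobNorm_diagonal,
      Real.sq_sqrt (Finset.sum_nonneg fun _ _ => sq_nonneg _)]
    exact le_add_of_nonneg_right (Finset.sum_nonneg fun k _ => by positivity)
  have h2 : ∀ k, -(coDim d k * (δ k * offNorm (A k))) ≤
      (Wᵀ * modeEmbed k (offPart (A k))).trace := by
    intro k
    rw [modeEmbed_eq_sum_single, Matrix.mul_sum, Matrix.trace_sum, offNorm_eq_sum, ← mul_assoc,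
      Finset.mul_sum, ← Finset.sum_neg_distrib]
    refine Finset.sum_le_sum fun x _ => ?_
    rw [Matrix.mul_smul, Matrix.trace_smul, smul_eq_mul]
    refine le_trans (neg_le_neg ?_) (neg_abs_le _)
    rw [abs_mul, mul_comm]
    exact mul_le_mul_of_nonneg_right (hoff k x.1 x.2) (abs_nonneg _)
  have h3 : (Wᵀ * kroneckerSum A).trace =
      (Wᵀ * Matrix.diagonal fun i : Idx d => ∑ k, A k (i k) (i k)).trace +
        ∑ k, (Wᵀ * modeEmbed k (offPart (A k))).trace := by
    rw [kroneckerSum_eq_diagonal_add, Matrix.mul_add, Matrix.trace_add, Matrix.mul_sum,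
      Matrix.trace_sum]
  have h4 : -(2 * ρ' * ∑ k, coDim d k * supportNorm (Ψ k) (A k)) ≤
      ∑ k, (Wᵀ * modeEmbed k (offPart (A k))).trace +
        ∑ k, (coDim d k : ℝ) * ρ k * (offNorm (Ψ k + A k) - offNorm (Ψ k)) := by
    rw [← Finset.sum_add_distrib, Finset.mul_sum, ← Finset.sum_neg_distrib]
    refine Finset.sum_le_sum fun k _ => ?_
    have h5 := penalty_increment_ge (Ψ k) (A k) (hδρ k) (hρ k)
    have h6 := mul_le_mul_of_nonneg_left h5 (Nat.cast_nonneg (α := ℝ) (coDim d k))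
    have h7 : (coDim d k : ℝ) * supportNorm (Ψ k) (A k) * ρ k ≤
        coDim d k * supportNorm (Ψ k) (A k) * ρ' :=
      mul_le_mul_of_nonneg_left (hρ' k)
        (mul_nonneg (Nat.cast_nonneg _) (supportNorm_nonneg _ _))
    have := h2 k
    linarith
  have h5 := mul_le_mul_of_nonneg_left (sum_coDim_mul_supportNorm_le hd Ψ A)
    (show 0 ≤ 2 * ρ' by linarith)
  rw [h3]
  linarith

end Penalty

section Optimization

variable {L : ℕ} {d : Fin L → ℕ}

lemma matrixObjective_strictConvex (S : Matrix (Idx d) (Idx d) ℝ) {ρ : Fin L → ℝ}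
    (hρ : ∀ k, 0 ≤ ρ k) {A B : Matrix (Idx d) (Idx d) ℝ} (hA : A.PosDef) (hB : B.PosDef)
    {t : ℝ} (ht0 : 0 < t) (ht1 : t < 1) :
    matrixObjective S ρ ((1 - t) • A + t • B) ≤
      (1 - t) * matrixObjective S ρ A + t * matrixObjective S ρ B ∧
    (A ≠ B → matrixObjective S ρ ((1 - t) • A + t • B) <
      (1 - t) * matrixObjective S ρ A + t * matrixObjective S ρ B) := by
  obtain ⟨-, h1, h2⟩ := log_det_strictConcave hA hB ht0 ht1
  have htr : (Sᵀ * ((1 - t) • A + t • B)).trace = (1 - t) * (Sᵀ * A).trace +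
      t * (Sᵀ * B).trace := by
    simp only [Matrix.mul_add, Matrix.mul_smul, Matrix.trace_add, Matrix.trace_smul, smul_eq_mul]
  have hpen : ∑ k, ρ k * ∑ i, ∑ b ∈ Finset.univ.erase (i k),
        |((1 - t) • A + t • B) i (Function.update i k b)| ≤
      (1 - t) * (∑ k, ρ k * ∑ i : Idx d, ∑ b ∈ Finset.univ.erase (i k),
        |A i (Function.update i k b)|) +
      t * ∑ k, ρ k * ∑ i : Idx d, ∑ b ∈ Finset.univ.erase (i k),
        |B i (Function.update i k b)| := by
    rw [Finset.mul_sum, Finset.mul_sum, ← Finset.sum_add_distrib]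
    refine Finset.sum_le_sum fun k _ => ?_
    rw [mul_left_comm, mul_left_comm t, ← mul_add]
    refine mul_le_mul_of_nonneg_left ?_ (hρ k)
    rw [Finset.mul_sum, Finset.mul_sum, ← Finset.sum_add_distrib]
    refine Finset.sum_le_sum fun i _ => ?_
    rw [Finset.mul_sum, Finset.mul_sum, ← Finset.sum_add_distrib]
    refine Finset.sum_le_sum fun b _ => ?_
    rw [Matrix.add_apply, Matrix.smul_apply, Matrix.smul_apply, smul_eq_mul, smul_eq_mul]
    refine (abs_add_le _ _).trans (le_of_eq ?_)
    rw [abs_mul, abs_mul, abs_of_pos ht0, abs_of_pos (sub_pos.2 ht1)]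
  unfold matrixObjective
  rw [htr]
  refine ⟨by linarith, fun hne => ?_⟩
  have := h2 hne
  linarith

lemma continuous_frobNorm_sub (Ω₀ : Matrix (Idx d) (Idx d) ℝ) :
    Continuous fun Ω : Matrix (Idx d) (Idx d) ℝ => frobNorm (Ω - Ω₀) := by
  unfold frobNorm
  simp only [Matrix.sub_apply]
  have : ∀ i j, Continuous fun Ω : Matrix (Idx d) (Idx d) ℝ => Ω i j := fun i j =>
    continuous_id.matrix_elem i j
  fun_prop

lemma continuousOn_matrixObjective (S : Matrix (Idx d) (Idx d) ℝ) (ρ : Fin L → ℝ)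
    {s : Set (Matrix (Idx d) (Idx d) ℝ)} (hs : ∀ Ω ∈ s, Ω.PosDef) :
    ContinuousOn (matrixObjective S ρ) s := by
  unfold matrixObjective
  refine ContinuousOn.add (ContinuousOn.add (ContinuousOn.neg (ContinuousOn.log
    (continuous_id.matrix_det).continuousOn fun Ω hΩ => (hs Ω hΩ).det_pos.ne')) ?_) ?_
  · exact (Continuous.matrix_trace (continuous_const.matrix_mul continuous_id)).continuousOn
  · have : ∀ i j, Continuous fun Ω : Matrix (Idx d) (Idx d) ℝ => Ω i j := fun i j =>
      continuous_id.matrix_elem i j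
    refine Continuous.continuousOn ?_
    fun_prop

lemma abs_entry_le_frobNorm {ι : Type*} [Fintype ι] (A : Matrix ι ι ℝ) (i j : ι) :
    |A i j| ≤ frobNorm A := by
  refine abs_le_of_sq_le_sq ?_ (frobNorm_nonneg _)
  rw [frobNorm_sq]
  exact (Finset.single_le_sum (f := fun j => A i j ^ 2) (fun _ _ => sq_nonneg _)
      (Finset.mem_univ j)).trans
    (Finset.single_le_sum (f := fun i => ∑ j, A i j ^ 2)
      (fun _ _ => Finset.sum_nonneg fun _ _ => sq_nonneg _) (Finset.mem_univ i))

lemma isCompact_kroneckerSum_ball (Ω₀ : Matrix (Idx d) (Idx d) ℝ) (R : ℝ) :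
    IsCompact {Ω : Matrix (Idx d) (Idx d) ℝ | Ω ∈ LinearMap.range (kroneckerSumLinear d) ∧
      Ω.IsHermitian ∧ frobNorm (Ω - Ω₀) ≤ R} := by
  have hbox : IsCompact (Set.pi Set.univ fun i : Idx d => Set.pi Set.univ fun j : Idx d =>
      Set.Icc (Ω₀ i j - R) (Ω₀ i j + R)) :=
    isCompact_univ_pi fun i => isCompact_univ_pi fun j => isCompact_Icc
  refine IsCompact.of_isClosed_subset hbox ?_ ?_
  · refine IsClosed.inter (Submodule.closed_of_finiteDimensional _) (IsClosed.inter ?_ ?_)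
    · exact isClosed_eq (continuous_id.matrix_conjTranspose) continuous_id
    · exact isClosed_le (continuous_frobNorm_sub Ω₀) continuous_const
  · rintro Ω ⟨-, -, h⟩ i - j -
    have h1 := (abs_entry_le_frobNorm (Ω - Ω₀) i j).trans h
    rw [Matrix.sub_apply, abs_le] at h1
    constructor <;> linarith

/-- If the objective grows from `Ω₀` to the sphere of radius `R`, then the minimizer exists, is
unique, and lies within distance `R` of `Ω₀`. -/
lemma existsUnique_estimator (hd : ∀ k, 0 < d k) (S : Matrix (Idx d) (Idx d) ℝ) {ρ : Fin L → ℝ}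
    (hρ : ∀ k, 0 ≤ ρ k) {Ψ : ∀ k, Matrix (Fin (d k)) (Fin (d k)) ℝ} {Ω₀ : Matrix (Idx d) (Idx d) ℝ}
    (hΩ₀ : Ω₀ = kroneckerSum Ψ) (hpd : Ω₀.PosDef) {R : ℝ} (hR : 0 < R)
    (hball : ∀ A : ∀ k, Matrix (Fin (d k)) (Fin (d k)) ℝ, (kroneckerSum A).IsHermitian →
      frobNorm (kroneckerSum A) ≤ R → (Ω₀ + kroneckerSum A).PosDef)
    (hsphere : ∀ A : ∀ k, Matrix (Fin (d k)) (Fin (d k)) ℝ, (kroneckerSum A).IsHermitian →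
      frobNorm (kroneckerSum A) = R →
        matrixObjective S ρ Ω₀ < matrixObjective S ρ (Ω₀ + kroneckerSum A)) :
    (∃! Ωhat, IsEstimator S ρ Ωhat) ∧ ∀ Ωhat, IsEstimator S ρ Ωhat → frobNorm (Ωhat - Ω₀) ≤ R := by
  set F := matrixObjective S ρ with hF
  have hfar : ∀ Φ : ∀ k, Matrix (Fin (d k)) (Fin (d k)) ℝ, (kroneckerSum Φ).PosDef →
      R < frobNorm (kroneckerSum Φ - Ω₀) → F Ω₀ < F (kroneckerSum Φ) := by
    intro Φ hΦ hlt
    set D := frobNorm (kroneckerSum Φ - Ω₀) with hD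
    have hD0 : 0 < D := hR.trans hlt
    have ht0 : 0 < R / D := by positivity
    have ht1 : R / D < 1 := (div_lt_one hD0).2 hlt
    have e1 : kroneckerSum ((R / D) • (Φ - Ψ)) = (R / D) • (kroneckerSum Φ - Ω₀) := by
      rw [kroneckerSum_smul, kroneckerSum_sub, hΩ₀]
    have h1 := hsphere ((R / D) • (Φ - Ψ))
      (by
        rw [e1, Matrix.IsHermitian, Matrix.conjTranspose_smul,
          (hΦ.isHermitian.sub hpd.isHermitian).eq]
        simp)
      (by rw [e1, frobNorm_smul, abs_of_pos ht0, ← hD]; field_simp)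
    have e2 : Ω₀ + kroneckerSum ((R / D) • (Φ - Ψ)) =
        (1 - R / D) • Ω₀ + (R / D) • kroneckerSum Φ := by
      rw [e1, smul_sub, sub_smul, one_smul]; abel
    rw [e2] at h1
    have h2 := (matrixObjective_strictConvex S hρ hpd hΦ ht0 ht1).1
    have h3 := h1.trans_le h2
    rw [← hF] at h3
    nlinarith
  set 𝒦 : Set (Matrix (Idx d) (Idx d) ℝ) := {Ω | Ω ∈ LinearMap.range (kroneckerSumLinear d) ∧
      Ω.IsHermitian ∧ frobNorm (Ω - Ω₀) ≤ R} with h𝒦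
  have h𝒦pd : ∀ Ω ∈ 𝒦, Ω.PosDef := by
    rintro Ω ⟨⟨Φ, hΦ⟩, hherm, hle⟩
    have hΦ' : kroneckerSum Φ = Ω := hΦ
    have e : kroneckerSum (Φ - Ψ) = Ω - Ω₀ := by rw [kroneckerSum_sub, hΦ', hΩ₀]
    have := hball (Φ - Ψ) (by rw [e]; exact hherm.sub hpd.isHermitian) (by rwa [e])
    rwa [e, add_sub_cancel] at this
  have hΩ₀𝒦 : Ω₀ ∈ 𝒦 := ⟨⟨Ψ, hΩ₀.symm⟩, hpd.isHermitian, by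
    rw [sub_self]; simpa [frobNorm] using hR.le⟩
  obtain ⟨Ωs, hΩs, hmin⟩ := (isCompact_kroneckerSum_ball Ω₀ R).exists_isMinOn ⟨Ω₀, hΩ₀𝒦⟩
    (continuousOn_matrixObjective S ρ h𝒦pd)
  have hest : ∀ Ω, IsEstimator S ρ Ω → ∀ Φ : ∀ k, Matrix (Fin (d k)) (Fin (d k)) ℝ,
      (kroneckerSum Φ).PosDef → F Ω ≤ F (kroneckerSum Φ) := by
    rintro Ω ⟨-, Φ₁, rfl, h⟩ Φ hΦ
    have := h Φ hΦ
    rwa [objective_eq_matrixObjective hd, objective_eq_matrixObjective hd] at this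
  have hbound : ∀ Ω, IsEstimator S ρ Ω → frobNorm (Ω - Ω₀) ≤ R := by
    intro Ω hΩ
    by_contra hcon
    have h1 := hest Ω hΩ Ψ (hΩ₀ ▸ hpd)
    obtain ⟨hΩpd, Φ, rfl, -⟩ := hΩ
    have h2 := hfar Φ hΩpd (not_le.1 hcon)
    rw [← hΩ₀] at h1
    linarith
  have hΩsest : IsEstimator S ρ Ωs := by
    obtain ⟨⟨Φ, hΦ⟩, -, -⟩ := id hΩs
    have hΦ' : kroneckerSum Φ = Ωs := hΦ
    refine ⟨h𝒦pd Ωs hΩs, Φ, hΦ'.symm, fun Φ' hΦ'pd => ?_⟩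
    rw [objective_eq_matrixObjective hd, objective_eq_matrixObjective hd, hΦ']
    by_cases hin : frobNorm (kroneckerSum Φ' - Ω₀) ≤ R
    · exact hmin ⟨⟨Φ', rfl⟩, hΦ'pd.isHermitian, hin⟩
    · exact (hmin hΩ₀𝒦).trans (hfar Φ' hΦ'pd (not_le.1 hin)).le
  refine ⟨⟨Ωs, hΩsest, fun Ω hΩ => ?_⟩, hbound⟩
  by_contra hne
  have h1 := hest Ω hΩ
  have h2 := hest Ωs hΩsest
  obtain ⟨hΩpd, Φ, rfl, -⟩ := id hΩ
  obtain ⟨hΩspd, Φs, rfl, -⟩ := id hΩsest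
  have h3 := (matrixObjective_strictConvex S hρ hΩpd hΩspd (t := 1 / 2) (by norm_num)
    (by norm_num)).2 hne
  have e : (1 - 1 / 2 : ℝ) • kroneckerSum Φ + (1 / 2 : ℝ) • kroneckerSum Φs =
      kroneckerSum ((1 - 1 / 2 : ℝ) • Φ + (1 / 2 : ℝ) • Φs) := by
    rw [kroneckerSum_add, kroneckerSum_smul, kroneckerSum_smul]
  have hmid := (log_det_strictConcave hΩpd hΩspd (t := 1 / 2) (by norm_num) (by norm_num)).1
  rw [e] at h3 hmid
  have h4 := h1 _ hmid
  have h5 := h2 _ hmid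
  rw [← hF] at h3
  linarith

end Optimization

section Rate

variable {L : ℕ} {d : Fin L → ℕ}

/-- The deterministic part of the argument: the rate of the estimator when the sample covariance
`S` is close to `Ω₀⁻¹` in the directions that matter. -/
lemma existsUnique_estimator_of_deviation_le (hL : 1 ≤ L) (hd : ∀ k, 0 < d k)
    {Ψ : ∀ k, Matrix (Fin (d k)) (Fin (d k)) ℝ} {Ω₀ : Matrix (Idx d) (Idx d) ℝ}
    (hΩ₀ : Ω₀ = kroneckerSum Ψ) (hpd : Ω₀.PosDef) (S : Matrix (Idx d) (Idx d) ℝ)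
    {δ ρ : Fin L → ℝ} {ρ' τ R : ℝ} (hδρ : ∀ k, δ k ≤ ρ k) (hρ : ∀ k, 0 ≤ ρ k)
    (hρ' : ∀ k, ρ k ≤ ρ') (hρ'0 : 0 ≤ ρ') (hτ : 0 ≤ τ)
    (hoff : ∀ k a b, |((S - Ω₀⁻¹)ᵀ * modeEmbed k (Matrix.single a b 1)).trace| ≤ coDim d k * δ k)
    (hdiag : ∀ f : ∀ k, Fin (d k) → ℝ,
      |((S - Ω₀⁻¹)ᵀ * Matrix.diagonal fun i : Idx d => ∑ k, f k (i k)).trace| ≤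
        τ * frobNorm (Matrix.diagonal fun i : Idx d => ∑ k, f k (i k)))
    (hR : 0 < R) (hsmall : opNorm Ω₀⁻¹ * (√((L + 1) / minCoDim d) * R) ≤ 1 / 5)
    (hgrow : 4 * opNorm Ω₀ ^ 2 * (2 * ρ' * √(sparsity Ψ) + τ) < R) :
    (∃! Ωhat, IsEstimator S ρ Ωhat) ∧
      ∀ Ωhat, IsEstimator S ρ Ωhat → frobNorm (Ωhat - Ω₀) ≤ R := by
  have hop : ∀ A : ∀ k, Matrix (Fin (d k)) (Fin (d k)) ℝ, frobNorm (kroneckerSum A) ≤ R →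
      opNorm Ω₀⁻¹ * opNorm (kroneckerSum A) ≤ 1 / 5 := by
    intro A hA
    refine le_trans ?_ hsmall
    refine mul_le_mul_of_nonneg_left ((opNorm_kroneckerSum_le hL hd A).trans ?_) (opNorm_nonneg _)
    gcongr
  refine existsUnique_estimator hd S hρ hΩ₀ hpd hR
    (fun A hA hle => (neg_log_det_ge hpd hA (hop A hle)).1) fun A hA heq => ?_
  have hcurv := (neg_log_det_ge hpd hA (hop A heq.le)).2
  have hlin := linear_part_ge hd (S - Ω₀⁻¹) hδρ hρ hρ' hρ'0 hτ hoff hdiag Ψ A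
  rw [heq] at hcurv hlin
  have e1 : matrixObjective S ρ Ω₀ = objective S ρ Ψ := by
    rw [objective_eq_matrixObjective hd, hΩ₀]
  have e2 : matrixObjective S ρ (Ω₀ + kroneckerSum A) = objective S ρ (Ψ + A) := by
    rw [objective_eq_matrixObjective hd, kroneckerSum_add, hΩ₀]
  have hsymm : Ω₀⁻¹ᵀ = Ω₀⁻¹ := by
    have := hpd.inv.isHermitian
    rwa [Matrix.IsHermitian, Matrix.conjTranspose_eq_transpose_of_trivial] at this
  have e3 : ((S - Ω₀⁻¹)ᵀ * kroneckerSum A).trace =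
      (Sᵀ * kroneckerSum A).trace - (Ω₀⁻¹ * kroneckerSum A).trace := by
    rw [Matrix.transpose_sub, Matrix.sub_mul, Matrix.trace_sub, hsymm]
  have e4 : objective S ρ (Ψ + A) - objective S ρ Ψ =
      (-Real.log (Ω₀ + kroneckerSum A).det + Real.log Ω₀.det) + (Sᵀ * kroneckerSum A).trace +
        ∑ k, (coDim d k : ℝ) * ρ k * (offNorm (Ψ k + A k) - offNorm (Ψ k)) := by
    simp only [objective, kroneckerSum_add, ← hΩ₀, Matrix.mul_add, Matrix.trace_add, Pi.add_apply,
      mul_sub, Finset.sum_sub_distrib]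
    ring
  rw [e3] at hlin
  rw [e1, e2, ← sub_pos, e4]
  have hM : 0 ≤ 4 * opNorm Ω₀ ^ 2 := by positivity
  set lam := 2 * ρ' * √(sparsity Ψ) + τ with hlam
  set c := -Real.log (Ω₀ + kroneckerSum A).det + Real.log Ω₀.det +
    (Ω₀⁻¹ * kroneckerSum A).trace with hc
  have h1 : lam * R < c := by
    by_contra hcon
    have h2 : 4 * opNorm Ω₀ ^ 2 * c ≤ 4 * opNorm Ω₀ ^ 2 * (lam * R) :=
      mul_le_mul_of_nonneg_left (not_lt.1 hcon) hM
    nlinarith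
  linarith

lemma posDef_of_spectrumWithin {ι : Type*} [Fintype ι] [DecidableEq ι] {A : Matrix ι ι ℝ}
    {lo hi : ℝ} (hlo : 0 < lo) (h : SpectrumWithin A lo hi) : A.PosDef :=
  h.1.posDef_iff_eigenvalues_pos.2 fun i =>
    hlo.trans_le (h.2 _ (h.1.eigenvalues_mem_spectrum_real i)).1

end Rate

end TeraLasso

theorem mainTheorem1 :
    -- `K` bounds the sub-gaussian norms; `a` and `c` depend on `K` only
    ∀ K : ℝ, 0 < K → ∃ a : ℝ, 0 < a ∧ ∃ c : ℝ, 0 < c ∧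
    -- `b` is the upper constant in the order of the penalty levels, `ε₀` a lower bound of the `ε k`
    ∀ b : ℝ, a ≤ b → ∀ ε₀ : ℝ, 0 < ε₀ → ∃ C : ℝ, 0 < C ∧
    ∀ (L : ℕ) (_ : 1 ≤ L) (d : Fin L → ℕ) (_ : ∀ k, 0 < d k) (n : ℕ)
      (Ψ : ∀ k, Matrix (Fin (d k)) (Fin (d k)) ℝ)
      (Ω₀ Sig₀ : Matrix (Idx d) (Idx d) ℝ) (_ : Ω₀ = kroneckerSum Ψ) (_ : Sig₀ = Ω₀⁻¹)
      (S : Type*) (_ : MeasurableSpace S) (μ : Measure S) (_ : IsProbabilityMeasure μ)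
      (X : Fin n → S → Idx d → ℝ)
      (_ : ∀ i, IsSubGaussianTensor μ K Sig₀ (X i))
      (_ : iIndepFun X μ) (_ : ∀ i j, IdentDistrib (X i) (X j) μ μ)
      (δ ε ρ : Fin L → ℝ)
      -- (A1)
      (_ : ∀ k, Real.log (totalDim d) ≤ coDim d k)
      (_ : ∀ k, a * (opNorm Sig₀ * Real.sqrt (Real.log (totalDim d) / (n * coDim d k))) ≤ δ k)
      (_ : ∀ k, δ k ≤ b * (opNorm Sig₀ * Real.sqrt (Real.log (totalDim d) / (n * coDim d k))))
      (_ : ∀ k, ε₀ ≤ ε k ∧ ε k < 1) (_ : ∀ k, ρ k = δ k / ε k)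
      -- (A2)
      (kLow kUp : ℝ) (_ : 0 < kLow) (_ : SpectrumWithin Ω₀ kLow kUp)
      -- (A3)
      (_ : C ^ 2 * (L + 1) * condNumber Sig₀ ^ 4 * complexity Ψ ≤ n * (minCoDim d : ℝ) ^ 2),
      ∃ E : Set S, MeasurableSet E ∧
        1 - L * Real.exp (-c * Real.log (totalDim d)) ≤ μ.real E ∧
        ∀ ω ∈ E,
          (∃! Ωhat, IsEstimator (sampleCov fun i => X i ω) ρ Ωhat) ∧
          ∀ Ωhat, IsEstimator (sampleCov fun i => X i ω) ρ Ωhat →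
            frobNorm (Ωhat - Ω₀) / opNorm Ω₀ ≤
              C * condNumber Sig₀ * Real.sqrt (complexity Ψ / (n * minCoDim d)) ∧
            opNorm (Ωhat - Ω₀) / opNorm Ω₀ ≤
              C * Real.sqrt (L + 1) * condNumber Sig₀ *
                Real.sqrt (complexity Ψ / (n * (minCoDim d : ℝ) ^ 2)) ∧
            frobNorm (Ωhat - Ω₀) / frobNorm Ω₀ ≤
              C * Real.sqrt (L + 1) * condNumber Sig₀ *
                Real.sqrt (complexity Ψ / (n * (minCoDim d : ℝ) ^ 2)) := by

  intro K hK
  obtain ⟨a, T, c₀, ha, hT, hc₀, hgood⟩ := exists_good_event K hK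
  refine ⟨a, ha, 1, one_pos, fun b hab ε₀ hε₀ => ?_⟩
  have hb : 0 < b := ha.trans_le hab
  obtain ⟨B, hB⟩ : ∃ B, B = 2 * (b / ε₀) + T := ⟨_, rfl⟩
  have hB0 : 0 < B := by rw [hB]; positivity
  obtain ⟨C₀, hC₀⟩ : ∃ C₀, C₀ = 4 * B + 1 / c₀ := ⟨_, rfl⟩
  have hC₀B : 4 * B < C₀ := by rw [hC₀]; linarith [show 0 < 1 / c₀ by positivity]
  have hC₀c : 1 ≤ C₀ * c₀ := by
    rw [hC₀, add_mul, one_div_mul_cancel hc₀.ne']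
    nlinarith
  have hC₀0 : 0 < C₀ := by linarith
  refine ⟨5 * C₀, by positivity, ?_⟩
  intro L hL d hd n Ψ Ω₀ Sig₀ hΩ₀ hSig₀ S _ μ _ X hX hind _ δ ε ρ hlogm hδlo hδhi hε hρ
    kLow kUp hkLow hspec hA3
  have hL1 : (1 : ℝ) ≤ L := by exact_mod_cast hL
  rcases Nat.lt_or_ge (totalDim d) 2 with hp | hp
  · refine ⟨∅, MeasurableSet.empty, ?_, by simp⟩
    have h1 : totalDim d = 1 := by have := totalDim_pos hd; omega
    simp [h1, hL1]
  have hp2 : (2 : ℝ) ≤ totalDim d := by exact_mod_cast hp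
  have hlog0 : 0 ≤ Real.log (totalDim d) := Real.log_nonneg (by linarith)
  have hpd : Ω₀.PosDef := posDef_of_spectrumWithin hkLow hspec
  have hdet : IsUnit Ω₀.det := isUnit_iff_ne_zero.2 hpd.det_pos.ne'
  have : Nonempty (Idx d) := ⟨fun k => ⟨0, hd k⟩⟩
  have hone : opNorm Sig₀ * opNorm Ω₀ ≥ 1 := by
    have h1 := opNorm_mul_le Sig₀ Ω₀
    rwa [hSig₀, Matrix.nonsing_inv_mul _ hdet, opNorm_one, ← hSig₀] at h1
  obtain ⟨κ, hκ⟩ : ∃ κ, κ = condNumber Sig₀ := ⟨_, rfl⟩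
  obtain ⟨σ, hσ⟩ : ∃ σ, σ = opNorm Sig₀ := ⟨_, rfl⟩
  obtain ⟨M, hM⟩ : ∃ M, M = opNorm Ω₀ := ⟨_, rfl⟩
  have hκσ : κ = σ * M := by
    rw [hκ, condNumber, hσ, hM, hSig₀, Matrix.nonsing_inv_nonsing_inv _ hdet]
  have hκ1 : 1 ≤ κ := by rw [hκσ, hσ, hM]; exact hone
  have hσ0 : 0 < σ := by
    have := opNorm_nonneg Sig₀
    rw [← hσ] at this
    refine this.lt_of_ne fun h => ?_
    rw [hκσ, ← h, zero_mul] at hκ1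
    linarith
  have hM0 : 0 < M := by
    have := opNorm_nonneg Ω₀
    rw [← hM] at this
    refine this.lt_of_ne fun h => ?_
    rw [hκσ, ← h, mul_zero] at hκ1
    linarith
  obtain ⟨m, hm⟩ : ∃ m : ℝ, m = minCoDim d := ⟨_, rfl⟩
  have hm0 : 0 < m := by rw [hm]; exact_mod_cast minCoDim_pos hL hd
  obtain ⟨p, hpp⟩ : ∃ p : ℝ, p = totalDim d := ⟨_, rfl⟩
  obtain ⟨cx, hcx⟩ : ∃ cx, cx = complexity Ψ := ⟨_, rfl⟩
  obtain ⟨lp, hlp⟩ : ∃ lp, lp = Real.log p := ⟨_, rfl⟩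
  have hcxdef : cx = sparsity Ψ * lp + L * p := by rw [hcx, complexity, hlp, hpp]
  simp only [← hpp, ← hlp, ← hcx, ← hκ, ← hσ, ← hM, ← hm] at hA3 hδlo hδhi hlogm hlog0 hp2 ⊢
  have hsl : 0 ≤ (sparsity Ψ : ℝ) * lp := by positivity
  have hLp : 0 < (L : ℝ) * p := by positivity
  have hcx0 : 0 < cx := by rw [hcxdef]; linarith
  have hn : 0 < n := by
    rcases Nat.eq_zero_or_pos n with h | h
    · exfalso
      rw [h, Nat.cast_zero, zero_mul] at hA3
      have : 0 < (5 * C₀) ^ 2 * (L + 1) * κ ^ 4 * cx := by positivity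
      linarith
    · exact h
  have hn0 : (0 : ℝ) < n := by exact_mod_cast hn
  have hbig : (L : ℝ) * (L + 1) * p ≤ c₀ ^ 2 * (n * m ^ 2) := by
    have hκ4 : 1 ≤ κ ^ 4 := one_le_pow₀ hκ1
    have h1 : (1 : ℝ) ≤ (5 * C₀ * c₀) ^ 2 := one_le_pow₀ (by linarith)
    calc (L : ℝ) * (L + 1) * p = 1 * ((L + 1) * 1 * (L * p)) := by ring
      _ ≤ (5 * C₀ * c₀) ^ 2 * ((L + 1) * κ ^ 4 * cx) := by
        gcongr
        rw [hcxdef]; linarith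
      _ = c₀ ^ 2 * ((5 * C₀) ^ 2 * (L + 1) * κ ^ 4 * cx) := by ring
      _ ≤ _ := by gcongr
  have hgood' := hgood μ hL hd hn Sig₀ (hσ ▸ hσ0) X hX hind δ hp
  simp only [← hpp, ← hlp, ← hσ, ← hm] at hgood'
  obtain ⟨E, hEm, hEp, hE⟩ := hgood' hlogm hδlo hbig
  refine ⟨E, hEm, hEp, fun ω hω => ?_⟩
  obtain ⟨hoff, hdiag⟩ := hE ω hω
  obtain ⟨r, hr⟩ : ∃ r, r = √(cx / (n * m)) := ⟨_, rfl⟩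
  have hr0 : 0 < r := by rw [hr]; positivity
  obtain ⟨q, hq⟩ : ∃ q, q = √((L + 1) / m) := ⟨_, rfl⟩
  have hq0 : 0 ≤ q := by rw [hq]; positivity
  have hqr : q * r = √(L + 1) * √(cx / (n * m ^ 2)) := by
    rw [hq, hr, ← Real.sqrt_mul (by positivity), ← Real.sqrt_mul (by positivity)]
    congr 1
    field_simp
  have hqrκ : C₀ * κ ^ 2 * (q * r) ≤ 1 / 5 := by
    refine abs_le_of_sq_le_sq' ?_ (by norm_num) |>.2
    rw [hqr, mul_pow, mul_pow (√(L + 1)), Real.sq_sqrt (by positivity),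
      Real.sq_sqrt (by positivity), ← mul_div_assoc, ← mul_div_assoc, div_le_iff₀ (by positivity)]
    linarith
  have hδ0 : ∀ k, 0 ≤ δ k := fun k => le_trans (by positivity) (hδlo k)
  have hε0 : ∀ k, 0 < ε k := fun k => hε₀.trans_le (hε k).1
  have hδρ : ∀ k, δ k ≤ ρ k := by
    intro k
    rw [hρ, le_div_iff₀ (hε0 k)]
    exact mul_le_of_le_one_right (hδ0 k) (hε k).2.le
  have hρ' : ∀ k, ρ k ≤ b / ε₀ * (σ * √(lp / (n * m))) := by
    intro k
    have hmk : m ≤ coDim d k := by rw [hm]; exact_mod_cast minCoDim_le k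
    calc ρ k = δ k / ε k := hρ k
      _ ≤ δ k / ε₀ := by
        have := hδ0 k
        have := (hε k).1
        gcongr
      _ ≤ b * (σ * √(lp / (n * coDim d k))) / ε₀ := by
        have := hδhi k
        gcongr
      _ ≤ b * (σ * √(lp / (n * m))) / ε₀ := by gcongr
      _ = _ := by ring
  have hrate : 2 * (b / ε₀ * (σ * √(lp / (n * m)))) * √(sparsity Ψ) +
      T * σ * √(L * p / (n * m)) ≤ B * σ * r := by
    have h1 : √(lp / (n * m)) * √(sparsity Ψ) ≤ r := by
      rw [← Real.sqrt_mul (by positivity), hr]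
      refine Real.sqrt_le_sqrt ?_
      rw [div_mul_eq_mul_div]
      gcongr
      rw [hcxdef]; linarith
    have h2 : √(L * p / (n * m)) ≤ r := by
      rw [hr]
      refine Real.sqrt_le_sqrt ?_
      gcongr
      rw [hcxdef]; linarith
    calc _ = 2 * (b / ε₀) * σ * (√(lp / (n * m)) * √(sparsity Ψ)) +
          T * σ * √(L * p / (n * m)) := by ring
      _ ≤ 2 * (b / ε₀) * σ * r + T * σ * r := by gcongr
      _ = _ := by rw [hB]; ring
  have hdet := existsUnique_estimator_of_deviation_le hL hd hΩ₀ hpd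
    (sampleCov fun i => X i ω) (R := C₀ * κ * M * r) hδρ
    (fun k => (hδ0 k).trans (hδρ k)) hρ' (by positivity) (τ := T * σ * √(L * p / (n * m)))
    (by positivity) (by rw [← hSig₀]; exact hoff) (by rw [← hSig₀]; exact hdiag) (by positivity)
    (by
      rw [← hSig₀, ← hσ, ← hm, ← hq]
      refine le_trans (le_of_eq ?_) hqrκ
      rw [sq κ, hκσ]; ring)
    (by
      rw [← hM]
      calc _ ≤ 4 * M ^ 2 * (B * σ * r) := by gcongr
        _ = 4 * B * (κ * M * r) := by rw [hκσ]; ring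
        _ < C₀ * (κ * M * r) := by gcongr
        _ = _ := by ring)
  refine ⟨hdet.1, fun Ωhat hΩhat => ?_⟩
  have hF := hdet.2 Ωhat hΩhat
  obtain ⟨-, Φ, hΦ, -⟩ := hΩhat
  have hF0 : 0 < frobNorm Ω₀ := by
    refine (frobNorm_nonneg _).lt_of_ne fun h => ?_
    have h0 := frobNorm_eq_zero h.symm
    have h1 := opNorm_smul 0 (1 : Matrix (Idx d) (Idx d) ℝ)
    rw [zero_smul, abs_zero, zero_mul, ← h0, ← hM] at h1
    linarith
  have hκr : 0 ≤ C₀ * κ * r := by positivity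
  have hqr0 : 0 ≤ C₀ * κ * (q * r) := by positivity
  refine ⟨?_, ?_, ?_⟩
  · rw [div_le_iff₀ hM0, ← hr]
    calc frobNorm (Ωhat - Ω₀) ≤ C₀ * κ * r * M := hF.trans_eq (by ring)
      _ ≤ 5 * (C₀ * κ * r) * M := mul_le_mul_of_nonneg_right (by linarith) hM0.le
      _ = _ := by ring
  · have hop : opNorm (Ωhat - Ω₀) ≤ q * frobNorm (Ωhat - Ω₀) := by
      rw [hΦ, hΩ₀, ← kroneckerSum_sub, hq, hm]
      exact opNorm_kroneckerSum_le hL hd _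
    rw [div_le_iff₀ hM0]
    calc opNorm (Ωhat - Ω₀) ≤ q * (C₀ * κ * M * r) := hop.trans (by gcongr)
      _ = C₀ * κ * (q * r) * M := by ring
      _ ≤ 5 * (C₀ * κ * (q * r)) * M := mul_le_mul_of_nonneg_right (by linarith) hM0.le
      _ = _ := by rw [hqr]; ring
  · have hop : M ≤ q * frobNorm Ω₀ := by
      rw [hM, hΩ₀, hq, hm]
      exact opNorm_kroneckerSum_le hL hd _
    rw [div_le_iff₀ hF0]
    calc frobNorm (Ωhat - Ω₀) ≤ C₀ * κ * M * r := hF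
      _ ≤ C₀ * κ * (q * frobNorm Ω₀) * r := by gcongr
      _ = C₀ * κ * (q * r) * frobNorm Ω₀ := by ring
      _ ≤ 5 * (C₀ * κ * (q * r)) * frobNorm Ω₀ :=
        mul_le_mul_of_nonneg_right (by linarith) hF0.le
      _ = _ := by rw [hqr]; ring
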